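/- **Definitions.** A polygonal curve $P$ in $\mathbb{R}^d$ is given by its vertices $p_1,\dots,p_n$, $n\ge 1$, and is viewed as the function on $[1,n]$ with $P(i+\lambda)=(1-\lambda)p_i+\lambda p_{i+1}$ for $1\le i<n$, $\lambda\in[0,1]$ (and $P(1)=p_1$). For curves $P,Q$ with $n$ and $m$ vertices, the *continuous Fréchet distance* is $\inf_{\phi,\psi}\max_{t\in[0,1]}\|P(\phi(t))-Q(\psi(t))\|$, where $\phi,\psi$ range over the continuous non-decreasing functions from $[0,1]$ onto $[1,n]$ and onto $[1,m]$, respectively; the *discrete Fréchet distance* is the same infimum over all non-decreasing functions from $[0,1]$ onto $\{1,\dots,n\}$ and onto $\{1,\dots,m\}$. A *$1.001$-approximation* is an algorithm that, given $P,Q$, computes a number $v$ with $D\le v\le 1.001\,D$, where $D$ is the Fréchet distance of $P$ and $Q$. Algorithms are deterministic programs of one of two random access machines: (a) the RAM with logarithmic cost, whose numbers are natural and rational numbers and where each operation costs the bit length of its operands and results (up to logarithmic factors the Word RAM); (b) the Real RAM, which has in addition to (logarithmic-cost) natural numbers exact real numbers with $+,-,\cdot,/,\sqrt{\ },<$ at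 unit cost, but no rounding. Coordinates of vertices are rational in (a) and real in (b). In (a) a running time $\mathcal{O}(T(n,m))$ of an algorithm on curves is understood up to a factor polynomial in the maximal bit length of the coordinates. *Hypothesis $\mathsf{SETH}'$:* for no $\varepsilon>0$ there is an algorithm that decides the satisfiability of formulas in conjunctive normal form (with clauses of unbounded width) with $N$ variables and $M$ clauses in time $\mathcal{O}((2-\varepsilon)^N)$ times a polynomial in $N$ and $M$. **Theorem.** Let $d\ge 2$ and $\delta>0$, and consider either of the machines (a), (b) and either of the two (continuous or discrete) Fréchet distances. Assume that $\mathsf{SETH}'$ holds for this machine. Then there is no $1.001$-approximation with running time $\mathcal{O}((nm)^{1-\delta})$ on this machine for the Fréchet distance of two polygonal curves in $\mathbb{R}^d$ with $n$ and $m$ vertices, $1\le m\le n$. Moreover, this holds for any polynomial restriction of $1\le m\le n$: for all constants $\gamma\in[0,1]$ and $\eta>0$ there is no such algorithm even for the restriction of the problem to instances with $1\le m\le n$ and $n^{\gamma-\eta}\le m\le n^{\gamma+\eta}$. -/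

import Mathlib

noncomputable section

namespace Frechet

/-! Polygonal curves and the two Fréchet distances -/

/-- The polygonal curve with vertices `p 0, …, p (n - 1)` as a function of the parameter
`t ∈ [0, n - 1]`: at `t = i + lam` with `0 ≤ lam < 1` it takes the value
`(1 - lam) • p i + lam • p (i + 1)`.
(Outside of `[0, n - 1]`, where it is never evaluated, the value is irrelevant.) -/
def polyline {n d : ℕ} [NeZero n] (p : Fin n → EuclideanSpace ℝ (Fin d)) (t : ℝ) :
    EuclideanSpace ℝ (Fin d) :=
  let vertex : ℕ → EuclideanSpace ℝ (Fin d) := fun i =>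
    p ⟨min i (n - 1), by have := NeZero.pos n; omega⟩
  (1 - (t - ⌊t⌋₊)) • vertex ⌊t⌋₊ + (t - ⌊t⌋₊) • vertex (⌊t⌋₊ + 1)

/-- The continuous non-decreasing functions from `[0, 1]` onto the parameter interval
`[0, n - 1]` of a curve with `n` vertices. -/
def contReparam (n : ℕ) : Set (unitInterval → ℝ) :=
  {φ | Continuous φ ∧ Monotone φ ∧ Set.range φ = Set.Icc 0 ((n : ℝ) - 1)}

/-- The non-decreasing functions from `[0, 1]` onto the set of (indices of) vertices. -/
def discReparam (n : ℕ) : Set (unitInterval → Fin n) :=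
  {φ | Monotone φ ∧ Function.Surjective φ}

/-- The continuous Fréchet distance: the infimum of all `D` such that some continuous
traversal has width (maximal distance) at most `D`. -/
def contDist {n m d : ℕ} [NeZero n] [NeZero m]
    (p : Fin n → EuclideanSpace ℝ (Fin d)) (q : Fin m → EuclideanSpace ℝ (Fin d)) : ℝ :=
  sInf {D : ℝ | ∃ φ ∈ contReparam n, ∃ ψ ∈ contReparam m,
    ∀ t, ‖polyline p (φ t) - polyline q (ψ t)‖ ≤ D}

/-- The discrete Fréchet distance: the infimum of all `D` such that some discrete
traversal has width (maximal distance) at most `D`. -/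
def discDist {n m d : ℕ}
    (p : Fin n → EuclideanSpace ℝ (Fin d)) (q : Fin m → EuclideanSpace ℝ (Fin d)) : ℝ :=
  sInf {D : ℝ | ∃ φ ∈ discReparam n, ∃ ψ ∈ discReparam m,
    ∀ t, ‖p (φ t) - q (ψ t)‖ ≤ D}

inductive Variant where
  | continuous
  | discrete

def dist {n m d : ℕ} [NeZero n] [NeZero m] (v : Variant)
    (p : Fin n → EuclideanSpace ℝ (Fin d)) (q : Fin m → EuclideanSpace ℝ (Fin d)) : ℝ :=
  match v with
  | .continuous => contDist p q
  | .discrete => discDist p q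

/-! Random access machines -/

/-- The arithmetic of a random access machine: besides natural numbers, which serve as
counters, addresses and words, the machine handles *scalars* (coordinates, distances).
The model says which numbers are scalars, how much an access to a scalar costs, and which
unary operations exist in addition to the field operations and comparisons. -/
structure Model where
  /-- The type of scalars. -/
  S : Type
  /-- The field operations on scalars. -/
  [field : Field S]
  /-- The real number that a scalar stands for. -/
  val : S →+* ℝ
  /-- The cost of accessing a scalar. -/
  size : S → ℕ
  /-- Additional unary operations from scalars to scalars. -/
  Fn : Type
  fn : Fn → S → S
  /-- Additional unary operations from scalars to natural numbers. -/
  Cast : Type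
  cast : Cast → S → ℕ

attribute [instance] Model.field

/-- Number of bits (plus one) of a natural number. -/
def bits (a : ℕ) : ℕ := Nat.size a + 1

/-- The random access machine with logarithmic cost: scalars are rational numbers, an access
to a number costs its number of bits, and rounding to a natural number is available.
Up to logarithmic factors, this is the usual Word RAM. -/
def logCostRAM : Model where
  S := ℚ
  val := Rat.castHom ℝ
  size := fun x => Nat.size x.num.natAbs + bits x.den
  Fn := Empty
  fn := fun o => o.elim
  Cast := Unit
  cast := fun _ x => ⌊x⌋₊

/-- The Real RAM: scalars are arbitrary real numbers, which are accessed at unit cost; square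
roots are available, but no rounding. -/
def realRAM : Model where
  S := ℝ
  val := RingHom.id ℝ
  size := fun _ => 1
  Fn := Unit
  fn := fun _ x => Real.sqrt x
  Cast := Empty
  cast := fun o => o.elim

/-- The memory: registers and arrays of natural numbers, registers and arrays of scalars.
A program mentions only finitely many registers and arrays. -/
structure State (M : Model) where
  reg : ℕ → ℕ
  arr : ℕ → ℕ → ℕ
  sreg : ℕ → M.S
  sarr : ℕ → ℕ → M.S

/-- Operations on natural numbers (truncated subtraction, division with rounding). -/
inductive NatOp where
  | add | sub | mul | div | mod

def NatOp.eval : NatOp → ℕ → ℕ → ℕ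
  | .add, a, b => a + b
  | .sub, a, b => a - b
  | .mul, a, b => a * b
  | .div, a, b => a / b
  | .mod, a, b => a % b

/-- Field operations on scalars. -/
inductive FieldOp where
  | add | sub | mul | div

def FieldOp.eval {K : Type} [Field K] : FieldOp → K → K → K
  | .add, a, b => a + b
  | .sub, a, b => a - b
  | .mul, a, b => a * b
  | .div, a, b => a / b

/-- Elementary instructions; see `Instr.run` for their effect. -/
inductive Instr (M : Model) where
  | const (r a : ℕ)
  | op (o : NatOp) (r s t : ℕ)
  | load (r A s : ℕ)
  | store (A s t : ℕ)
  | ofNat (x r : ℕ)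
  | sop (o : FieldOp) (x y z : ℕ)
  | sload (x A s : ℕ)
  | sstore (A s x : ℕ)
  | fn (o : M.Fn) (x y : ℕ)
  | cast (o : M.Cast) (r x : ℕ)

/-- The effect of an elementary instruction on the memory. -/
def Instr.run {M : Model} : Instr M → State M → State M
  | .const r a, σ => { σ with reg := Function.update σ.reg r a }
  | .op o r s t, σ => { σ with reg := Function.update σ.reg r (o.eval (σ.reg s) (σ.reg t)) }
  | .load r A s, σ => { σ with reg := Function.update σ.reg r (σ.arr A (σ.reg s)) }
  | .store A s t, σ =>
      { σ with arr := Function.update σ.arr A (Function.update (σ.arr A) (σ.reg s) (σ.reg t)) }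
  | .ofNat x r, σ => { σ with sreg := Function.update σ.sreg x (σ.reg r : M.S) }
  | .sop o x y z, σ =>
      { σ with sreg := Function.update σ.sreg x (o.eval (σ.sreg y) (σ.sreg z)) }
  | .sload x A s, σ => { σ with sreg := Function.update σ.sreg x (σ.sarr A (σ.reg s)) }
  | .sstore A s x, σ =>
      { σ with sarr := Function.update σ.sarr A
                (Function.update (σ.sarr A) (σ.reg s) (σ.sreg x)) }
  | .fn o x y, σ => { σ with sreg := Function.update σ.sreg x (M.fn o (σ.sreg y)) }
  | .cast o r x, σ => { σ with reg := Function.update σ.reg r (M.cast o (σ.sreg x)) }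

/-- The cost of an elementary instruction: the sizes of all operands, addresses and results. -/
def Instr.cost {M : Model} : Instr M → State M → ℕ
  | .const _ a, _ => bits a
  | .op o _ s t, σ => bits (σ.reg s) + bits (σ.reg t) + bits (o.eval (σ.reg s) (σ.reg t))
  | .load _ A s, σ => bits (σ.reg s) + bits (σ.arr A (σ.reg s))
  | .store _ s t, σ => bits (σ.reg s) + bits (σ.reg t)
  | .ofNat _ r, σ => bits (σ.reg r) + M.size (σ.reg r : M.S)
  | .sop o _ y z, σ =>
      M.size (σ.sreg y) + M.size (σ.sreg z) + M.size (o.eval (σ.sreg y) (σ.sreg z))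
  | .sload _ A s, σ => bits (σ.reg s) + M.size (σ.sarr A (σ.reg s))
  | .sstore _ s x, σ => bits (σ.reg s) + M.size (σ.sreg x)
  | .fn o _ y, σ => M.size (σ.sreg y) + M.size (M.fn o (σ.sreg y))
  | .cast o _ x, σ => M.size (σ.sreg x) + bits (M.cast o (σ.sreg x))

/-- Comparisons of two registers. -/
inductive Test where
  | lt (r s : ℕ)
  | slt (x y : ℕ)

def Test.holds {M : Model} : Test → State M → Prop
  | .lt r s, σ => σ.reg r < σ.reg s
  | .slt x y, σ => M.val (σ.sreg x) < M.val (σ.sreg y)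

def Test.cost {M : Model} : Test → State M → ℕ
  | .lt r s, σ => bits (σ.reg r) + bits (σ.reg s)
  | .slt x y, σ => M.size (σ.sreg x) + M.size (σ.sreg y)

/-- Programs. -/
inductive Program (M : Model) where
  | basic (i : Instr M)
  | seq (P Q : Program M)
  | cond (b : Test) (P Q : Program M)
  | loop (b : Test) (P : Program M)

/-- `Exec P σ τ t`: started in memory `σ`, the program `P` halts with memory `τ` after
`t` units of time. `cond b P Q` runs `P` or `Q` according to whether `b` holds, and `loop b P`
repeats `P` while `b` holds. -/
inductive Exec {M : Model} : Program M → State M → State M → ℕ → Prop where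
  | basic (i : Instr M) (σ : State M) : Exec (.basic i) σ (i.run σ) (i.cost σ)
  | seq {P Q : Program M} {σ₀ σ₁ σ₂ : State M} {t₁ t₂ : ℕ} :
      Exec P σ₀ σ₁ t₁ → Exec Q σ₁ σ₂ t₂ → Exec (.seq P Q) σ₀ σ₂ (t₁ + t₂)
  | condTrue {b : Test} {P Q : Program M} {σ₀ σ₁ : State M} {t : ℕ} :
      b.holds σ₀ → Exec P σ₀ σ₁ t → Exec (.cond b P Q) σ₀ σ₁ (b.cost σ₀ + t)
  | condFalse {b : Test} {P Q : Program M} {σ₀ σ₁ : State M} {t : ℕ} :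
      ¬ b.holds σ₀ → Exec Q σ₀ σ₁ t → Exec (.cond b P Q) σ₀ σ₁ (b.cost σ₀ + t)
  | loopTrue {b : Test} {P : Program M} {σ₀ σ₁ σ₂ : State M} {t₁ t₂ : ℕ} :
      b.holds σ₀ → Exec P σ₀ σ₁ t₁ → Exec (.loop b P) σ₁ σ₂ t₂ →
        Exec (.loop b P) σ₀ σ₂ (b.cost σ₀ + t₁ + t₂)
  | loopFalse {b : Test} {P : Program M} {σ : State M} :
      ¬ b.holds σ → Exec (.loop b P) σ σ (b.cost σ)

/-- A matrix stored row by row in an array, followed by zeros. -/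
def flatten {a b : ℕ} {α : Type} [Zero α] (f : Fin a → Fin b → α) (k : ℕ) : α :=
  if h : k < a * b then
    f (finProdFinEquiv.symm ⟨k, h⟩).1 (finProdFinEquiv.symm ⟨k, h⟩).2
  else 0

/-! Satisfiability -/

/-- A formula in conjunctive normal form with `N` variables and `K` clauses of unbounded width;
clause `j` consists of the literals `x i`, `i ∈ pos j`, and `¬ x i`, `i ∈ neg j`. -/
structure CNF (N K : ℕ) where
  pos : Fin K → Finset (Fin N)
  neg : Fin K → Finset (Fin N)

def CNF.Satisfiable {N K : ℕ} (F : CNF N K) : Prop :=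
  ∃ a : Fin N → Bool, ∀ j,
    (∃ i ∈ F.pos j, a i = true) ∨ (∃ i ∈ F.neg j, a i = false)

/-- Memory holding a formula: `N` and `K` in the registers `0` and `1`, the incidence matrices
of the positive and the negative literals in the arrays `0` and `1`, and `0` everywhere else. -/
def CNF.input {N K : ℕ} (F : CNF N K) (M : Model) : State M where
  reg := fun r => if r = 0 then N else if r = 1 then K else 0
  arr := fun A =>
    if A = 0 then flatten fun j i => if i ∈ F.pos j then 1 else 0
    else if A = 1 then flatten fun j i => if i ∈ F.neg j then 1 else 0
    else fun _ => 0
  sreg := fun _ => 0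
  sarr := fun _ _ => 0

/-- The hypothesis that, for no `ε > 0`, the satisfiability of formulas in conjunctive normal
form with `N` variables and `K` clauses can be decided in time `(2 - ε) ^ N` times a polynomial
in `N` and `K`. (The answer is given by the final value `1` or not `1` of register `0`.) -/
def SETHPrime (M : Model) : Prop :=
  ¬ ∃ ε : ℝ, 0 < ε ∧ ε < 2 ∧ ∃ (P : Program M) (c : ℝ) (k : ℕ),
    ∀ (N K : ℕ) (F : CNF N K), ∃ (τ : State M) (t : ℕ),
      Exec P (F.input M) τ t ∧
      (t : ℝ) ≤ c * ((N : ℝ) + K + 1) ^ k * (2 - ε) ^ N ∧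
      (τ.reg 0 = 1 ↔ F.Satisfiable)

/-! Approximation algorithms for the Fréchet distance -/

/-- Memory holding two curves given by the coordinates of their vertices: the numbers of vertices
in the registers `0` and `1`, the coordinates in the scalar arrays `0` and `1`, and `0`
everywhere else. -/
def curvesInput {n m d : ℕ} (M : Model) (p : Fin n → Fin d → M.S) (q : Fin m → Fin d → M.S) :
    State M where
  reg := fun r => if r = 0 then n else if r = 1 then m else 0
  arr := fun _ _ => 0
  sreg := fun _ => 0
  sarr := fun A => if A = 0 then flatten p else if A = 1 then flatten q else fun _ => 0

/-- The points of Euclidean space with the given coordinates. -/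
def points {n d : ℕ} (M : Model) (p : Fin n → Fin d → M.S) : Fin n → EuclideanSpace ℝ (Fin d) :=
  fun i => WithLp.toLp 2 fun k => M.val (p i k)

/-- The maximal size of a coordinate. For `realRAM` this is `1`, for `logCostRAM` it is the
maximal bit length. -/
def coordSize {n d : ℕ} (M : Model) (p : Fin n → Fin d → M.S) : ℕ :=
  Finset.univ.sup fun i => Finset.univ.sup fun k => M.size (p i k)

/-- There is an `α`-approximation algorithm for the (continuous or discrete) Fréchet distance of
curves with `n` and `m` vertices in dimension `d`, restricted to the instances with
`1 ≤ m ≤ n` and `R n m`, with running time `O(T n m)`; that is, an algorithm that computes (in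
the scalar register `0`) a number between the Fréchet distance and `α` times the Fréchet distance.
A factor polynomial in the size of the coordinates is allowed in the running time; it is a constant
for `realRAM`, while for `logCostRAM` nothing could be computed without it. -/
def HasApproxAlgorithm (M : Model) (v : Variant) (d : ℕ) (α : ℝ) (R : ℕ → ℕ → Prop)
    (T : ℕ → ℕ → ℝ) : Prop :=
  ∃ (P : Program M) (c : ℝ) (k : ℕ),
    ∀ (n m : ℕ) [NeZero n] [NeZero m], m ≤ n → R n m →
      ∀ (p : Fin n → Fin d → M.S) (q : Fin m → Fin d → M.S),
        ∃ (τ : State M) (t : ℕ),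
          Exec P (curvesInput M p q) τ t ∧
          (t : ℝ) ≤ c * T n m * ((max (coordSize M p) (coordSize M q) : ℕ) : ℝ) ^ k ∧
          dist v (points M p) (points M q) ≤ M.val (τ.sreg 0) ∧
          M.val (τ.sreg 0) ≤ α * dist v (points M p) (points M q)

end Frechet

end

/-! Satisfiability is reduced to finding orthogonal vectors, and this to approximating the Fréchet
distance. Split the variables of a formula into two groups. An assignment of one group yields a 0-1
vector indexed by the clauses, with entry 1 where it makes no literal of the clause true. The
formula is satisfiable iff some vector of the first group is orthogonal to some vector of the second
(`satisfiable_iff`).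

A vector becomes a zigzag, near x = 10 for the first group and near x = 1010 for the second. An
entry 1 moves a vertex away from the other curve, so vertices for the same clause have horizontal
distance 998, 1000 or 1002, the last exactly if both entries are 1. Alternating heights force a
narrow traversal to pass two zigzags in step. The second curve starts and ends at (910,180), which
is close to every vertex of the first curve; around its zigzags it has the vertices (1085,360) and
(1085,0), whose partners on the first curve are the vertices (85,360) and (85,0) that enclose each
zigzag there. If there is an orthogonal pair, the first curve can select its zigzag while the second
one waits, then the second curve selects its own, and both zigzags are passed in step: the distance
is at most 1000 (`dist_le_of_orthogonal`). Conversely, a traversal of width less than 1001.5 has to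
pass some pair of zigzags in step, and this pair is orthogonal (`Narrow.exists_orthogonal`). A
1.001-approximation tells the two cases apart. Upper bounds are proved with discrete traversals and
lower bounds with continuous ones, which covers both distances.

The groups have sizes in ratio q : p, and the curves are padded to U^q and U^p vertices for a common
U. So m = n^(p/q), which realizes any polynomial restriction, and n m is 2^N up to a polynomial
factor. The approximation then takes time 2^((1-δ)N) and writing the curves takes time 2^(Nq/(p+q)),
up to polynomial factors; both beat 2^N.

The rest implements this on the machine. `runs_prepProg` replaces the formula in memory by the
curves, with numbers of O(N + K) bits, so that the cost is the number of steps times a polynomial;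
`exec_satProg` adds the approximation and a comparison with 1001. -/

noncomputable section
namespace Frechet
open Set

/-! ### Linear interpolation and the coordinates of polygonal curves. -/

/-- Linear interpolation of a sequence of real numbers. -/
def interp (f : ℕ → ℝ) (t : ℝ) : ℝ :=
  (1 - (t - ⌊t⌋₊)) * f ⌊t⌋₊ + (t - ⌊t⌋₊) * f (⌊t⌋₊ + 1)

/-- At `t = i + 1` the floor already belongs to the next edge, but the formulas of both edges agree
there. Thus edges may be treated as closed. -/
theorem interp_edge (f : ℕ → ℝ) {t : ℝ} {i : ℕ} (h0 : (i : ℝ) ≤ t) (h1 : t ≤ i + 1) :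
    interp f t = (1 - (t - i)) * f i + (t - i) * f (i + 1) := by
  rcases h1.lt_or_eq with h | h
  · have : ⌊t⌋₊ = i := by
      rw [Nat.floor_eq_iff (le_trans (Nat.cast_nonneg i) h0)]; exact ⟨h0, h⟩
    simp [interp, this]
  · have : ⌊t⌋₊ = i + 1 := by rw [h]; exact_mod_cast Nat.floor_natCast (i + 1)
    simp only [interp, this]
    subst h
    push_cast
    ring

theorem interp_nat (f : ℕ → ℝ) (i : ℕ) : interp f i = f i := by
  rw [interp_edge f le_rfl (by linarith)]; ring

theorem polyline_edge {n d : ℕ} [NeZero n] (p : Fin n → EuclideanSpace ℝ (Fin d)) {t : ℝ} {i : ℕ}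
    (h0 : (i : ℝ) ≤ t) (h1 : t ≤ i + 1) (hi : i + 1 < n) :
    polyline p t = (1 - (t - i)) • p ⟨i, by omega⟩ + (t - i) • p ⟨i + 1, hi⟩ := by
  rcases h1.lt_or_eq with h | h
  · have : ⌊t⌋₊ = i := by
      rw [Nat.floor_eq_iff (le_trans (Nat.cast_nonneg i) h0)]; exact ⟨h0, h⟩
    have e1 : min i (n - 1) = i := by omega
    have e2 : min (i + 1) (n - 1) = i + 1 := by omega
    simp [polyline, this, e1, e2]
  · have : ⌊t⌋₊ = i + 1 := by rw [h]; exact_mod_cast Nat.floor_natCast (i + 1)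
    have e2 : min (i + 1) (n - 1) = i + 1 := by omega
    subst h
    simp [polyline, this, e2]

theorem polyline_nat {n d : ℕ} [NeZero n] (p : Fin n → EuclideanSpace ℝ (Fin d)) (i : Fin n) :
    polyline p (i : ℕ) = p i := by
  have e1 : min (i : ℕ) (n - 1) = i := by have := i.2; omega
  simp [polyline, e1]

/-- The coordinates of a polygonal curve, when the vertices are given by a sequence that is
constant from `n - 1` on. -/
theorem polyline_apply {n d : ℕ} [NeZero n] (p : Fin n → EuclideanSpace ℝ (Fin d)) (k : Fin d)
    (f : ℕ → ℝ) (hf : ∀ i : Fin n, p i k = f i) (hc : ∀ i, n - 1 ≤ i → f i = f (n - 1)) (t : ℝ) :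
    polyline p t k = interp f t := by
  have key : ∀ i : ℕ, f (min i (n - 1)) = f i := by
    intro i
    rcases le_total i (n - 1) with h | h
    · rw [min_eq_left h]
    · rw [min_eq_right h, hc i h]
  simp [polyline, interp, hf, key]

/-! ### Staircase paths of index pairs. -/

/-- Pairs that are reached from `(0, 0)` by a staircase path through pairs in `C`. -/
inductive Reach (C : ℕ → ℕ → Prop) : ℕ → ℕ → Prop
  | zero : C 0 0 → Reach C 0 0
  | step {i j i' j' : ℕ} : Reach C i j → i ≤ i' → i' ≤ i + 1 → j ≤ j' → j' ≤ j + 1 → C i' j' →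
      Reach C i' j'

theorem Reach.left {C : ℕ → ℕ → Prop} {i j : ℕ} (h : Reach C i j) {i' : ℕ} (hi : i ≤ i')
    (hC : ∀ k, i < k → k ≤ i' → C k j) : Reach C i' j := by
  induction i', hi using Nat.le_induction with
  | base => exact h
  | succ k hk ih =>
    exact .step (ih fun l h1 h2 => hC l h1 (by omega)) (by omega) le_rfl le_rfl (by omega)
      (hC _ (by omega) le_rfl)

theorem Reach.right {C : ℕ → ℕ → Prop} {i j : ℕ} (h : Reach C i j) {j' : ℕ} (hj : j ≤ j')
    (hC : ∀ k, j < k → k ≤ j' → C i k) : Reach C i j' := by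
  induction j', hj using Nat.le_induction with
  | base => exact h
  | succ k hk ih =>
    exact .step (ih fun l h1 h2 => hC l h1 (by omega)) le_rfl (by omega) (by omega) le_rfl
      (hC _ (by omega) le_rfl)

theorem Reach.diag {C : ℕ → ℕ → Prop} {i j : ℕ} (h : Reach C i j) (l : ℕ)
    (hC : ∀ k, k < l → C (i + k + 1) (j + k + 1)) : Reach C (i + l) (j + l) := by
  induction l with
  | zero => exact h
  | succ k ih =>
    exact .step (ih fun l h1 => hC l (by omega)) (by omega) (by omega) (by omega) (by omega)
      (hC _ (by omega))

/-- After time `T` the path stays at its end, so that the conditions on steps and on `C` hold at all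
natural times. -/
theorem Reach.exists_path {C : ℕ → ℕ → Prop} {i j : ℕ} (h : Reach C i j) :
    ∃ (T : ℕ) (I J : ℕ → ℕ), I 0 = 0 ∧ J 0 = 0 ∧ I T = i ∧ J T = j ∧
      (∀ k, I k ≤ I (k + 1) ∧ I (k + 1) ≤ I k + 1) ∧
      (∀ k, J k ≤ J (k + 1) ∧ J (k + 1) ≤ J k + 1) ∧ ∀ k, C (I k) (J k) := by
  induction h with
  | zero h => exact ⟨0, fun _ => 0, fun _ => 0, by simp [h]⟩
  | @step i j i' j' _ h1 h2 h3 h4 h5 ih =>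
    obtain ⟨T, I, J, a1, a2, a3, a4, a5, a6, a7⟩ := ih
    refine ⟨T + 1, fun k => if k ≤ T then I k else i', fun k => if k ≤ T then J k else j',
      by simp [a1], by simp [a2], by simp, by simp, fun k => ?_, fun k => ?_, fun k => ?_⟩
    · have := a5 k
      rcases lt_trichotomy k T with h | h | h
      · simpa [h.le, Nat.succ_le_iff.2 h] using this
      · subst h; simp [a3, h1, h2]
      · simp [h.not_ge, show ¬ k + 1 ≤ T by omega]
    · have := a6 k
      rcases lt_trichotomy k T with h | h | h
      · simpa [h.le, Nat.succ_le_iff.2 h] using this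
      · subst h; simp [a4, h3, h4]
      · simp [h.not_ge, show ¬ k + 1 ≤ T by omega]
    · by_cases h : k ≤ T <;> simp [h, a7, h5]

theorem monotone_of_path {I : ℕ → ℕ} (h : ∀ k, I k ≤ I (k + 1) ∧ I (k + 1) ≤ I k + 1) :
    Monotone I := monotone_nat_of_le_succ fun k => (h k).1

theorem exists_of_path {I : ℕ → ℕ} (h : ∀ k, I k ≤ I (k + 1) ∧ I (k + 1) ≤ I k + 1)
    (h0 : I 0 = 0) (T v : ℕ) (hv : v ≤ I T) : ∃ k ≤ T, I k = v := by
  induction T with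
  | zero => exact ⟨0, le_rfl, by omega⟩
  | succ T ih =>
    by_cases hT : v ≤ I T
    · obtain ⟨k, hk, e⟩ := ih hT; exact ⟨k, by omega, e⟩
    · exact ⟨T + 1, le_rfl, by have := h T; omega⟩

/-! ### From staircase paths to traversals and back. -/

/-- The vertices of a discrete traversal along a path. -/
theorem floor_mem_discReparam {n : ℕ} (T : ℕ) (I : ℕ → ℕ) (h0 : I 0 = 0) (hT : I T + 1 = n)
    (hI : ∀ k, I k ≤ I (k + 1) ∧ I (k + 1) ≤ I k + 1)
    (hb : ∀ t : unitInterval, I ⌊(t : ℝ) * T⌋₊ < n) :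
    (fun t : unitInterval => (⟨I ⌊(t : ℝ) * T⌋₊, hb t⟩ : Fin n)) ∈ discReparam n := by
  refine ⟨fun s t hst => ?_, fun v => ?_⟩
  · exact monotone_of_path hI (Nat.floor_mono (mul_le_mul_of_nonneg_right hst (Nat.cast_nonneg T)))
  · obtain ⟨k, hk, e⟩ := exists_of_path hI h0 T v (by omega)
    rcases Nat.eq_zero_or_pos T with h | h
    · refine ⟨0, Fin.ext ?_⟩
      subst h
      simp [show k = 0 by omega] at e ⊢
      exact e
    · have hT' : (0 : ℝ) < T := by exact_mod_cast h
      refine ⟨⟨k / T, by positivity, (div_le_one hT').2 (by exact_mod_cast hk)⟩, Fin.ext ?_⟩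
      simp [div_mul_cancel₀ _ hT'.ne', e]

/-- The piecewise linear function with values `I k` at `k ≤ T`, constant from `T` on. -/
def ramp (I : ℕ → ℕ) : ℕ → ℝ → ℝ
  | 0, _ => I 0
  | T + 1, s => ramp I T s + ((I (T + 1) : ℝ) - I T) * max 0 (min 1 (s - T))

theorem ramp_of_ge (I : ℕ → ℕ) (T : ℕ) (s : ℝ) (hs : (T : ℝ) ≤ s) : ramp I T s = I T := by
  induction T with
  | zero => rfl
  | succ T ih =>
    push_cast at hs
    rw [ramp, ih (by linarith), min_eq_left (by linarith), max_eq_right (by norm_num)]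
    ring

theorem ramp_edge (I : ℕ → ℕ) (T k : ℕ) (hk : k < T) (s : ℝ) (h0 : (k : ℝ) ≤ s) (h1 : s ≤ k + 1) :
    ramp I T s = I k + (s - k) * ((I (k + 1) : ℝ) - I k) := by
  induction T with
  | zero => omega
  | succ T ih =>
    rcases Nat.lt_succ_iff_lt_or_eq.1 hk with h | h
    · have : (k : ℝ) + 1 ≤ T := by exact_mod_cast h
      rw [ramp, ih h, max_eq_left]
      · ring
      · exact (min_le_right _ _).trans (by linarith)
    · subst h
      rw [ramp, ramp_of_ge I k s h0, min_eq_right (by linarith), max_eq_right (by linarith)]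
      ring

theorem continuous_ramp (I : ℕ → ℕ) (T : ℕ) : Continuous (ramp I T) := by
  induction T with
  | zero => exact continuous_const
  | succ T ih =>
    have : ramp I (T + 1) = fun s => ramp I T s + ((I (T + 1) : ℝ) - I T) *
        max 0 (min 1 (s - T)) := rfl
    rw [this]
    fun_prop

theorem monotone_ramp (I : ℕ → ℕ) (hI : Monotone I) (T : ℕ) : Monotone (ramp I T) := by
  induction T with
  | zero => exact monotone_const
  | succ T ih =>
    intro s t hst
    simp only [ramp]
    have : (0 : ℝ) ≤ (I (T + 1) : ℝ) - I T := sub_nonneg.2 (by exact_mod_cast hI (by omega))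
    have := ih hst
    gcongr

theorem ramp_mem_contReparam {n : ℕ} (T : ℕ) (I : ℕ → ℕ) (h0 : I 0 = 0) (hT : I T + 1 = n)
    (hI : ∀ k, I k ≤ I (k + 1) ∧ I (k + 1) ≤ I k + 1) :
    (fun t : unitInterval => ramp I T ((t : ℝ) * T)) ∈ contReparam n := by
  have hmono := monotone_ramp I (monotone_of_path hI) T
  have hT' : (I T : ℝ) = n - 1 := by rw [← hT]; push_cast; ring
  have e0 : ramp I T 0 = 0 := by
    rcases Nat.eq_zero_or_pos T with h | h
    · subst h; simp [ramp, h0]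
    · rw [ramp_edge I T 0 h 0 (by simp) (by simp)]; simp [h0]
  have e1 : ramp I T T = n - 1 := by rw [ramp_of_ge I T T le_rfl, hT']
  have hc : Continuous (fun t : unitInterval => ramp I T ((t : ℝ) * T)) :=
    (continuous_ramp I T).comp (by fun_prop)
  have hm : Monotone (fun t : unitInterval => ramp I T ((t : ℝ) * T)) := fun s t hst =>
    hmono (mul_le_mul_of_nonneg_right hst (Nat.cast_nonneg T))
  refine ⟨hc, hm, Subset.antisymm ?_ ?_⟩
  · rintro _ ⟨t, rfl⟩
    constructor
    · have := hm (show (0 : unitInterval) ≤ t from t.2.1)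
      simpa [e0] using this
    · have := hm (show t ≤ (1 : unitInterval) from t.2.2)
      simpa [e1] using this
  · rintro x ⟨hx0, hx1⟩
    exact mem_range_of_exists_le_of_exists_ge hc ⟨0, by simpa [e0] using hx0⟩
      ⟨1, by simpa [e1] using hx1⟩

/-- One formula for both kinds of steps of a path: staying at a vertex and moving along an edge. -/
theorem polyline_ramp {n d : ℕ} [NeZero n] (p : Fin n → EuclideanSpace ℝ (Fin d)) {i i' : ℕ}
    (h1 : i ≤ i') (h2 : i' ≤ i + 1) (hi : i < n) (hi' : i' < n) {lam : ℝ} (hl0 : 0 ≤ lam)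
    (hl1 : lam ≤ 1) :
    polyline p (i + lam * ((i' : ℝ) - i)) = (1 - lam) • p ⟨i, hi⟩ + lam • p ⟨i', hi'⟩ := by
  rcases h1.eq_or_lt with h | h
  · subst h
    have := polyline_nat p ⟨i, hi⟩
    simp only at this
    rw [sub_self, mul_zero, add_zero, this, ← add_smul]; simp
  · obtain rfl : i' = i + 1 := by omega
    have e : (i : ℝ) + lam * (((i + 1 : ℕ) : ℝ) - i) = i + lam := by push_cast; ring
    rw [e, polyline_edge p (i := i) (by linarith) (by linarith) hi']
    simp

/-- Closeness of two vertices, given by their indices. -/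
def Close {n m d : ℕ} (p : Fin n → EuclideanSpace ℝ (Fin d)) (q : Fin m → EuclideanSpace ℝ (Fin d))
    (D : ℝ) (i j : ℕ) : Prop :=
  ∃ (hi : i < n) (hj : j < m), ‖p ⟨i, hi⟩ - q ⟨j, hj⟩‖ ≤ D

variable {n m d : ℕ} [NeZero n] [NeZero m] {p : Fin n → EuclideanSpace ℝ (Fin d)}
  {q : Fin m → EuclideanSpace ℝ (Fin d)} {D : ℝ}

/-- During a step both curves move affinely, so the difference of the two positions is a convex
combination of the differences at the ends of the step, and its norm stays at most `D`. -/
theorem exists_contReparam_of_reach (h : Reach (Close p q D) (n - 1) (m - 1)) :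
    ∃ φ ∈ contReparam n, ∃ ψ ∈ contReparam m,
      ∀ t, ‖polyline p (φ t) - polyline q (ψ t)‖ ≤ D := by
  obtain ⟨T, I, J, a1, a2, a3, a4, a5, a6, a7⟩ := h.exists_path
  have hn := NeZero.pos n
  have hm := NeZero.pos m
  refine ⟨_, ramp_mem_contReparam T I a1 (by omega) a5, _,
    ramp_mem_contReparam T J a2 (by omega) a6, fun t => ?_⟩
  have ht0 : 0 ≤ (t : ℝ) * T := mul_nonneg t.2.1 (Nat.cast_nonneg T)
  have ht1 : (t : ℝ) * T ≤ T := mul_le_of_le_one_left (Nat.cast_nonneg T) t.2.2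
  rcases ht1.eq_or_lt with h1 | h1
  · obtain ⟨hi, hj, hC⟩ := a7 T
    simp only [h1, ramp_of_ge I T T le_rfl, ramp_of_ge J T T le_rfl]
    have e1 := polyline_nat p ⟨I T, hi⟩
    have e2 := polyline_nat q ⟨J T, hj⟩
    simp only at e1 e2
    rwa [e1, e2]
  · set s := (t : ℝ) * T with hs
    set k := ⌊s⌋₊ with hk
    have hkT : k < T := (Nat.floor_lt ht0).2 h1
    have hk0 : (k : ℝ) ≤ s := Nat.floor_le ht0
    have hk1 : s ≤ k + 1 := (Nat.lt_floor_add_one s).le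
    obtain ⟨hi, hj, hC⟩ := a7 k
    obtain ⟨hi', hj', hC'⟩ := a7 (k + 1)
    simp only [ramp_edge I T k hkT s hk0 hk1, ramp_edge J T k hkT s hk0 hk1]
    rw [polyline_ramp p (a5 k).1 (a5 k).2 hi hi' (by linarith) (by linarith),
      polyline_ramp q (a6 k).1 (a6 k).2 hj hj' (by linarith) (by linarith)]
    set lam := s - k
    have hl0 : 0 ≤ lam := by simp only [lam]; linarith
    have hl1 : 0 ≤ 1 - lam := by simp only [lam]; linarith
    calc _ = ‖(1 - lam) • (p ⟨I k, hi⟩ - q ⟨J k, hj⟩) +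
          lam • (p ⟨I (k + 1), hi'⟩ - q ⟨J (k + 1), hj'⟩)‖ := by
          congr 1; module
      _ ≤ (1 - lam) * ‖p ⟨I k, hi⟩ - q ⟨J k, hj⟩‖ +
          lam * ‖p ⟨I (k + 1), hi'⟩ - q ⟨J (k + 1), hj'⟩‖ := by
          refine (norm_add_le _ _).trans ?_
          rw [norm_smul, norm_smul, Real.norm_of_nonneg hl0, Real.norm_of_nonneg hl1]
      _ ≤ (1 - lam) * D + lam * D := by gcongr
      _ = D := by ring

theorem exists_discReparam_of_reach (h : Reach (Close p q D) (n - 1) (m - 1)) :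
    ∃ φ ∈ discReparam n, ∃ ψ ∈ discReparam m, ∀ t, ‖p (φ t) - q (ψ t)‖ ≤ D := by
  obtain ⟨T, I, J, a1, a2, a3, a4, a5, a6, a7⟩ := h.exists_path
  have hn := NeZero.pos n
  have hm := NeZero.pos m
  exact ⟨_, floor_mem_discReparam T I a1 (by omega) a5 fun t => (a7 _).1, _,
    floor_mem_discReparam T J a2 (by omega) a6 fun t => (a7 _).2.1, fun t => (a7 _).2.2⟩

/-- Induction on the sum of the two indices. The predecessor of a pair is the visited pair with the
largest smaller sum. If an index grew by more than 1 between them, surjectivity would give a time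
with the value just before the last one, and its sum would lie strictly between the two. -/
theorem reach_of_discReparam {φ : unitInterval → Fin n} {ψ : unitInterval → Fin m}
    (hφ : φ ∈ discReparam n) (hψ : ψ ∈ discReparam m) (h : ∀ t, ‖p (φ t) - q (ψ t)‖ ≤ D) :
    Reach (Close p q D) (n - 1) (m - 1) := by
  obtain ⟨mφ, sφ⟩ := hφ
  obtain ⟨mψ, sψ⟩ := hψ
  have hn := NeZero.pos n
  have hm := NeZero.pos m
  have key : ∀ (l : ℕ) (t : unitInterval), (φ t : ℕ) + ψ t = l →
      Reach (Close p q D) (φ t) (ψ t) := by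
    intro l
    induction l using Nat.strong_induction_on with
    | _ l ih =>
      intro t ht
      have hC : Close p q D (φ t) (ψ t) := ⟨(φ t).2, (ψ t).2, h t⟩
      by_cases hl : l = 0
      · have e1 : (φ t : ℕ) = 0 := by omega
        have e2 : (ψ t : ℕ) = 0 := by omega
        rw [e1, e2] at hC ⊢
        exact .zero hC
      -- the predecessor: among the times of smaller sum, one of maximal sum
      let s : Set ℕ := {k | k < l ∧ ∃ t' : unitInterval, (φ t' : ℕ) + ψ t' = k}
      have hs : s.Nonempty := by
        have h0 : (0 : unitInterval) ≤ t := t.2.1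
        obtain ⟨t1, h1⟩ := sφ ⟨0, hn⟩
        obtain ⟨t2, h2⟩ := sψ ⟨0, hm⟩
        refine ⟨0, by omega, 0, ?_⟩
        have b1 := mφ (show (0 : unitInterval) ≤ t1 from t1.2.1)
        have b2 := mψ (show (0 : unitInterval) ≤ t2 from t2.2.1)
        rw [h1] at b1
        rw [h2] at b2
        have b1' : (φ 0 : ℕ) ≤ 0 := b1
        have b2' : (ψ 0 : ℕ) ≤ 0 := b2
        omega
      have hfin : s.Finite := (finite_Iio l).subset fun k hk => hk.1
      obtain ⟨k, ⟨hkl, t', ht'⟩, hmax⟩ := hfin.exists_maximal hs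
      have hmax' : ∀ t'' : unitInterval, (φ t'' : ℕ) + ψ t'' < l → (φ t'' : ℕ) + ψ t'' ≤ k := by
        intro t'' h''
        by_contra hcon
        exact absurd (hmax ⟨h'', t'', rfl⟩ (by omega)) (by omega)
      have hlt : t' < t := by
        by_contra hcon
        have c1 : (φ t : ℕ) ≤ φ t' := mφ (not_lt.1 hcon)
        have c2 : (ψ t : ℕ) ≤ ψ t' := mψ (not_lt.1 hcon)
        omega
      have c1 : (φ t' : ℕ) ≤ φ t := mφ hlt.le
      have c2 : (ψ t' : ℕ) ≤ ψ t := mψ hlt.le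
      refine .step (ih k hkl t' ht') c1 ?_ c2 ?_ hC
      · by_contra hcon
        obtain ⟨t1, h1⟩ := sφ ⟨φ t - 1, by have := (φ t).2; omega⟩
        have e1 : (φ t1 : ℕ) = φ t - 1 := by rw [h1]
        have l1 : t1 < t := by
          by_contra hc
          have : (φ t : ℕ) ≤ φ t1 := mφ (not_lt.1 hc)
          omega
        have l2 : t' < t1 := by
          by_contra hc
          have : (φ t1 : ℕ) ≤ φ t' := mφ (not_lt.1 hc)
          omega
        have d1 : (ψ t1 : ℕ) ≤ ψ t := mψ l1.le
        have d2 : (ψ t' : ℕ) ≤ ψ t1 := mψ l2.le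
        have := hmax' t1 (by omega)
        omega
      · by_contra hcon
        obtain ⟨t1, h1⟩ := sψ ⟨ψ t - 1, by have := (ψ t).2; omega⟩
        have e1 : (ψ t1 : ℕ) = ψ t - 1 := by rw [h1]
        have l1 : t1 < t := by
          by_contra hc
          have : (ψ t : ℕ) ≤ ψ t1 := mψ (not_lt.1 hc)
          omega
        have l2 : t' < t1 := by
          by_contra hc
          have : (ψ t1 : ℕ) ≤ ψ t' := mψ (not_lt.1 hc)
          omega
        have d1 : (φ t1 : ℕ) ≤ φ t := mφ l1.le
        have d2 : (φ t' : ℕ) ≤ φ t1 := mφ l2.le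
        have := hmax' t1 (by omega)
        omega
  obtain ⟨t1, h1⟩ := sφ ⟨n - 1, by omega⟩
  obtain ⟨t2, h2⟩ := sψ ⟨m - 1, by omega⟩
  have b1 := mφ (show t1 ≤ (1 : unitInterval) from t1.2.2)
  have b2 := mψ (show t2 ≤ (1 : unitInterval) from t2.2.2)
  rw [h1] at b1
  rw [h2] at b2
  have b1' : n - 1 ≤ (φ 1 : ℕ) := b1
  have b2' : m - 1 ≤ (ψ 1 : ℕ) := b2
  have := key _ 1 rfl
  rwa [show (φ 1 : ℕ) = n - 1 by have := (φ 1).2; omega,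
    show (ψ 1 : ℕ) = m - 1 by have := (ψ 1).2; omega] at this

/-- The sum of all vertex distances admits every pair. This makes the sets in both definitions of
distance nonempty; otherwise their `sInf` would be 0 and no lower bound could hold. -/
theorem exists_reach (p : Fin n → EuclideanSpace ℝ (Fin d)) (q : Fin m → EuclideanSpace ℝ (Fin d)) :
    ∃ D, Reach (Close p q D) (n - 1) (m - 1) := by
  have hn := NeZero.pos n
  have hm := NeZero.pos m
  let D := ∑ i, ∑ j, ‖p i - q j‖
  have hC : ∀ i j, i < n → j < m → Close p q D i j := fun i j hi hj => by
    refine ⟨hi, hj, ?_⟩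
    have h1 : ‖p ⟨i, hi⟩ - q ⟨j, hj⟩‖ ≤ ∑ j, ‖p ⟨i, hi⟩ - q j‖ :=
      Finset.single_le_sum (f := fun j => ‖p ⟨i, hi⟩ - q j‖) (fun _ _ => norm_nonneg _)
        (Finset.mem_univ (⟨j, hj⟩ : Fin m))
    have h2 : ∑ j, ‖p ⟨i, hi⟩ - q j‖ ≤ ∑ i, ∑ j, ‖p i - q j‖ :=
      Finset.single_le_sum (f := fun i => ∑ j, ‖p i - q j‖)
        (fun _ _ => Finset.sum_nonneg fun _ _ => norm_nonneg _) (Finset.mem_univ (⟨i, hi⟩ : Fin n))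
    exact h1.trans h2
  exact ⟨D, ((Reach.zero (hC 0 0 hn hm)).left (Nat.zero_le (n - 1))
    fun k _ hk => hC _ _ (by omega) hm).right (Nat.zero_le _) fun k _ hk =>
      hC _ _ (by omega) (by omega)⟩

theorem dist_le_of_reach (v : Variant) (h : Reach (Close p q D) (n - 1) (m - 1)) :
    dist v p q ≤ D := by
  cases v with
  | continuous =>
    refine csInf_le ⟨0, ?_⟩ (exists_contReparam_of_reach h)
    rintro E ⟨φ, _, ψ, _, hE⟩
    exact (norm_nonneg _).trans (hE 0)
  | discrete =>
    refine csInf_le ⟨0, ?_⟩ (exists_discReparam_of_reach h)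
    rintro E ⟨φ, _, ψ, _, hE⟩
    exact (norm_nonneg _).trans (hE 0)

/-- A discrete traversal follows a staircase path, and interpolating this path gives a continuous
traversal within the same bound. Hence it suffices to exclude narrow continuous traversals. -/
theorem le_dist_of_contReparam (v : Variant) (h : ∀ E, ∀ φ ∈ contReparam n, ∀ ψ ∈ contReparam m,
    (∀ t, ‖polyline p (φ t) - polyline q (ψ t)‖ ≤ E) → D ≤ E) : D ≤ dist v p q := by
  obtain ⟨D₀, hD₀⟩ := exists_reach p q
  cases v with
  | continuous =>
    refine le_csInf ⟨D₀, exists_contReparam_of_reach hD₀⟩ ?_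
    rintro E ⟨φ, hφ, ψ, hψ, hE⟩
    exact h E φ hφ ψ hψ hE
  | discrete =>
    refine le_csInf ⟨D₀, exists_discReparam_of_reach hD₀⟩ ?_
    rintro E ⟨φ, hφ, ψ, hψ, hE⟩
    obtain ⟨φ', hφ', ψ', hψ', hE'⟩ := exists_contReparam_of_reach (reach_of_discReparam hφ hψ hE)
    exact h E φ' hφ' ψ' hψ' hE'

end Frechet
end

noncomputable section
namespace Frechet
open Set

/-! The two curves of the reduction -/

/-- The bit encoded at position `r` of a vector gadget. -/
def gadgetBit (f : ℕ → ℕ) (r : ℕ) : ℕ := if r % 2 = 1 then f (r / 2) else 0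

/-- The height of position `r` of a vector gadget. -/
def gadgetY (r : ℕ) : ℕ := if r = 0 then 360 else if r % 2 = 1 then 0 else 180

/-- The first curve has `A` blocks of `2 * K + 4` vertices: a rest point (10,180), an entrance
(85,360), a zigzag of `2 * K + 1` vertices and an exit (85,0). The zigzag encodes the bits at odd
positions, of height 0; even positions have height 180, except for the start, which is marked by
height 360. After the blocks the rest point is repeated, so the curve can be padded to any length.
-/
def leftX (K A : ℕ) (α : ℕ → ℕ → ℕ) (v : ℕ) : ℕ :=
  if v / (2 * K + 4) < A then
    if v % (2 * K + 4) = 0 then 10 else if v % (2 * K + 4) = 1 then 85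
    else if v % (2 * K + 4) = 2 * K + 3 then 85
    else 11 - 2 * gadgetBit (α (v / (2 * K + 4))) (v % (2 * K + 4) - 2)
  else 10

def leftY (K A : ℕ) (v : ℕ) : ℕ :=
  if v / (2 * K + 4) < A then
    if v % (2 * K + 4) = 0 then 180 else if v % (2 * K + 4) = 1 then 360
    else if v % (2 * K + 4) = 2 * K + 3 then 0
    else gadgetY (v % (2 * K + 4) - 2)
  else 180

/-- The second curve starts at (910,180), goes to (1085,360), runs through `B` zigzags without
anything between them, and goes to (1085,0). Then (910,180) is repeated as padding. -/
def rightX (K B : ℕ) (β : ℕ → ℕ → ℕ) (w : ℕ) : ℕ :=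
  if w = 0 then 910 else if w = 1 then 1085
  else if w - 2 < B * (2 * K + 1) then
    1009 + 2 * gadgetBit (β ((w - 2) / (2 * K + 1))) ((w - 2) % (2 * K + 1))
  else if w - 2 = B * (2 * K + 1) then 1085 else 910

def rightY (K B : ℕ) (w : ℕ) : ℕ :=
  if w = 0 then 180 else if w = 1 then 360
  else if w - 2 < B * (2 * K + 1) then gadgetY ((w - 2) % (2 * K + 1))
  else if w - 2 = B * (2 * K + 1) then 0 else 180

theorem block_div {a r c : ℕ} (h : r < c) : (a * c + r) / c = a := by
  rw [Nat.add_comm, Nat.add_mul_div_right _ _ (by omega), Nat.div_eq_of_lt h, zero_add]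

theorem block_mod {a r c : ℕ} (h : r < c) : (a * c + r) % c = r := by
  rw [Nat.add_comm, Nat.add_mul_mod_self_right, Nat.mod_eq_of_lt h]

theorem block_lt {a b r c : ℕ} (h : r < c) (hab : a < b) : a * c + r < b * c := by
  calc a * c + r < a * c + c := by omega
    _ = (a + 1) * c := by ring
    _ ≤ b * c := Nat.mul_le_mul_right c hab

/-! ### Coordinates of the vertices. -/

section values

variable {K A B : ℕ} {α β : ℕ → ℕ → ℕ}

theorem gadgetBit_le {f : ℕ → ℕ} (h : ∀ j, f j ≤ 1) (r : ℕ) : gadgetBit f r ≤ 1 := by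
  unfold gadgetBit; split_ifs <;> simp [h]

theorem gadgetY_le (r : ℕ) : gadgetY r ≤ 360 := by
  unfold gadgetY; split_ifs <;> omega

theorem leftX_gadget {a r : ℕ} (ha : a < A) (hr : r ≤ 2 * K) :
    leftX K A α (a * (2 * K + 4) + 2 + r) = 11 - 2 * gadgetBit (α a) r := by
  rw [add_assoc]
  unfold leftX
  rw [block_div (by omega), block_mod (by omega), if_pos ha, if_neg (by omega), if_neg (by omega),
    if_neg (by omega), Nat.add_sub_cancel_left]

theorem leftY_gadget {a r : ℕ} (ha : a < A) (hr : r ≤ 2 * K) :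
    leftY K A (a * (2 * K + 4) + 2 + r) = gadgetY r := by
  rw [add_assoc]
  unfold leftY
  rw [block_div (by omega), block_mod (by omega), if_pos ha, if_neg (by omega), if_neg (by omega),
    if_neg (by omega), Nat.add_sub_cancel_left]

theorem left_s {a : ℕ} (ha : a < A) :
    leftX K A α (a * (2 * K + 4) + 1) = 85 ∧ leftY K A (a * (2 * K + 4) + 1) = 360 := by
  unfold leftX leftY
  rw [block_div (by omega), block_mod (by omega)]
  simp [ha]

theorem left_t {a : ℕ} (ha : a < A) :
    leftX K A α (a * (2 * K + 4) + (2 * K + 3)) = 85 ∧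
      leftY K A (a * (2 * K + 4) + (2 * K + 3)) = 0 := by
  unfold leftX leftY
  rw [block_div (by omega), block_mod (by omega)]
  simp [ha]

theorem left_of_ge {v : ℕ} (hv : A * (2 * K + 4) ≤ v) : leftX K A α v = 10 ∧ leftY K A v = 180 := by
  unfold leftX leftY
  have : ¬ v / (2 * K + 4) < A := by
    rw [Nat.div_lt_iff_lt_mul (by omega)]; omega
  simp [this]

theorem leftY_le (v : ℕ) : leftY K A v ≤ 360 := by
  unfold leftY
  split_ifs <;> first | omega | exact gadgetY_le _

theorem leftX_le (v : ℕ) : leftX K A α v ≤ 85 := by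
  unfold leftX
  split_ifs <;> omega

theorem leftX_ge (hα : ∀ a j, α a j ≤ 1) (v : ℕ) : 9 ≤ leftX K A α v := by
  unfold leftX
  have := gadgetBit_le (hα (v / (2 * K + 4))) (v % (2 * K + 4) - 2)
  split_ifs <;> omega

/-- The line `20 * x + y = 2000` separates the entrances (85,360) from the other vertices of the
first curve. Its distance from (1085,360) is `20060 / √401`, which exceeds 1001.5. -/
theorem left_far_w {v : ℕ} (hv : v / (2 * K + 4) < A → v % (2 * K + 4) ≠ 1) :
    20 * leftX K A α v + leftY K A v ≤ 2000 := by
  have := gadgetY_le (v % (2 * K + 4) - 2)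
  unfold leftX leftY
  split_ifs with h1 h2 h3 h4 <;> omega

/-- The mirror image of `left_far_w` under `y ↦ 360 - y`, for the exits (85,0) and the point
(1085,0). -/
theorem left_far_z {v : ℕ} (hv : v / (2 * K + 4) < A → v % (2 * K + 4) ≠ 2 * K + 3) :
    20 * leftX K A α v ≤ 1640 + leftY K A v := by
  unfold leftX leftY
  split_ifs with h1 h2 h3 h4 <;> omega

theorem right_gadget {b r : ℕ} (hb : b < B) (hr : r ≤ 2 * K) :
    rightX K B β (2 + b * (2 * K + 1) + r) = 1009 + 2 * gadgetBit (β b) r ∧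
      rightY K B (2 + b * (2 * K + 1) + r) = gadgetY r := by
  have h1 : 2 + b * (2 * K + 1) + r - 2 = b * (2 * K + 1) + r := by omega
  have h2 : b * (2 * K + 1) + r < B * (2 * K + 1) := block_lt (by omega) hb
  unfold rightX rightY
  rw [h1, block_div (by omega), block_mod (by omega), if_neg (by omega), if_neg (by omega),
    if_pos h2, if_neg (by omega), if_neg (by omega), if_pos h2]
  exact ⟨rfl, rfl⟩

theorem right_zero : rightX K B β 0 = 910 ∧ rightY K B 0 = 180 := ⟨rfl, rfl⟩

theorem right_one : rightX K B β 1 = 1085 ∧ rightY K B 1 = 360 := ⟨rfl, rfl⟩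

theorem right_z : rightX K B β (2 + B * (2 * K + 1)) = 1085 ∧
    rightY K B (2 + B * (2 * K + 1)) = 0 := by
  have h1 : 2 + B * (2 * K + 1) - 2 = B * (2 * K + 1) := by omega
  unfold rightX rightY
  rw [h1]
  constructor <;> rw [if_neg (by omega), if_neg (by omega), if_neg (lt_irrefl _), if_pos rfl]

theorem right_of_ge {w : ℕ} (hw : 3 + B * (2 * K + 1) ≤ w) :
    rightX K B β w = 910 ∧ rightY K B w = 180 := by
  unfold rightX rightY
  rw [if_neg (by omega), if_neg (by omega), if_neg (by omega), if_neg (by omega), if_neg (by omega),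
    if_neg (by omega), if_neg (by omega), if_neg (by omega)]
  exact ⟨rfl, rfl⟩

theorem rightY_le (w : ℕ) : rightY K B w ≤ 360 := by
  unfold rightY
  split_ifs <;> first | omega | exact gadgetY_le _

theorem rightX_ge {w : ℕ} (h1 : 1 ≤ w) (h2 : w ≤ 2 + B * (2 * K + 1)) :
    1009 ≤ rightX K B β w := by
  unfold rightX
  split_ifs <;> omega

theorem rightX_le (hβ : ∀ b j, β b j ≤ 1) (w : ℕ) : rightX K B β w ≤ 1085 := by
  have := gadgetBit_le (hβ ((w - 2) / (2 * K + 1))) ((w - 2) % (2 * K + 1))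
  unfold rightX
  split_ifs <;> omega

theorem rightX_inner_le (hβ : ∀ b j, β b j ≤ 1) {w : ℕ} (h1 : 2 ≤ w)
    (h2 : w < 2 + B * (2 * K + 1)) :
    rightX K B β w ≤ 1011 := by
  have := gadgetBit_le (hβ ((w - 2) / (2 * K + 1))) ((w - 2) % (2 * K + 1))
  unfold rightX
  split_ifs <;> omega

/-- Heights above 180 are how the start of a zigzag is recognized. -/
theorem rightY_gt {w : ℕ} (h1 : 1 ≤ w) (h : 180 < rightY K B w) :
    w = 1 ∨ ∃ b < B, w = 2 + b * (2 * K + 1) := by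
  unfold rightY at h
  split_ifs at h with c1 c2 c3 c4
  · omega
  · exact .inl c2
  · right
    unfold gadgetY at h
    split_ifs at h with c5
    · refine ⟨(w - 2) / (2 * K + 1), (Nat.div_lt_iff_lt_mul (by omega)).2 c3, ?_⟩
      have := Nat.div_add_mod (w - 2) (2 * K + 1)
      rw [c5, mul_comm] at this
      omega
    · omega
    · omega
  · omega
  · omega

end values

/-! Soundness -/

/-- On an edge the function is linear, so it exceeds `c` between two places where it does. This
keeps a curve on one side of the height 90. -/
theorem interp_gt {f : ℕ → ℝ} {i : ℕ} {t t' c : ℝ} (h0 : (i : ℝ) ≤ t) (h : t ≤ t')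
    (h1 : t' ≤ i + 1) (hc : c < interp f t) (hf : c < f (i + 1)) : c < interp f t' := by
  rw [interp_edge f h0 (h.trans h1)] at hc
  rw [interp_edge f (h0.trans h) h1]
  rcases le_total (f i) (f (i + 1)) with h2 | h2
  · nlinarith [mul_nonneg (sub_nonneg.2 h) (sub_nonneg.2 h2)]
  · nlinarith [mul_nonneg (sub_nonneg.2 h1) (sub_nonneg.2 h2)]

theorem interp_lt {f : ℕ → ℝ} {i : ℕ} {t t' c : ℝ} (h0 : (i : ℝ) ≤ t) (h : t ≤ t')
    (h1 : t' ≤ i + 1) (hc : interp f t < c) (hf : f (i + 1) < c) : interp f t' < c := by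
  rw [interp_edge f h0 (h.trans h1)] at hc
  rw [interp_edge f (h0.trans h) h1]
  rcases le_total (f i) (f (i + 1)) with h2 | h2
  · nlinarith [mul_nonneg (sub_nonneg.2 h1) (sub_nonneg.2 h2)]
  · nlinarith [mul_nonneg (sub_nonneg.2 h) (sub_nonneg.2 h2)]

theorem interp_le_of_edge {f : ℕ → ℝ} {i : ℕ} {t c : ℝ} (h0 : (i : ℝ) ≤ t) (h1 : t ≤ i + 1)
    (hi : f i ≤ c) (hf : f (i + 1) ≤ c) : interp f t ≤ c := by
  rw [interp_edge f h0 h1]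
  nlinarith [mul_nonneg (sub_nonneg.2 h0) (sub_nonneg.2 hf),
    mul_nonneg (sub_nonneg.2 h1) (sub_nonneg.2 hi)]

theorem le_interp_of_edge {f : ℕ → ℝ} {i : ℕ} {t c : ℝ} (h0 : (i : ℝ) ≤ t) (h1 : t ≤ i + 1)
    (hi : c ≤ f i) (hf : c ≤ f (i + 1)) : c ≤ interp f t := by
  rw [interp_edge f h0 h1]
  nlinarith [mul_nonneg (sub_nonneg.2 h0) (sub_nonneg.2 hf),
    mul_nonneg (sub_nonneg.2 h1) (sub_nonneg.2 hi)]

/-- An intermediate value theorem from monotonicity and the range only. If the preimage found lies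
outside `[s, t]`, then monotonicity makes an end of the interval a preimage as well. -/
theorem exists_time {φ : unitInterval → ℝ} (hm : Monotone φ) {N : ℝ}
    (hr : range φ = Icc 0 N) {s t : unitInterval} (hst : s ≤ t) {x : ℝ} (hs : φ s ≤ x)
    (ht : x ≤ φ t) : ∃ r, s ≤ r ∧ r ≤ t ∧ φ r = x := by
  have h0 : φ s ∈ Icc 0 N := hr ▸ mem_range_self s
  have h1 : φ t ∈ Icc 0 N := hr ▸ mem_range_self t
  have hx : x ∈ range φ := by rw [hr]; exact ⟨h0.1.trans hs, ht.trans h1.2⟩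
  obtain ⟨r, rfl⟩ := hx
  rcases le_total s r with h | h
  · rcases le_total r t with h' | h'
    · exact ⟨r, h, h', rfl⟩
    · exact ⟨t, hst, le_rfl, le_antisymm (hm h') ht⟩
  · exact ⟨s, le_rfl, hst, le_antisymm hs (hm h)⟩

/-- The horizontal distance is at least 998, and `998 ^ 2 + 90 ^ 2 > 1001.5 ^ 2`. -/
theorem abs_lt_of_dist {x x' y y' : ℝ} (h : (x - x') ^ 2 + (y - y') ^ 2 < 1001.5 ^ 2) (hx : x ≤ 11)
    (hx' : 1009 ≤ x') : y - y' < 90 ∧ y' - y < 90 := by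
  constructor <;> nlinarith

/-- A traversal of the two curves of width less than `1001.5`. -/
structure Narrow (K A B : ℕ) (α β : ℕ → ℕ → ℕ) (n m : ℕ) (φ ψ : unitInterval → ℝ) : Prop where
  monoφ : Monotone φ
  monoψ : Monotone ψ
  rangeφ : range φ = Icc 0 ((n : ℝ) - 1)
  rangeψ : range ψ = Icc 0 ((m : ℝ) - 1)
  lt_m : B * (2 * K + 1) + 3 < m
  width : ∀ t, (interp (fun v => leftX K A α v) (φ t) - interp (fun w => rightX K B β w) (ψ t)) ^ 2
    + (interp (fun v => leftY K A v) (φ t) - interp (fun w => rightY K B w) (ψ t)) ^ 2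
      < 1001.5 ^ 2

namespace Narrow

variable {K A B : ℕ} {α β : ℕ → ℕ → ℕ} {n m : ℕ} {φ ψ : unitInterval → ℝ}

theorem nonnegφ (h : Narrow K A B α β n m φ ψ) (t : unitInterval) : 0 ≤ φ t := by
  have : φ t ∈ Icc 0 ((n : ℝ) - 1) := h.rangeφ ▸ mem_range_self t
  exact this.1

theorem nonnegψ (h : Narrow K A B α β n m φ ψ) (t : unitInterval) : 0 ≤ ψ t := by
  have : ψ t ∈ Icc 0 ((m : ℝ) - 1) := h.rangeψ ▸ mem_range_self t
  exact this.1

/-- While the second curve is at (1085,360), the first curve must be on an edge at an entrance: any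
other point of it lies in the half plane of `left_far_w`, which is too far away. -/
theorem near_s (h : Narrow K A B α β n m φ ψ) {t : unitInterval} (ht : ψ t = 1) :
    ∃ a < A, ((a * (2 * K + 4) + 1 : ℕ) : ℝ) - 1 < φ t ∧
      φ t < ((a * (2 * K + 4) + 1 : ℕ) : ℝ) + 1 := by
  by_contra! hcon
  have hw := h.width t
  have hk0 := Nat.floor_le (h.nonnegφ t)
  have hk1 := Nat.lt_floor_add_one (φ t)
  set k := ⌊φ t⌋₊
  have key : ∀ v : ℕ, ((v : ℝ) - 1 < φ t ∧ φ t < v + 1) →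
      20 * (leftX K A α v : ℝ) + leftY K A v ≤ 2000 := by
    intro v hv
    have := left_far_w (K := K) (A := A) (α := α) (v := v) (fun h1 h2 => by
      have e := Nat.div_add_mod v (2 * K + 4)
      rw [h2, mul_comm] at e
      have := hcon _ h1 (by rw [e]; exact hv.1)
      rw [e] at this
      linarith)
    exact_mod_cast this
  have e2 : interp (fun w => (rightX K B β w : ℝ)) (ψ t) = 1085 := by
    have := interp_nat (fun w => (rightX K B β w : ℝ)) 1
    rw [ht]; simpa [right_one] using this
  have e3 : interp (fun w => (rightY K B w : ℝ)) (ψ t) = 360 := by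
    have := interp_nat (fun w => (rightY K B w : ℝ)) 1
    rw [ht]; simpa [rightY] using this
  rw [e2, e3] at hw
  have hle : 20 * interp (fun v => (leftX K A α v : ℝ)) (φ t) +
      interp (fun v => (leftY K A v : ℝ)) (φ t) ≤ 2000 := by
    rw [interp_edge _ hk0 hk1.le, interp_edge _ hk0 hk1.le]
    have b1 := key k ⟨by linarith, hk1⟩
    -- Exactly at vertex `k`, the next vertex has parameter distance 1 and may be an entrance; there
    -- the bound at `k` has to suffice.
    rcases hk0.eq_or_lt with hk | hk
    · rw [← hk]; simp only [sub_self]; linarith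
    have b2 := key (k + 1) ⟨by push_cast; linarith, by push_cast; linarith⟩
    nlinarith [mul_nonneg (sub_nonneg.2 hk0) (sub_nonneg.2 b2),
      mul_nonneg (sub_nonneg.2 hk1.le) (sub_nonneg.2 b1)]
  set x := interp (fun v => (leftX K A α v : ℝ)) (φ t)
  set y := interp (fun v => (leftY K A v : ℝ)) (φ t)
  -- With `u = 1085 - x` and `w = 360 - y`: `(u - 20 w)² + (20 u + w)² = 401 (u² + w²)`, and `20 u +
  -- w ≥ 20060`.
  nlinarith [sq_nonneg ((1085 - x) - 20 * (360 - y)), sq_nonneg (20 * (1085 - x) + (360 - y) - 20060)]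

theorem near_t (h : Narrow K A B α β n m φ ψ) {t : unitInterval}
    (ht : ψ t = (2 + B * (2 * K + 1) : ℕ)) :
    ∃ a < A, ((a * (2 * K + 4) + (2 * K + 3) : ℕ) : ℝ) - 1 < φ t ∧
      φ t < ((a * (2 * K + 4) + (2 * K + 3) : ℕ) : ℝ) + 1 := by
  by_contra! hcon
  have hw := h.width t
  have hk0 := Nat.floor_le (h.nonnegφ t)
  have hk1 := Nat.lt_floor_add_one (φ t)
  set k := ⌊φ t⌋₊
  have key : ∀ v : ℕ, ((v : ℝ) - 1 < φ t ∧ φ t < v + 1) →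
      20 * (leftX K A α v : ℝ) ≤ 1640 + leftY K A v := by
    intro v hv
    have := left_far_z (K := K) (A := A) (α := α) (v := v) (fun h1 h2 => by
      have e := Nat.div_add_mod v (2 * K + 4)
      rw [h2, mul_comm] at e
      have := hcon _ h1 (by rw [e]; exact hv.1)
      rw [e] at this
      linarith)
    exact_mod_cast this
  have e2 : interp (fun w => (rightX K B β w : ℝ)) (ψ t) = 1085 := by
    rw [ht, interp_nat, right_z.1]; norm_num
  have e3 : interp (fun w => (rightY K B w : ℝ)) (ψ t) = 0 := by
    rw [ht, interp_nat, (right_z (β := β)).2]; norm_num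
  rw [e2, e3] at hw
  have hle : 20 * interp (fun v => (leftX K A α v : ℝ)) (φ t) ≤ 1640 +
      interp (fun v => (leftY K A v : ℝ)) (φ t) := by
    rw [interp_edge _ hk0 hk1.le, interp_edge _ hk0 hk1.le]
    have b1 := key k ⟨by linarith, hk1⟩
    rcases hk0.eq_or_lt with hk | hk
    · rw [← hk]; simp only [sub_self]; linarith
    have b2 := key (k + 1) ⟨by push_cast; linarith, by push_cast; linarith⟩
    nlinarith [mul_nonneg (sub_nonneg.2 hk0) (sub_nonneg.2 b2),
      mul_nonneg (sub_nonneg.2 hk1.le) (sub_nonneg.2 b1)]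
  set x := interp (fun v => (leftX K A α v : ℝ)) (φ t)
  set y := interp (fun v => (leftY K A v : ℝ)) (φ t)
  nlinarith [sq_nonneg ((1085 - x) - 20 * y), sq_nonneg (20 * (1085 - x) + y - 20060)]

/-- The heights of the two curves differ by less than `90` inside the gadgets. -/
theorem height (h : Narrow K A B α β n m φ ψ) {t : unitInterval} {a r w : ℕ} (ha : a < A)
    (hr : r ≤ 2 * K) (h0 : ((a * (2 * K + 4) + 2 + r : ℕ) : ℝ) ≤ φ t)
    (h1 : φ t ≤ ((a * (2 * K + 4) + 2 + r : ℕ) : ℝ) + 1)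
    (h2 : r < 2 * K ∨ φ t = (a * (2 * K + 4) + 2 + r : ℕ)) (hw : 1 ≤ w)
    (hw' : w < 2 + B * (2 * K + 1)) (hw0 : (w : ℝ) ≤ ψ t) (hw1 : ψ t ≤ w + 1) :
    interp (fun v => (leftY K A v : ℝ)) (φ t) - interp (fun w => (rightY K B w : ℝ)) (ψ t) < 90 ∧
    interp (fun w => (rightY K B w : ℝ)) (ψ t) - interp (fun v => (leftY K A v : ℝ)) (φ t) < 90 := by
  refine abs_lt_of_dist (h.width t) ?_ ?_
  · have key : ∀ r ≤ 2 * K, (leftX K A α (a * (2 * K + 4) + 2 + r) : ℝ) ≤ 11 := fun r hr => by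
      rw [leftX_gadget ha hr]; exact_mod_cast Nat.sub_le _ _
    -- The edge after the last position leads to the exit, where x is 85; there only the vertex
    -- itself is allowed.
    rcases h2 with h2 | h2
    · exact interp_le_of_edge h0 h1 (key r hr) (key (r + 1) h2)
    · rw [h2, interp_nat]; exact key r hr
  · refine le_interp_of_edge hw0 hw1 ?_ ?_
    · exact_mod_cast rightX_ge hw hw'.le
    · exact_mod_cast rightX_ge (by omega) (by omega)

theorem gadgetY_even {r : ℕ} (h : r % 2 = 0) : 180 ≤ gadgetY r := by
  unfold gadgetY; split_ifs <;> omega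

theorem gadgetY_odd {r : ℕ} (h : r % 2 = 1) : gadgetY r = 0 := by
  unfold gadgetY; split_ifs <;> omega

/-- While the first curve is at position `r` of a gadget, the second curve is near position `r` of
a gadget. -/
def At (K : ℕ) (φ ψ : unitInterval → ℝ) (a b r : ℕ) (t : unitInterval) : Prop :=
  φ t = (a * (2 * K + 4) + 2 + r : ℕ) ∧ ((2 + b * (2 * K + 1) + r : ℕ) : ℝ) - 1 < ψ t ∧
    ψ t < ((2 + b * (2 * K + 1) + r : ℕ) : ℝ) + 1

/-- The first curve has height 360, so the second one is higher than 270, and an end of its current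
edge is higher than 180. By `rightY_gt` this end is the start of a zigzag, or it is (1085,360),
which is followed by the start of zigzag 0. -/
theorem at_zero (h : Narrow K A B α β n m φ ψ) (hB : 0 < B) {a : ℕ} (ha : a < A)
    {t : unitInterval} (ht : φ t = (a * (2 * K + 4) + 2 : ℕ)) (h1 : 1 ≤ ψ t)
    (h2 : ψ t ≤ (2 + B * (2 * K + 1) : ℕ)) : ∃ b < B, At K φ ψ a b 0 t := by
  have hY : interp (fun v => (leftY K A v : ℝ)) (φ t) = 360 := by
    rw [ht, interp_nat]
    have := leftY_gadget (K := K) (r := 0) ha (by omega)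
    rw [add_zero] at this
    rw [this]; norm_num [gadgetY]
  have hX : interp (fun v => (leftX K A α v : ℝ)) (φ t) ≤ 11 := by
    rw [ht, interp_nat]
    have := leftX_gadget (K := K) (r := 0) (α := α) ha (by omega)
    rw [add_zero] at this
    rw [this]; exact_mod_cast Nat.sub_le _ _
  have hk0 := Nat.floor_le (h.nonnegψ t)
  have hk1 := Nat.lt_floor_add_one (ψ t)
  have hk2 : 1 ≤ ⌊ψ t⌋₊ := Nat.le_floor (by exact_mod_cast h1)
  have hk3 : ⌊ψ t⌋₊ ≤ 2 + B * (2 * K + 1) := Nat.floor_le_of_le h2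
  set k := ⌊ψ t⌋₊
  rcases hk3.eq_or_lt with hk | hk
  · exfalso
    have e : ψ t = (2 + B * (2 * K + 1) : ℕ) := le_antisymm h2 (by rw [← hk]; exact hk0)
    have := abs_lt_of_dist (h.width t) hX (by
      rw [e, interp_nat, right_z.1]; norm_num)
    rw [hY, e, interp_nat, (right_z (β := β)).2] at this
    norm_num at this
  have h90 := abs_lt_of_dist (h.width t) hX (le_interp_of_edge hk0 hk1.le
    (by exact_mod_cast rightX_ge hk2 hk.le) (by exact_mod_cast rightX_ge (by omega) (by omega)))
  rw [hY] at h90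
  -- A zigzag start at an end of the current edge is less than one edge away, unless the curve is
  -- exactly at the other end.
  have hmark : ∀ b < B, k = 2 + b * (2 * K + 1) ∨ k + 1 = 2 + b * (2 * K + 1) →
      k + 1 = 2 + b * (2 * K + 1) ∧ (k : ℝ) = ψ t ∨ At K φ ψ a b 0 t := by
    rintro b hb (h3 | h3)
    · right
      refine ⟨by simpa using ht, ?_, ?_⟩
      · rw [add_zero, ← h3]; linarith
      · rw [add_zero, ← h3]; exact hk1
    · rcases hk0.eq_or_lt with h4 | h4
      · exact .inl ⟨h3, h4⟩
      · right
        refine ⟨by simpa using ht, ?_, ?_⟩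
        · rw [add_zero, ← h3]; push_cast; linarith
        · rw [add_zero, ← h3]; push_cast; linarith
  have hnot : ¬ ((k : ℝ) = ψ t ∧ rightY K B k ≤ 180) := by
    rintro ⟨h3, h4⟩
    rw [← h3, interp_nat] at h90
    have : (rightY K B k : ℝ) ≤ 180 := by exact_mod_cast h4
    linarith [h90.1]
  by_cases c1 : 180 < rightY K B k
  · rcases rightY_gt hk2 c1 with h3 | ⟨b, hb, h3⟩
    · rcases hmark 0 hB (.inr (by omega)) with h4 | h4
      · exfalso
        -- here the second curve is exactly at its second vertex
        have e : ψ t = (1 : ℕ) := by rw [← h4.2, h3]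
        have := h.width t
        rw [hY, e, interp_nat, interp_nat, right_one.1, (right_one (β := β)).2] at this
        push_cast at this
        nlinarith
      · exact ⟨0, hB, h4⟩
    · rcases hmark b hb (.inl h3) with h4 | h4
      · omega
      · exact ⟨b, hb, h4⟩
  · by_cases c2 : 180 < rightY K B (k + 1)
    · rcases rightY_gt (by omega) c2 with h3 | ⟨b, hb, h3⟩
      · omega
      · rcases hmark b hb (.inr h3) with h4 | h4
        · exact absurd ⟨h4.2, by omega⟩ hnot
        · exact ⟨b, hb, h4⟩
    · exfalso
      have := interp_le_of_edge (f := fun w => (rightY K B w : ℝ)) (c := 180) hk0 hk1.le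
        (by exact_mod_cast not_lt.1 c1) (by exact_mod_cast not_lt.1 c2)
      linarith [h90.1]

/-- Heights are at least 180 at even positions and 0 at odd ones, and differ by less than 90 between
the curves; so whenever one curve is at such a position, the other is on the same side of height 90.
A second curve that is late stays on one edge ending at position `r`, hence on one side, while the
first curve changes sides. A second curve that is early passes positions `r + 1` and `r + 2`, on
different sides, while the first curve is on one edge ending at `r + 1`. -/
theorem at_succ (h : Narrow K A B α β n m φ ψ) {a b r : ℕ} (ha : a < A) (hb : b < B)
    (hr : r + 2 ≤ 2 * K) {t t' : unitInterval} (htt : t ≤ t') (ht : At K φ ψ a b r t)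
    (ht' : φ t' = (a * (2 * K + 4) + 2 + (r + 1) : ℕ)) : At K φ ψ a b (r + 1) t' := by
  obtain ⟨e, l, u⟩ := ht
  have hψ := h.monoψ htt
  have hend : 2 + b * (2 * K + 1) + (r + 2) < 2 + B * (2 * K + 1) := by
    have := block_lt (a := b) (b := B) (r := r + 2) (c := 2 * K + 1) (by omega) hb
    omega
  have hYl : ∀ r ≤ 2 * K, ∀ t, φ t = (a * (2 * K + 4) + 2 + r : ℕ) →
      interp (fun v => (leftY K A v : ℝ)) (φ t) = gadgetY r := fun r hr t e => by
    rw [e, interp_nat, leftY_gadget ha hr]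
  have hYr : ∀ r ≤ 2 * K, ∀ t, ψ t = (2 + b * (2 * K + 1) + r : ℕ) →
      interp (fun w => (rightY K B w : ℝ)) (ψ t) = gadgetY r := fun r hr t e => by
    rw [e, interp_nat, (right_gadget (β := β) hb hr).2]
  have heven : ∀ {r : ℕ}, r % 2 = 0 → (180 : ℝ) ≤ gadgetY r := fun h => by
    exact_mod_cast gadgetY_even h
  have hodd : ∀ {r : ℕ}, r % 2 = 1 → (gadgetY r : ℝ) = 0 := fun h => by
    exact_mod_cast gadgetY_odd h
  refine ⟨ht', ?_, ?_⟩
  · by_contra hcon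
    -- The vertex before position `r`. It may belong to the preceding zigzag or be (1085,360), but
    -- its x-coordinate is at least 1009 in any case.
    obtain ⟨k, hk⟩ : ∃ k, 2 + b * (2 * K + 1) + r = k + 1 :=
      ⟨1 + b * (2 * K + 1) + r, by omega⟩
    have hYk : rightY K B (k + 1) = gadgetY r := by
      rw [← hk]; exact (right_gadget (β := β) hb (by omega)).2
    rw [hk] at l u
    rw [← add_assoc, hk] at hcon
    push_cast at l u hcon
    have hle : ψ t' ≤ k + 1 := by linarith
    have g := h.height (t := t) (w := k) ha (r := r) (by omega) e.ge (by rw [e]; linarith) (.inr e)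
      (by omega) (by omega) (by linarith) (by linarith)
    have g' := h.height (t := t') (w := k) ha (r := r + 1) (by omega) ht'.ge (by rw [ht']; linarith)
      (.inr ht') (by omega) (by omega) (by linarith) hle
    rw [hYl r (by omega) t e] at g
    rw [hYl (r + 1) (by omega) t' ht'] at g'
    rcases Nat.mod_two_eq_zero_or_one r with hp | hp
    · have := interp_gt (f := fun w => (rightY K B w : ℝ)) (c := 90) (i := k) (by linarith) hψ hle
        (by linarith [heven hp, g.1]) (by simp only [hYk]; linarith [heven hp])
      linarith [hodd (show (r + 1) % 2 = 1 by omega), g'.2]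
    · have := interp_lt (f := fun w => (rightY K B w : ℝ)) (c := 90) (i := k) (by linarith) hψ hle
        (by linarith [hodd hp, g.2]) (by simp only [hYk]; linarith [hodd hp])
      linarith [heven (show (r + 1) % 2 = 0 by omega), g'.1]
  · by_contra hcon
    have hcon : ((2 + b * (2 * K + 1) + (r + 2) : ℕ) : ℝ) ≤ ψ t' := by
      push_cast at hcon ⊢; linarith
    have hu1 : ψ t ≤ ((2 + b * (2 * K + 1) + (r + 1) : ℕ) : ℝ) := by
      push_cast at u ⊢; linarith
    obtain ⟨t1, h1, h1', e1⟩ := exists_time h.monoψ h.rangeψ htt hu1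
      (le_trans (by push_cast; linarith) hcon)
    obtain ⟨t2, h2, h2', e2⟩ := exists_time h.monoψ h.rangeψ h1'
      (by rw [e1]; push_cast; linarith) hcon
    have b1 : φ t ≤ φ t1 := h.monoφ h1
    have b2 : φ t1 ≤ φ t2 := h.monoφ h2
    have b3 : φ t2 ≤ φ t' := h.monoφ h2'
    rw [e] at b1
    rw [ht'] at b3
    have b3 : φ t2 ≤ ((a * (2 * K + 4) + 2 + r : ℕ) : ℝ) + 1 := by push_cast at b3 ⊢; linarith
    have g := h.height (t := t1) (w := 2 + b * (2 * K + 1) + (r + 1)) ha (r := r) (by omega) b1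
      (by linarith) (.inl (by omega)) (by omega) (by omega) e1.ge (by rw [e1]; linarith)
    have g' := h.height (t := t2) (w := 2 + b * (2 * K + 1) + (r + 2)) ha (r := r) (by omega)
      (by linarith) b3 (.inl (by omega)) (by omega) (by omega) e2.ge (by rw [e2]; linarith)
    rw [hYr (r + 1) (by omega) t1 e1] at g
    rw [hYr (r + 2) (by omega) t2 e2] at g'
    have hYk : leftY K A (a * (2 * K + 4) + 2 + r + 1) = gadgetY (r + 1) :=
      leftY_gadget (r := r + 1) ha (by omega)
    rcases Nat.mod_two_eq_zero_or_one r with hp | hp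
    · have := interp_lt (f := fun v => (leftY K A v : ℝ)) (c := 90)
        (i := a * (2 * K + 4) + 2 + r) b1 b2 b3
        (by linarith [hodd (show (r + 1) % 2 = 1 by omega), g.1])
        (by simp only [hYk]; linarith [hodd (show (r + 1) % 2 = 1 by omega)])
      linarith [heven (show (r + 2) % 2 = 0 by omega), g'.2]
    · have := interp_gt (f := fun v => (leftY K A v : ℝ)) (c := 90)
        (i := a * (2 * K + 4) + 2 + r) b1 b2 b3
        (by linarith [heven (show (r + 1) % 2 = 0 by omega), g.2])
        (by simp only [hYk]; linarith [heven (show (r + 1) % 2 = 0 by omega)])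
      linarith [hodd (show (r + 2) % 2 = 1 by omega), g'.1]

/-- If both bits were 1, the first curve would be at (9,0). At parameter distance `lam` from its own
position (1011,0), the second curve has x-coordinate at least `1011 - 2 * lam` and height at least
`180 * lam`, because both neighbours have height at least 180. Leaving the vertex gains more by
height than it loses horizontally. -/
theorem not_both (h : Narrow K A B α β n m φ ψ) {a b j : ℕ} (ha : a < A) (hb : b < B)
    (hj : j < K) {t : unitInterval} (ht : At K φ ψ a b (2 * j + 1) t) :
    ¬ (α a j = 1 ∧ β b j = 1) := by
  rintro ⟨h1, h2⟩
  obtain ⟨e, l, u⟩ := ht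
  have hw := h.width t
  have hb1 : ∀ f : ℕ → ℕ, gadgetBit f (2 * j + 1) = f j := fun f => by
    unfold gadgetBit
    rw [if_pos (by omega), show (2 * j + 1) / 2 = j by omega]
  have hx : interp (fun v => (leftX K A α v : ℝ)) (φ t) = 9 := by
    rw [e, interp_nat, leftX_gadget ha (by omega), hb1, h1]; norm_num
  have hy : interp (fun v => (leftY K A v : ℝ)) (φ t) = 0 := by
    rw [e, interp_nat, leftY_gadget ha (by omega), gadgetY_odd (by omega)]; norm_num
  have hX : ∀ r ≤ 2 * K, (1009 : ℝ) ≤ rightX K B β (2 + b * (2 * K + 1) + r) := fun r hr => by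
    rw [(right_gadget hb hr).1]; push_cast; linarith [Nat.cast_nonneg (α := ℝ) (gadgetBit (β b) r)]
  have hX1 : (rightX K B β (2 + b * (2 * K + 1) + (2 * j + 1)) : ℝ) = 1011 := by
    rw [(right_gadget hb (by omega)).1, hb1, h2]; norm_num
  have hY1 : (rightY K B (2 + b * (2 * K + 1) + (2 * j + 1)) : ℝ) = 0 := by
    rw [(right_gadget (β := β) hb (by omega)).2, gadgetY_odd (by omega)]; norm_num
  have hY : ∀ r ≤ 2 * K, r % 2 = 0 → (180 : ℝ) ≤ rightY K B (2 + b * (2 * K + 1) + r) :=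
    fun r hr hp => by
      rw [(right_gadget (β := β) hb hr).2]; exact_mod_cast gadgetY_even hp
  rw [hx, hy] at hw
  have key : ∀ lam x y : ℝ, 0 ≤ lam → lam ≤ 1 → 1011 - 2 * lam ≤ x → 180 * lam ≤ y →
      1001.5 ^ 2 < (9 - x) ^ 2 + (0 - y) ^ 2 := by
    intro lam x y l0 l1 hx hy
    have h3 : (1002 - 2 * lam) ^ 2 ≤ (9 - x) ^ 2 := by nlinarith
    have h4 : (180 * lam) ^ 2 ≤ (0 - y) ^ 2 := by nlinarith
    -- The quadratic `(1002 - 2 lam)² + (180 lam)²` has its minimum close to `lam = 1 / 16`.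
    nlinarith [sq_nonneg (lam - 1 / 16)]
  rcases le_total (ψ t) ((2 + b * (2 * K + 1) + (2 * j + 1) : ℕ) : ℝ) with hc | hc
  · have h0 : ((2 + b * (2 * K + 1) + 2 * j : ℕ) : ℝ) ≤ ψ t := by push_cast at l ⊢; linarith
    have h0' : ψ t ≤ ((2 + b * (2 * K + 1) + 2 * j : ℕ) : ℝ) + 1 := by push_cast at hc ⊢; linarith
    have a1 := hX (2 * j) (by omega)
    have a2 := hY (2 * j) (by omega) (by omega)
    rw [interp_edge _ h0 h0', interp_edge _ h0 h0'] at hw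
    simp only [add_assoc] at hw hX1 hY1 a1 a2
    rw [hX1, hY1] at hw
    refine absurd hw (not_lt.2 (key (1 - (ψ t - ((2 + b * (2 * K + 1) + 2 * j : ℕ) : ℝ))) _ _
      (by linarith) (by linarith) ?_ ?_).le)
    · simp only [add_assoc] at h0 h0' ⊢
      nlinarith
    · simp only [add_assoc] at h0 h0' ⊢
      nlinarith
  · have a1 := hX (2 * j + 2) (by omega)
    have a2 := hY (2 * j + 2) (by omega) (by omega)
    rw [interp_edge _ hc u.le, interp_edge _ hc u.le, hX1, hY1] at hw
    simp only [add_assoc, show 1 + 1 = 2 from rfl] at hw a1 a2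
    refine absurd hw (not_lt.2 (key (ψ t - ((2 + b * (2 * K + 1) + (2 * j + 1) : ℕ) : ℝ)) _ _
      (by linarith) (by linarith) ?_ ?_).le)
    · simp only [add_assoc] at hc u ⊢
      nlinarith
    · simp only [add_assoc] at hc u ⊢
      nlinarith

/-- While the second curve goes from (1085,360) to (1085,0), the first goes from the entrance of a
block `a` to the exit of a block `a' ≥ a`, so it passes all of zigzag `a`. By `at_zero` this begins
near the start of some zigzag `b`, and by `at_succ` the two stay in step. -/
theorem exists_orthogonal (h : Narrow K A B α β n m φ ψ) (hB : 0 < B) (hK : 0 < K) :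
    ∃ a < A, ∃ b < B, ∀ j < K, ¬ (α a j = 1 ∧ β b j = 1) := by
  have hm := h.lt_m
  have hmR : ((B * (2 * K + 1) + 3 : ℕ) : ℝ) + 1 ≤ m := by exact_mod_cast hm
  push_cast at hmR
  have hBK : (0 : ℝ) ≤ (B : ℝ) * (2 * K + 1) := by positivity
  obtain ⟨tw, hw⟩ : (1 : ℝ) ∈ range ψ := by
    rw [h.rangeψ]; constructor <;> linarith
  obtain ⟨tz, hz⟩ : ((2 + B * (2 * K + 1) : ℕ) : ℝ) ∈ range ψ := by
    rw [h.rangeψ]; push_cast; constructor <;> linarith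
  have hwz : tw ≤ tz := by
    by_contra hc
    have := h.monoψ (not_le.1 hc).le
    rw [hw, hz] at this
    push_cast at this
    linarith
  obtain ⟨a, ha, s1, s2⟩ := h.near_s hw
  obtain ⟨a', ha', z1, z2⟩ := h.near_t hz
  have hφ := h.monoφ hwz
  have haa : a ≤ a' := by
    by_contra hc
    have h1 : (a' + 1) * (2 * K + 4) ≤ a * (2 * K + 4) := Nat.mul_le_mul_right _ (by omega)
    have h2 : ((a' : ℝ) + 1) * (2 * K + 4) ≤ a * (2 * K + 4) := by exact_mod_cast h1
    push_cast at s1 z2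
    nlinarith
  have hend : ((a * (2 * K + 4) + 2 + 2 * K : ℕ) : ℝ) ≤ φ tz := by
    have h1 : a * (2 * K + 4) ≤ a' * (2 * K + 4) := Nat.mul_le_mul_right _ haa
    have h2 : (a : ℝ) * (2 * K + 4) ≤ a' * (2 * K + 4) := by exact_mod_cast h1
    push_cast at z1 ⊢
    linarith
  obtain ⟨t0, h0, h0', e0⟩ := exists_time h.monoφ h.rangeφ hwz
    (x := (a * (2 * K + 4) + 2 : ℕ)) (by push_cast at s2 ⊢; linarith)
    (le_trans (by push_cast; linarith) hend)
  obtain ⟨b, hb, hat⟩ := h.at_zero hB ha e0 (by rw [← hw]; exact h.monoψ h0)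
    (by rw [← hz]; exact h.monoψ h0')
  -- The last bit is at position `2 * K - 1`; position `2 * K` is needed only as its neighbour.
  have key : ∀ r, r + 1 ≤ 2 * K → ∃ t ≤ tz, At K φ ψ a b r t := by
    intro r
    induction r with
    | zero => intro _; exact ⟨t0, h0', hat⟩
    | succ r ih =>
      intro hr
      obtain ⟨t, ht, hA⟩ := ih (by omega)
      obtain ⟨t', h1, h2, e⟩ := exists_time h.monoφ h.rangeφ ht
        (x := (a * (2 * K + 4) + 2 + (r + 1) : ℕ)) (by rw [hA.1]; push_cast; linarith)
        (le_trans (by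
          have : ((r + 1 : ℕ) : ℝ) ≤ ((2 * K : ℕ) : ℝ) := by exact_mod_cast (by omega : r + 1 ≤ 2 * K)
          push_cast at this ⊢; linarith) hend)
      exact ⟨t', h2, h.at_succ ha hb (by omega) h1 hA e⟩
  refine ⟨a, ha, b, hb, fun j hj => ?_⟩
  obtain ⟨t, _, hA⟩ := key (2 * j + 1) (by omega)
  exact h.not_both ha hb hj hA

end Narrow

end Frechet
end

noncomputable section
namespace Frechet
open Set

/-! The curves as inputs, and their Fréchet distance -/

/-- Coordinates of points in the plane spanned by the first two axes. -/
def planeCoords (M : Model) (n d : ℕ) (X Y : ℕ → ℕ) : Fin n → Fin d → M.S :=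
  fun i k => if (k : ℕ) = 0 then (X i : M.S) else if (k : ℕ) = 1 then (Y i : M.S) else 0

theorem points_planeCoords (M : Model) (n d : ℕ) (X Y : ℕ → ℕ) (i : Fin n) (k : Fin d) :
    points M (planeCoords M n d X Y) i k =
      if (k : ℕ) = 0 then (X i : ℝ) else if (k : ℕ) = 1 then (Y i : ℝ) else 0 := by
  simp only [points, planeCoords]
  split_ifs <;> simp

theorem norm_planeCoords_sub (M : Model) {n m d : ℕ} (hd : 2 ≤ d) (X Y X' Y' : ℕ → ℕ) (i : Fin n)
    (j : Fin m) :
    ‖points M (planeCoords M n d X Y) i - points M (planeCoords M m d X' Y') j‖ ^ 2 =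
      ((X i : ℝ) - X' j) ^ 2 + ((Y i : ℝ) - Y' j) ^ 2 := by
  obtain ⟨e, rfl⟩ := Nat.exists_eq_add_of_le' hd
  rw [EuclideanSpace.norm_sq_eq, Fin.sum_univ_succ, Fin.sum_univ_succ]
  simp [points_planeCoords]

theorem le_norm_sq {d : ℕ} (hd : 2 ≤ d) (z : EuclideanSpace ℝ (Fin d)) :
    z ⟨0, by omega⟩ ^ 2 + z ⟨1, by omega⟩ ^ 2 ≤ ‖z‖ ^ 2 := by
  obtain ⟨e, rfl⟩ := Nat.exists_eq_add_of_le' hd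
  rw [EuclideanSpace.norm_sq_eq, Fin.sum_univ_succ, Fin.sum_univ_succ]
  have : 0 ≤ ∑ i : Fin e, ‖z i.succ.succ‖ ^ 2 := Finset.sum_nonneg fun _ _ => sq_nonneg _
  simp only [Real.norm_eq_abs, sq_abs] at this ⊢
  have e0 : (⟨0, by omega⟩ : Fin (e + 2)) = 0 := rfl
  have e1 : (⟨1, by omega⟩ : Fin (e + 2)) = Fin.succ 0 := rfl
  rw [e0, e1]
  linarith

section

variable {M : Model} {K A B n m d : ℕ} [NeZero n] [NeZero m] {α β : ℕ → ℕ → ℕ}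

/-- The two curves of the reduction. -/
def leftCurve (M : Model) (n d K A : ℕ) (α : ℕ → ℕ → ℕ) : Fin n → Fin d → M.S :=
  planeCoords M n d (leftX K A α) (leftY K A)

def rightCurve (M : Model) (m d K B : ℕ) (β : ℕ → ℕ → ℕ) : Fin m → Fin d → M.S :=
  planeCoords M m d (rightX K B β) (rightY K B)

theorem le_dist_of_not_orthogonal (v : Variant) (hd : 2 ≤ d)
    (hn : A * (2 * K + 4) < n) (hm : B * (2 * K + 1) + 3 < m)
    (hB : 0 < B) (hK : 0 < K)
    (h : ¬ ∃ a < A, ∃ b < B, ∀ j < K, ¬ (α a j = 1 ∧ β b j = 1)) :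
    1001.5 ≤ dist v (points M (leftCurve M n d K A α)) (points M (rightCurve M m d K B β)) := by
  refine le_dist_of_contReparam v fun E φ hφ ψ hψ hE => ?_
  by_contra! hlt
  have hE0 : 0 ≤ E := (norm_nonneg _).trans (hE 0)
  refine h (Narrow.exists_orthogonal (n := n) (m := m) (φ := φ) (ψ := ψ)
    ⟨hφ.2.1, hψ.2.1, hφ.2.2, hψ.2.2, hm, fun t => ?_⟩ hB hK)
  have h1 := (le_norm_sq hd _).trans (pow_le_pow_left₀ (norm_nonneg _) (hE t) 2)
  -- `polyline` repeats the last vertex beyond the end. The padding does the same, as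
  -- `polyline_apply` requires.
  have cl : ∀ i, n - 1 ≤ i → leftX K A α i = 10 ∧ leftY K A i = 180 :=
    fun i hi => left_of_ge (by omega)
  have cr : ∀ i, m - 1 ≤ i → rightX K B β i = 910 ∧ rightY K B i = 180 :=
    fun i hi => right_of_ge (by omega)
  have e1 := polyline_apply (points M (leftCurve M n d K A α)) ⟨0, by omega⟩
    (fun i => leftX K A α i) (fun i => by simp [leftCurve, points_planeCoords])
    (fun i hi => by simp only [(cl i hi).1, (cl (n - 1) le_rfl).1]) (φ t)
  have e2 := polyline_apply (points M (leftCurve M n d K A α)) ⟨1, by omega⟩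
    (fun i => leftY K A i) (fun i => by simp [leftCurve, points_planeCoords])
    (fun i hi => by simp only [(cl i hi).2, (cl (n - 1) le_rfl).2]) (φ t)
  have e3 := polyline_apply (points M (rightCurve M m d K B β)) ⟨0, by omega⟩
    (fun i => rightX K B β i) (fun i => by simp [rightCurve, points_planeCoords])
    (fun i hi => by simp only [(cr i hi).1, (cr (m - 1) le_rfl).1]) (ψ t)
  have e4 := polyline_apply (points M (rightCurve M m d K B β)) ⟨1, by omega⟩
    (fun i => rightY K B i) (fun i => by simp [rightCurve, points_planeCoords])
    (fun i hi => by simp only [(cr i hi).2, (cr (m - 1) le_rfl).2]) (ψ t)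
  rw [PiLp.sub_apply, PiLp.sub_apply, e1, e2, e3, e4] at h1
  refine h1.trans_lt ?_
  gcongr

/-- The second curve waits at (910,180) until the first is at the entrance of block `a`. The first
waits there while the second goes to the vertex before zigzag `b`. Both pass their zigzags
diagonally, at distances 998 or 1000 by orthogonality. The first waits at its exit until the second
is back at (910,180), and then both run to their ends. -/
theorem dist_le_of_orthogonal (v : Variant) (hd : 2 ≤ d) (hα : ∀ a j, α a j ≤ 1)
    (hβ : ∀ b j, β b j ≤ 1) (hn : A * (2 * K + 4) < n) (hm : B * (2 * K + 1) + 3 < m)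
    (h : ∃ a < A, ∃ b < B, ∀ j < K, ¬ (α a j = 1 ∧ β b j = 1)) :
    dist v (points M (leftCurve M n d K A α)) (points M (rightCurve M m d K B β)) ≤ 1000 := by
  obtain ⟨a, ha, b, hb, hab⟩ := h
  refine dist_le_of_reach v ?_
  set C := Close (points M (leftCurve M n d K A α)) (points M (rightCurve M m d K B β)) 1000
  have hC : ∀ i j, i < n → j < m → ((leftX K A α i : ℝ) - rightX K B β j) ^ 2 +
      ((leftY K A i : ℝ) - rightY K B j) ^ 2 ≤ 1000 ^ 2 → C i j := fun i j hi hj hle => by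
    refine ⟨hi, hj, ?_⟩
    have := norm_planeCoords_sub M hd (leftX K A α) (leftY K A) (rightX K B β) (rightY K B)
      ⟨i, hi⟩ ⟨j, hj⟩
    exact le_of_sq_le_sq (by rw [leftCurve, rightCurve, this]; exact hle) (by norm_num)
  have hu : ∀ i j, i < n → j < m → rightX K B β j = 910 ∧ rightY K B j = 180 → C i j := by
    intro i j hi hj hj'
    refine hC i j hi hj ?_
    rw [hj'.1, hj'.2]
    have h1 : (9 : ℝ) ≤ leftX K A α i := by exact_mod_cast leftX_ge hα i
    have h2 : (leftX K A α i : ℝ) ≤ 85 := by exact_mod_cast leftX_le i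
    have h3 : (0 : ℝ) ≤ leftY K A i := Nat.cast_nonneg _
    have h4 : (leftY K A i : ℝ) ≤ 360 := by exact_mod_cast leftY_le i
    push_cast
    nlinarith
  have hblock : a * (2 * K + 4) + (2 * K + 3) < A * (2 * K + 4) := block_lt (by omega) ha
  have hblock' : b * (2 * K + 1) + 2 * K < B * (2 * K + 1) := block_lt (by omega) hb
  have hwide : ∀ i j, i < n → 2 ≤ j → j < 2 + B * (2 * K + 1) → leftX K A α i = 85 →
      leftY K A i ≤ 360 → C i j := by
    intro i j hi hj hj' hx hy
    refine hC i j hi (by omega) ?_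
    rw [hx]
    have h1 : (1009 : ℝ) ≤ rightX K B β j := by exact_mod_cast rightX_ge (by omega) hj'.le
    have h2 : (rightX K B β j : ℝ) ≤ 1011 := by exact_mod_cast rightX_inner_le hβ hj hj'
    have h3 : (0 : ℝ) ≤ rightY K B j := Nat.cast_nonneg _
    have h4 : (rightY K B j : ℝ) ≤ 360 := by exact_mod_cast rightY_le j
    have h5 : (0 : ℝ) ≤ leftY K A i := Nat.cast_nonneg _
    have h6 : (leftY K A i : ℝ) ≤ 360 := by exact_mod_cast hy
    push_cast
    nlinarith
  have hs := left_s (K := K) (α := α) ha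
  have ht := left_t (K := K) (α := α) ha
  have r1 : Reach C (a * (2 * K + 4) + 1) 0 :=
    (Reach.zero (hu 0 0 (by omega) (by omega) right_zero)).left (by omega)
      fun k _ hk => hu k 0 (by omega) (by omega) right_zero
  have r2 : Reach C (a * (2 * K + 4) + 1) (b * (2 * K + 1) + 1) :=
    r1.right (by omega) fun k h1 h2 => by
      rcases Nat.lt_or_ge 1 k with h3 | h3
      · exact hwide _ _ (by omega) h3 (by omega) hs.1 hs.2.le
      · obtain rfl : k = 1 := by omega
        refine hC _ _ (by omega) (by omega) ?_
        rw [hs.1, hs.2, right_one.1, (right_one (β := β)).2]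
        norm_num
  have r3 := r2.diag (2 * K + 1) fun k hk => by
    have e1 : a * (2 * K + 4) + 1 + k + 1 = a * (2 * K + 4) + 2 + k := by omega
    have e2 : b * (2 * K + 1) + 1 + k + 1 = 2 + b * (2 * K + 1) + k := by omega
    refine hC _ _ (by omega) (by omega) ?_
    rw [e1, e2, leftX_gadget ha (by omega), leftY_gadget ha (by omega),
      (right_gadget hb (by omega)).1, (right_gadget (β := β) hb (by omega)).2, sub_self]
    have b1 := gadgetBit_le (hα a) k
    have b2 := gadgetBit_le (hβ b) k
    have b3 : ¬ (gadgetBit (α a) k = 1 ∧ gadgetBit (β b) k = 1) := by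
      unfold gadgetBit
      split_ifs with hp
      · exact hab (k / 2) (by omega)
      · simp
    interval_cases h1 : gadgetBit (α a) k <;> interval_cases h2 : gadgetBit (β b) k <;>
      first | exact absurd ⟨rfl, rfl⟩ b3 | norm_num
  have e1 : a * (2 * K + 4) + 1 + (2 * K + 1) = a * (2 * K + 4) + (2 * K + 2) := by omega
  have e2 : b * (2 * K + 1) + 1 + (2 * K + 1) = 2 + b * (2 * K + 1) + 2 * K := by omega
  rw [e1, e2] at r3
  have r4 : Reach C (a * (2 * K + 4) + (2 * K + 3)) (2 + b * (2 * K + 1) + 2 * K) :=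
    r3.left (by omega) fun k h1 h2 => by
      obtain rfl : k = a * (2 * K + 4) + (2 * K + 3) := by omega
      exact hwide _ _ (by omega) (by omega) (by omega) ht.1 (by omega)
  have r5 : Reach C (a * (2 * K + 4) + (2 * K + 3)) (3 + B * (2 * K + 1)) :=
    r4.right (by omega) fun k h1 h2 => by
      rcases lt_trichotomy k (2 + B * (2 * K + 1)) with h3 | h3 | h3
      · exact hwide _ _ (by omega) (by omega) h3 ht.1 (by omega)
      · refine hC _ _ (by omega) (by omega) ?_
        rw [h3, ht.1, ht.2, right_z.1, (right_z (β := β)).2]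
        norm_num
      · exact hu _ _ (by omega) (by omega) (right_of_ge (by omega))
  have r6 : Reach C (n - 1) (3 + B * (2 * K + 1)) :=
    r5.left (by omega) fun k _ _ => hu _ _ (by omega) (by omega) (right_of_ge le_rfl)
  exact r6.right (by omega) fun k _ _ => hu _ _ (by omega) (by omega) (right_of_ge (by omega))

end

/-! Assignments -/

/-- The literals of clause `j` that are made true by setting variable `i` to bit `e`. -/
def litTrue {N K : ℕ} (F : CNF N K) (e : Bool) (j i : ℕ) : Prop :=
  ∃ (hj : j < K) (hi : i < N), if e then ⟨i, hi⟩ ∈ F.pos ⟨j, hj⟩ else ⟨i, hi⟩ ∈ F.neg ⟨j, hj⟩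

open Classical in
/-- Whether the assignment of the variables `lo ≤ i < hi` by the bits of `c` fails to satisfy
clause `j`. -/
def failBit {N K : ℕ} (F : CNF N K) (lo hi c j : ℕ) : ℕ :=
  if ∃ i, i < hi - lo ∧ litTrue F (c.testBit i) j (lo + i) then 0 else 1

theorem failBit_le {N K : ℕ} (F : CNF N K) (lo hi c j : ℕ) : failBit F lo hi c j ≤ 1 := by
  unfold failBit; split_ifs <;> simp

/-- A clause holds iff one of the two partial assignments makes one of its literals true. Partial
assignments are given by the binary digits of `a` and `b`; digits beyond the last variable are
ignored, so `s + r` may exceed `N`. -/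
theorem satisfiable_iff {N K : ℕ} (F : CNF N K) {s r : ℕ} (hsr : N ≤ s + r) :
    F.Satisfiable ↔ ∃ a < 2 ^ s, ∃ b < 2 ^ r, ∀ j < K,
      ¬ (failBit F 0 (min s N) a j = 1 ∧ failBit F s N b j = 1) := by
  have key : ∀ lo hi c j, failBit F lo hi c j = 1 ↔
      ¬ ∃ i, i < hi - lo ∧ litTrue F (c.testBit i) j (lo + i) := by
    intro lo hi c j
    unfold failBit
    split_ifs with h <;> simp only [h] <;> simp
  simp only [key, ← not_or, not_not]
  constructor
  · rintro ⟨x, hx⟩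
    let f : ℕ → Bool := fun i => if h : i < N then x ⟨i, h⟩ else false
    have hbits : ∀ (t : ℕ) (g : ℕ → Bool), ∃ a < 2 ^ t, ∀ i < t, a.testBit i = g i := by
      intro t g
      refine ⟨(BitVec.ofFnLE fun i : Fin t => g i).toNat, BitVec.isLt _, fun i hi => ?_⟩
      rw [BitVec.testBit_toNat, BitVec.getLsbD_ofFnLE]
      simp [hi]
    obtain ⟨a, ha, ha'⟩ := hbits s f
    obtain ⟨b, hb, hb'⟩ := hbits r fun i => f (s + i)
    refine ⟨a, ha, b, hb, fun j hj => ?_⟩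
    have main : ∀ (i : Fin N) (e : Bool), x i = e →
        (if e then i ∈ F.pos ⟨j, hj⟩ else i ∈ F.neg ⟨j, hj⟩) →
        (∃ i, i < min s N - 0 ∧ litTrue F (a.testBit i) j (0 + i)) ∨
          ∃ i, i < N - s ∧ litTrue F (b.testBit i) j (s + i) := by
      intro i e he hie
      have hi := i.2
      have hf : f i = e := by simp [f, he]
      rcases Nat.lt_or_ge i s with h | h
      · refine .inl ⟨i, by omega, ?_⟩
        rw [ha' i h, hf]
        exact ⟨hj, by omega, by simpa using hie⟩
      · refine .inr ⟨i - s, by omega, ?_⟩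
        rw [hb' _ (by omega), show s + (i - s) = (i : ℕ) by omega, hf]
        exact ⟨hj, by omega, by simpa using hie⟩
    rcases hx ⟨j, hj⟩ with ⟨i, h1, h2⟩ | ⟨i, h1, h2⟩
    · exact main i true h2 (by simpa using h1)
    · exact main i false h2 (by simpa using h1)
  · rintro ⟨a, -, b, -, hab⟩
    refine ⟨fun i => if (i : ℕ) < s then a.testBit i else b.testBit (i - s), fun j => ?_⟩
    rcases hab j j.2 with ⟨i, hi, hj, hi', hl⟩ | ⟨i, hi, hj, hi', hl⟩
    · have his : 0 + i < s := by omega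
      cases hb : a.testBit i
      · refine .inr ⟨_, by simpa [hb] using hl, ?_⟩
        simpa [show i < s by omega] using hb
      · refine .inl ⟨_, by simpa [hb] using hl, ?_⟩
        simpa [show i < s by omega] using hb
    · cases hb : b.testBit i
      · refine .inr ⟨_, by simpa [hb] using hl, ?_⟩
        simpa using hb
      · refine .inl ⟨_, by simpa [hb] using hl, ?_⟩
        simpa using hb

end Frechet
end

noncomputable section
namespace Frechet
open Set

/-! Running programs on bounded numbers -/

/-- Small natural numbers are scalars of small size. -/
class SmallScalars (M : Model) : Prop where
  size_le : ∀ a : ℕ, a ≤ 1085 → M.size (a : M.S) ≤ 20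

instance : SmallScalars realRAM := ⟨fun _ _ => by simp [realRAM]⟩

instance : SmallScalars logCostRAM := ⟨fun a ha => by
  have h1 : Nat.size a ≤ 11 := Nat.size_le.2 (by omega)
  have h2 : Nat.size 1 = 1 := by norm_num
  change Nat.size (a : ℚ).num.natAbs + (Nat.size (a : ℚ).den + 1) ≤ 20
  rw [Rat.num_natCast, Rat.den_natCast, Int.natAbs_natCast, h2]
  omega⟩

variable {M : Model}

/-- All natural numbers have at most `E` bits, and the scalar registers are small. -/
structure Good (E : ℕ) (σ : State M) : Prop where
  reg : ∀ r, σ.reg r < 2 ^ E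
  arr : ∀ A i, σ.arr A i < 2 ^ E
  sreg : ∀ x, M.size (σ.sreg x) ≤ 20

/-- The result of the instruction is sufficiently small. -/
def Instr.Safe (E : ℕ) : Instr M → State M → Prop
  | .const _ a, _ => a < 2 ^ E
  | .op .add _ s t, σ => σ.reg s + σ.reg t < 2 ^ E
  | .op .mul _ s t, σ => σ.reg s * σ.reg t < 2 ^ E
  | .op _ _ _ _, _ => True
  | .load _ _ _, _ => True
  | .store _ _ _, _ => True
  | .ofNat _ r, σ => σ.reg r ≤ 1085
  | .sstore _ _ _, _ => True
  | _, _ => False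

/-- A bound for the cost of an instruction on numbers of at most `E` bits. -/
def unitCost (E : ℕ) : ℕ := 3 * E + 30

theorem bits_le {a E : ℕ} (h : a < 2 ^ E) : bits a ≤ E + 1 := Nat.succ_le_succ (Nat.size_le.2 h)

theorem update_lt {E : ℕ} {f : ℕ → ℕ} (hf : ∀ r, f r < 2 ^ E) {r a : ℕ} (ha : a < 2 ^ E) :
    ∀ s, Function.update f r a s < 2 ^ E := fun s => by
  rw [Function.update_apply]; split_ifs <;> simp [hf, ha]

theorem NatOp.eval_lt {E : ℕ} {o : NatOp} {r s t : ℕ} {σ : State M} (hσ : Good E σ)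
    (h : (Instr.op o r s t : Instr M).Safe E σ) : o.eval (σ.reg s) (σ.reg t) < 2 ^ E := by
  have := hσ.reg s
  cases o with
  | add => exact h
  | sub => exact (Nat.sub_le _ _).trans_lt this
  | mul => exact h
  | div => exact (Nat.div_le_self _ _).trans_lt this
  | mod => exact (Nat.mod_le _ _).trans_lt this

theorem Good.run [SmallScalars M] {E : ℕ} {σ : State M} (hσ : Good E σ) {i : Instr M}
    (h : i.Safe E σ) : Good E (i.run σ) ∧ i.cost σ ≤ unitCost E := by
  have hr := fun r => bits_le (hσ.reg r)
  have ha := fun A i => bits_le (hσ.arr A i)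
  have hx := hσ.sreg
  unfold unitCost
  cases i with
  | const r a =>
    refine ⟨⟨update_lt hσ.reg h, hσ.arr, hσ.sreg⟩, ?_⟩
    have := bits_le (show a < 2 ^ E from h)
    simp only [Instr.cost]; omega
  | op o r s t =>
    have he := NatOp.eval_lt hσ h
    refine ⟨⟨update_lt hσ.reg he, hσ.arr, hσ.sreg⟩, ?_⟩
    have := bits_le he
    have := hr s
    have := hr t
    simp only [Instr.cost]; omega
  | load r A s =>
    refine ⟨⟨update_lt hσ.reg (hσ.arr _ _), hσ.arr, hσ.sreg⟩, ?_⟩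
    have := hr s
    have := ha A (σ.reg s)
    simp only [Instr.cost]; omega
  | store A s t =>
    refine ⟨⟨hσ.reg, fun B i => ?_, hσ.sreg⟩, ?_⟩
    · simp only [Instr.run, Function.update_apply]
      split_ifs
      · rw [Function.update_apply]; split_ifs <;> simp [hσ.reg, hσ.arr]
      · exact hσ.arr _ _
    · have := hr s
      have := hr t
      simp only [Instr.cost]; omega
  | ofNat x r =>
    have hs := SmallScalars.size_le (M := M) (σ.reg r) h
    refine ⟨⟨hσ.reg, hσ.arr, fun y => ?_⟩, ?_⟩
    · simp only [Instr.run, Function.update_apply]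
      split_ifs
      · exact hs
      · exact hσ.sreg y
    · have := hr r
      simp only [Instr.cost]; omega
  | sstore A s x =>
    refine ⟨⟨hσ.reg, hσ.arr, hσ.sreg⟩, ?_⟩
    have := hr s
    have := hx x
    simp only [Instr.cost]; omega
  | sop => exact h.elim
  | sload => exact h.elim
  | fn => exact h.elim
  | cast => exact h.elim

/-- The program halts within `s` steps on numbers of at most `E` bits in a memory with
property `Q`. -/
def Runs (E : ℕ) (P : Program M) (σ : State M) (s : ℕ) (Q : State M → Prop) : Prop :=
  ∃ τ t, Exec P σ τ t ∧ t ≤ s * unitCost E ∧ Good E τ ∧ Q τ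

namespace Runs

variable {E s s' s₁ s₂ : ℕ} {P P' : Program M} {σ : State M} {Q R : State M → Prop}

theorem mono (h : Runs E P σ s Q) (hs : s ≤ s') (hQ : ∀ τ, Q τ → R τ) : Runs E P σ s' R := by
  obtain ⟨τ, t, h1, h2, h3, h4⟩ := h
  exact ⟨τ, t, h1, h2.trans (Nat.mul_le_mul_right _ hs), h3, hQ _ h4⟩

theorem basic [SmallScalars M] {i : Instr M} (hσ : Good E σ) (h : i.Safe E σ) (hQ : Q (i.run σ)) :
    Runs E (.basic i) σ 1 Q :=
  ⟨_, _, .basic i σ, by simpa using (hσ.run h).2, (hσ.run h).1, hQ⟩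

theorem seq (h : Runs E P σ s₁ R) (h' : ∀ τ, Good E τ → R τ → Runs E P' τ s₂ Q) :
    Runs E (.seq P P') σ (s₁ + s₂) Q := by
  obtain ⟨τ, t, h1, h2, h3, h4⟩ := h
  obtain ⟨τ', t', h1', h2', h3', h4'⟩ := h' τ h3 h4
  exact ⟨τ', t + t', .seq h1 h1', by rw [Nat.add_mul]; omega, h3', h4'⟩

theorem test_le {r r' : ℕ} (hσ : Good E σ) : (Test.lt r r').cost σ ≤ unitCost E := by
  have := bits_le (hσ.reg r)
  have := bits_le (hσ.reg r')
  simp only [Test.cost, unitCost]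
  omega

theorem cond {r r' : ℕ} (hσ : Good E σ) (h1 : σ.reg r < σ.reg r' → Runs E P σ s Q)
    (h2 : ¬ σ.reg r < σ.reg r' → Runs E P' σ s Q) : Runs E (.cond (.lt r r') P P') σ (s + 1) Q := by
  have hc := test_le (r := r) (r' := r') hσ
  by_cases h : σ.reg r < σ.reg r'
  · obtain ⟨τ, t, h1, h2, h3, h4⟩ := h1 h
    exact ⟨τ, _, .condTrue h h1, by rw [Nat.add_mul]; omega, h3, h4⟩
  · obtain ⟨τ, t, h1, h2, h3, h4⟩ := h2 h
    exact ⟨τ, _, .condFalse h h1, by rw [Nat.add_mul]; omega, h3, h4⟩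

/-- A loop that is run `n` times, with invariant `I`. -/
theorem loop {r r' n : ℕ} (I : ℕ → State M → Prop)
    (hb : ∀ k τ, I k τ → (τ.reg r < τ.reg r' ↔ k < n))
    (hP : ∀ k τ, k < n → Good E τ → I k τ → Runs E P τ s (I (k + 1)))
    (hσ : Good E σ) (h0 : I 0 σ) :
    Runs E (.loop (.lt r r') P) σ (n * (s + 1) + 1) (I n) := by
  have key : ∀ l k τ, k + l = n → Good E τ → I k τ →
      Runs E (.loop (.lt r r') P) τ (l * (s + 1) + 1) (I n) := by
    intro l
    induction l with
    | zero =>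
      intro k τ hk hτ hI
      have h : ¬ τ.reg r < τ.reg r' := by rw [hb k τ hI]; omega
      exact ⟨τ, _, .loopFalse h, by simpa using test_le hτ, hτ, by rwa [show n = k by omega]⟩
    | succ l ih =>
      intro k τ hk hτ hI
      have h : τ.reg r < τ.reg r' := by rw [hb k τ hI]; omega
      obtain ⟨τ', t', h1, h2, h3, h4⟩ := hP k τ (by omega) hτ hI
      obtain ⟨τ'', t'', h1', h2', h3', h4'⟩ := ih (k + 1) τ' (by omega) h3 h4
      refine ⟨τ'', _, .loopTrue h h1 h1', ?_, h3', h4'⟩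
      have := test_le (r := r) (r' := r') hτ
      have e : ((l + 1) * (s + 1) + 1) * unitCost E =
          unitCost E + s * unitCost E + (l * (s + 1) + 1) * unitCost E := by ring
      rw [e]
      show (Test.lt r r').cost τ + t' + t'' ≤ _
      omega
  exact key n 0 σ (by omega) hσ h0

end Runs

/-! ### Straight-line programs and unchanged parts of the memory. -/

/-- Straight-line programs. -/
def block : Instr M → List (Instr M) → Program M
  | i, [] => .basic i
  | i, j :: l => .seq (.basic i) (block j l)

def runBlock (σ : State M) (l : List (Instr M)) : State M := l.foldl (fun σ i => i.run σ) σ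

def SafeBlock (E : ℕ) : State M → List (Instr M) → Prop
  | _, [] => True
  | σ, i :: l => i.Safe E σ ∧ SafeBlock E (i.run σ) l

theorem Runs.block [SmallScalars M] {E : ℕ} {i : Instr M} {l : List (Instr M)} {σ : State M}
    {Q : State M → Prop} (hσ : Good E σ) (h : SafeBlock E σ (i :: l))
    (hQ : Q (runBlock σ (i :: l))) : Runs E (block i l) σ (l.length + 1) Q := by
  induction l generalizing i σ with
  | nil => exact Runs.basic hσ h.1 hQ
  | cons j l ih =>
    have := (Runs.basic (E := E) (Q := fun τ => τ = i.run σ) hσ h.1 rfl).seq (s₂ := l.length + 1)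
      (Q := Q) (P' := Frechet.block j l) (by rintro τ hτ rfl; exact ih hτ h.2 hQ)
    exact this.mono (by simp; omega) fun _ h => h

/-- The program writes only into registers of natural numbers with property `S`. -/
def Program.Writes (S : ℕ → Prop) : Program M → Prop
  | .basic (.const r _) => S r
  | .basic (.op _ r _ _) => S r
  | .basic (.load r _ _) => S r
  | .basic _ => False
  | .seq P Q => P.Writes S ∧ Q.Writes S
  | .cond _ P Q => P.Writes S ∧ Q.Writes S
  | .loop _ P => P.Writes S

/-- The two memories differ only in registers of natural numbers with property `S`. -/
structure Frame (S : ℕ → Prop) (σ τ : State M) : Prop where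
  reg : ∀ r, ¬ S r → τ.reg r = σ.reg r
  arr : τ.arr = σ.arr
  sreg : τ.sreg = σ.sreg
  sarr : τ.sarr = σ.sarr

theorem Frame.refl (S : ℕ → Prop) (σ : State M) : Frame S σ σ := ⟨fun _ _ => rfl, rfl, rfl, rfl⟩

theorem Frame.trans {S : ℕ → Prop} {σ τ υ : State M} (h : Frame S σ τ) (h' : Frame S τ υ) :
    Frame S σ υ :=
  ⟨fun r hr => (h'.reg r hr).trans (h.reg r hr), h'.arr.trans h.arr, h'.sreg.trans h.sreg,
    h'.sarr.trans h.sarr⟩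

theorem Exec.frame {S : ℕ → Prop} {P : Program M} {σ τ : State M} {t : ℕ} (h : Exec P σ τ t)
    (hP : P.Writes S) : Frame S σ τ := by
  have hupd : ∀ (σ : State M) r a, S r → Frame S σ { σ with reg := Function.update σ.reg r a } :=
    fun σ r a hr => ⟨fun s hs => by
      simp only [Function.update_apply]
      rw [if_neg]; rintro rfl; exact hs hr, rfl, rfl, rfl⟩
  induction h with
  | basic i σ =>
    cases i with
    | const r a => exact hupd _ _ _ hP
    | op o r s t => exact hupd _ _ _ hP
    | load r A s => exact hupd _ _ _ hP
    | store => exact hP.elim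
    | ofNat => exact hP.elim
    | sop => exact hP.elim
    | sload => exact hP.elim
    | sstore => exact hP.elim
    | fn => exact hP.elim
    | cast => exact hP.elim
  | seq _ _ ih1 ih2 => exact (ih1 hP.1).trans (ih2 hP.2)
  | condTrue _ _ ih => exact ih hP.1
  | condFalse _ _ ih => exact ih hP.2
  | loopTrue _ _ _ ih1 ih2 => exact (ih1 hP).trans (ih2 hP)
  | loopFalse _ => exact .refl _ _

theorem Runs.frame {E s : ℕ} {P : Program M} {σ : State M} {Q : State M → Prop} {S : ℕ → Prop}
    (h : Runs E P σ s Q) (hP : P.Writes S) : Runs E P σ s fun τ => Q τ ∧ Frame S σ τ := by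
  obtain ⟨τ, t, h1, h2, h3, h4⟩ := h
  exact ⟨τ, t, h1, h2, h3, h4, h1.frame hP⟩

/-- The size of a computed scalar is bounded by the running time. -/
theorem Exec.size_sreg_le {P : Program M} {σ τ : State M} {t : ℕ} (h : Exec P σ τ t) (x : ℕ) :
    M.size (τ.sreg x) ≤ M.size (σ.sreg x) + t := by
  induction h with
  | basic i σ =>
    -- Each instruction that writes a scalar register pays for the size of the result.
    cases i <;> simp only [Instr.run, Instr.cost, Function.update_apply] <;>
      first | omega | (split_ifs with h <;> omega)
  | seq _ _ ih1 ih2 => omega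
  | condTrue _ _ ih => omega
  | condFalse _ _ ih => omega
  | loopTrue _ _ _ ih1 ih2 => omega
  | loopFalse _ => omega

end Frechet
end

noncomputable section
namespace Frechet
open Set

variable {M : Model}

/-! ### Programs that compute single vertices. -/

theorem flatten_apply {a b : ℕ} {α : Type} [Zero α] (f : Fin a → Fin b → α) {i j : ℕ} (hi : i < a)
    (hj : j < b) : flatten f (i * b + j) = f ⟨i, hi⟩ ⟨j, hj⟩ := by
  have h : i * b + j < a * b := block_lt hj hi
  rw [flatten, dif_pos h]
  congr 1 <;> apply Fin.ext
  · simp [block_div hj]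
  · simp [block_mod hj]

/-- The arrays of the memory that hold the formula. -/
structure HoldsCNF {N K : ℕ} (F : CNF N K) (σ : State M) : Prop where
  arr_zero : σ.arr 0 = flatten fun j i => if i ∈ F.pos j then 1 else 0
  arr_one : σ.arr 1 = flatten fun j i => if i ∈ F.neg j then 1 else 0

/-- The scratch registers of the programs that compute single vertices. They expect the index of
the vertex in register `15` and leave its coordinates in the registers `22` and `23`. -/
def gadgetRegs (r : ℕ) : Prop := 16 ≤ r ∧ r < 30

/-- Compute in register `21` whether the assignment in register `16` of the variables between the
registers `19` and `20` fails for the clause in register `18`. -/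
def failLoop : Program M :=
  -- Registers `0`, `2`, `3` hold `N`, 1 and 2. The lowest digit of the assignment selects between
  -- the positive and the negative incidence matrix, and is then divided off.
  .loop (.lt 19 20) (block (.op .mul 24 18 0) [.op .add 24 24 19, .load 25 0 24, .load 26 1 24,
    .op .mod 27 16 3, .op .mul 25 25 27, .op .sub 21 21 25, .op .sub 27 2 27, .op .mul 26 26 27,
    .op .sub 21 21 26, .op .div 16 16 3, .op .add 19 19 2])

theorem failBit_of_exists {N K : ℕ} (F : CNF N K) {lo hi c j : ℕ}
    (h : ∃ i, i < hi - lo ∧ litTrue F (c.testBit i) j (lo + i)) : failBit F lo hi c j = 0 :=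
  if_pos h

theorem failBit_of_not_exists {N K : ℕ} (F : CNF N K) {lo hi c j : ℕ}
    (h : ¬ ∃ i, i < hi - lo ∧ litTrue F (c.testBit i) j (lo + i)) : failBit F lo hi c j = 1 :=
  if_neg h

/-- The recursion as the machine evaluates it: a true literal subtracts 1, and truncated subtraction
keeps the bit at 0 from then on. -/
theorem failBit_succ {N K : ℕ} (F : CNF N K) {lo k c j : ℕ} (hj : j < K) (hk : lo + k < N) :
    failBit F lo (lo + (k + 1)) c j = failBit F lo (lo + k) c j
      - (if (⟨lo + k, hk⟩ : Fin N) ∈ F.pos ⟨j, hj⟩ then 1 else 0) * (c / 2 ^ k % 2)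
      - (if (⟨lo + k, hk⟩ : Fin N) ∈ F.neg ⟨j, hj⟩ then 1 else 0) * (1 - c / 2 ^ k % 2) := by
  have hsplit : (∃ i, i < lo + (k + 1) - lo ∧ litTrue F (c.testBit i) j (lo + i)) ↔
      (∃ i, i < lo + k - lo ∧ litTrue F (c.testBit i) j (lo + i)) ∨
        litTrue F (c.testBit k) j (lo + k) := by
    constructor
    · rintro ⟨i, hi, h⟩
      rcases Nat.lt_or_ge i k with h' | h'
      · exact .inl ⟨i, by omega, h⟩
      · obtain rfl : i = k := by omega
        exact .inr h
    · rintro (⟨i, hi, h⟩ | h)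
      · exact ⟨i, by omega, h⟩
      · exact ⟨k, by omega, h⟩
  have hlit : litTrue F (c.testBit k) j (lo + k) ↔
      if c.testBit k then (⟨lo + k, hk⟩ : Fin N) ∈ F.pos ⟨j, hj⟩ else
        (⟨lo + k, hk⟩ : Fin N) ∈ F.neg ⟨j, hj⟩ :=
    ⟨fun ⟨_, _, h⟩ => h, fun h => ⟨hj, hk, h⟩⟩
  have hb : c.testBit k = decide (c / 2 ^ k % 2 = 1) := Nat.testBit_eq_decide_div_mod_eq
  by_cases h1 : ∃ i, i < lo + k - lo ∧ litTrue F (c.testBit i) j (lo + i)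
  · rw [failBit_of_exists F h1, failBit_of_exists F (hsplit.2 (.inl h1))]
    simp
  · rw [failBit_of_not_exists F h1]
    by_cases h2 : litTrue F (c.testBit k) j (lo + k)
    · rw [failBit_of_exists F (hsplit.2 (.inr h2))]
      rw [hlit, hb] at h2
      rcases Nat.mod_two_eq_zero_or_one (c / 2 ^ k) with h3 | h3 <;> simp [h3] at h2 <;>
        simp [h3, h2]
    · rw [failBit_of_not_exists F (fun h => (hsplit.1 h).elim h1 h2)]
      rw [hlit, hb] at h2
      rcases Nat.mod_two_eq_zero_or_one (c / 2 ^ k) with h3 | h3 <;> simp [h3] at h2 <;>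
        simp [h3, h2]

theorem failLoop_writes : (failLoop : Program M).Writes gadgetRegs := by
  simp [failLoop, block, Program.Writes, gadgetRegs]

theorem runs_failLoop [SmallScalars M] {E N K lo hi c j : ℕ} (F : CNF N K) {σ : State M}
    (hσ : Good E σ) (hF : HoldsCNF F σ) (hE : K * N + N < 2 ^ E) (h0 : σ.reg 0 = N)
    (h2 : σ.reg 2 = 1) (h3 : σ.reg 3 = 2) (h16 : σ.reg 16 = c) (h18 : σ.reg 18 = j) (hj : j < K)
    (h19 : σ.reg 19 = lo) (h20 : σ.reg 20 = hi) (hhi : hi ≤ N) (h21 : σ.reg 21 = 1) :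
    Runs E failLoop σ (13 * N + 1) fun τ => τ.reg 21 = failBit F lo hi c j ∧
      τ.reg 17 = σ.reg 17 ∧ τ.reg 22 = σ.reg 22 ∧ τ.reg 23 = σ.reg 23 ∧ Frame gadgetRegs σ τ := by
  let I : ℕ → State M → Prop := fun k τ => τ.reg 16 = c / 2 ^ k ∧ τ.reg 18 = j ∧
    τ.reg 19 = lo + k ∧ τ.reg 20 = hi ∧ τ.reg 21 = failBit F lo (lo + k) c j ∧
    (τ.reg 17 = σ.reg 17 ∧ τ.reg 22 = σ.reg 22 ∧ τ.reg 23 = σ.reg 23) ∧ Frame gadgetRegs σ τ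
  have hloop : Runs E failLoop σ ((hi - lo) * (12 + 1) + 1) (I (hi - lo)) := by
    refine Runs.loop I ?_ ?_ hσ ?_
    · rintro k τ ⟨-, -, e19, e20, -⟩
      rw [e19, e20]; omega
    · rintro k τ hk hτ ⟨e16, e18, e19, e20, e21, ⟨e17, e22, e23⟩, hfr⟩
      have e0 : τ.reg 0 = N := by rw [hfr.reg 0 (by simp [gadgetRegs]), h0]
      have e2 : τ.reg 2 = 1 := by rw [hfr.reg 2 (by simp [gadgetRegs]), h2]
      have e3 : τ.reg 3 = 2 := by rw [hfr.reg 3 (by simp [gadgetRegs]), h3]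
      have hlt : lo + k < N := by omega
      have hblk : j * N + (lo + k) < K * N := block_lt hlt hj
      have a0 : τ.arr 0 (j * N + (lo + k)) =
          if (⟨lo + k, hlt⟩ : Fin N) ∈ F.pos ⟨j, hj⟩ then 1 else 0 := by
        rw [hfr.arr, hF.arr_zero, flatten_apply _ hj hlt]
      have a1 : τ.arr 1 (j * N + (lo + k)) =
          if (⟨lo + k, hlt⟩ : Fin N) ∈ F.neg ⟨j, hj⟩ then 1 else 0 := by
        rw [hfr.arr, hF.arr_one, flatten_apply _ hj hlt]
      have hle : ∀ x y : ℕ, x ≤ 1 → y ≤ 1 → x * y < 2 ^ E := fun x y hx hy => by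
        have := hτ.reg 2
        rw [e2] at this
        exact (Nat.mul_le_mul hx hy).trans_lt this
      have m1 : τ.arr 0 (j * N + (lo + k)) * (c / 2 ^ k % 2) < 2 ^ E :=
        hle _ _ (by rw [a0]; split_ifs <;> simp) (by omega)
      have m2 : τ.arr 1 (j * N + (lo + k)) * (1 - c / 2 ^ k % 2) < 2 ^ E :=
        hle _ _ (by rw [a1]; split_ifs <;> simp) (by omega)
      have hbody := Runs.block (E := E) (i := .op .mul 24 18 0) (l := [.op .add 24 24 19,
        .load 25 0 24, .load 26 1 24,
        .op .mod 27 16 3, .op .mul 25 25 27, .op .sub 21 21 25, .op .sub 27 2 27, .op .mul 26 26 27,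
        .op .sub 21 21 26, .op .div 16 16 3, .op .add 19 19 2]) (σ := τ)
        (Q := fun τ' => τ'.reg 16 = c / 2 ^ (k + 1) ∧ τ'.reg 18 = j ∧
          τ'.reg 19 = lo + (k + 1) ∧ τ'.reg 20 = hi ∧
          τ'.reg 21 = failBit F lo (lo + (k + 1)) c j ∧
          (τ'.reg 17 = σ.reg 17 ∧ τ'.reg 22 = σ.reg 22 ∧ τ'.reg 23 = σ.reg 23)) hτ ?_ ?_
      · refine (hbody.frame (S := gadgetRegs) ?_).mono le_rfl ?_
        · simp [block, Program.Writes, gadgetRegs]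
        · rintro τ' ⟨⟨q1, q2, q3, q4, q5, q6⟩, hfr'⟩
          exact ⟨q1, q2, q3, q4, q5, q6, hfr.trans hfr'⟩
      · simp only [SafeBlock, Instr.Safe, Instr.run, NatOp.eval, Function.update_apply, e16, e18,
          e19, e21, e0, e2, e3]
        norm_num
        exact ⟨by omega, by omega, m1, m2, by omega⟩
      · simp only [runBlock, List.foldl, Instr.run, NatOp.eval, Function.update_apply, e16, e18,
          e19, e20, e21, e0, e2, e3, e17, e22, e23]
        norm_num
        refine ⟨?_, by omega, ?_⟩
        · rw [pow_succ, Nat.div_div_eq_div_mul]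
        · rw [a0, a1]
          have := failBit_succ F (c := c) hj hlt
          rw [this]
    · exact ⟨by simp [h16], h18, by simp [h19], h20, by simp [h21, failBit], ⟨rfl, rfl, rfl⟩,
        .refl _ _⟩
  refine hloop.mono ?_ ?_
  · have : hi - lo ≤ N := by omega
    nlinarith
  · rintro τ ⟨-, -, -, -, e21, ⟨e17, e22, e23⟩, hfr⟩
    refine ⟨?_, e17, e22, e23, hfr⟩
    rw [e21]
    unfold failBit
    rw [show lo + (hi - lo) - lo = hi - lo by omega]

theorem Runs.basic_le [SmallScalars M] {E s : ℕ} {i : Instr M} {σ : State M} {Q : State M → Prop}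
    (hσ : Good E σ) (hs : 1 ≤ s) (h : i.Safe E σ) (hQ : Q (i.run σ)) : Runs E (.basic i) σ s Q :=
  (Runs.basic hσ h hQ).mono hs fun _ h => h

theorem Runs.block_le [SmallScalars M] {E s : ℕ} {i : Instr M} {l : List (Instr M)} {σ : State M}
    {Q : State M → Prop} (hσ : Good E σ) (hs : l.length + 1 ≤ s) (h : SafeBlock E σ (i :: l))
    (hQ : Q (runBlock σ (i :: l))) : Runs E (Frechet.block i l) σ s Q :=
  (Runs.block hσ h hQ).mono hs fun _ h => h

theorem Runs.seq_basic [SmallScalars M] {E s s' : ℕ} {P : Program M} {i : Instr M} {σ : State M}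
    {Q : State M → Prop} (hσ : Good E σ) (hs : s + 1 ≤ s') (h : i.Safe E σ)
    (hP : Good E (i.run σ) → Runs E P (i.run σ) s Q) : Runs E (.seq (.basic i) P) σ s' Q :=
  ((Runs.basic (Q := fun τ => τ = i.run σ) hσ h rfl).seq (s₂ := s)
    (by rintro τ hτ rfl; exact hP hτ)).mono (by omega) fun _ h => h

theorem Runs.seq_block [SmallScalars M] {E s s' : ℕ} {P : Program M} {i : Instr M}
    {l : List (Instr M)} {σ : State M} {Q : State M → Prop} (hσ : Good E σ)
    (hs : s + (l.length + 1) ≤ s') (h : SafeBlock E σ (i :: l))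
    (hP : ∀ τ, Good E τ → τ = runBlock σ (i :: l) → Runs E P τ s Q) :
    Runs E (.seq (Frechet.block i l) P) σ s' Q :=
  ((Runs.block (Q := fun τ => τ = runBlock σ (i :: l)) hσ h rfl).seq (s₂ := s)
    fun τ hτ h => hP τ hτ h).mono (by omega) fun _ h => h

theorem Runs.seq_le {E s s₁ s₂ : ℕ} {P P' : Program M} {σ : State M} {Q R : State M → Prop}
    (h : Runs E P σ s₁ R) (hs : s₁ + s₂ ≤ s) (h' : ∀ τ, Good E τ → R τ → Runs E P' τ s₂ Q) :
    Runs E (.seq P P') σ s Q :=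
  (h.seq h').mono hs fun _ h => h

theorem Runs.cond_le {E s s' r r' : ℕ} {P P' : Program M} {σ : State M} {Q : State M → Prop}
    (hσ : Good E σ) (hs : s + 1 ≤ s') (h1 : σ.reg r < σ.reg r' → Runs E P σ s Q)
    (h2 : ¬ σ.reg r < σ.reg r' → Runs E P' σ s Q) : Runs E (.cond (.lt r r') P P') σ s' Q :=
  (Runs.cond hσ h1 h2).mono hs fun _ h => h

/-- Compute the bit (in register `21`) and the height (in register `23`) of the position in
register `17` of the vector gadget of the assignment in register `16`. -/
def gadgetProg : Program M :=
  .seq (.basic (.const 21 0))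
    (.cond (.lt 4 17)
      (.seq (.basic (.op .mod 24 17 3))
        (.cond (.lt 4 24)
          (.seq (block (.op .div 18 17 3) [.const 23 0, .const 21 1]) failLoop)
          (.basic (.const 23 180))))
      (.basic (.const 23 360)))

theorem gadgetProg_writes : (gadgetProg : Program M).Writes gadgetRegs := by
  have := failLoop_writes (M := M)
  simp [gadgetProg, block, Program.Writes, this]
  simp [gadgetRegs]

theorem runs_gadgetProg [SmallScalars M] {E N K lo hi c r : ℕ} (F : CNF N K) {σ : State M}
    (hσ : Good E σ) (hF : HoldsCNF F σ) (hE : K * N + N < 2 ^ E) (hE' : 2000 < 2 ^ E)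
    (h0 : σ.reg 0 = N) (h2 : σ.reg 2 = 1) (h3 : σ.reg 3 = 2) (h4 : σ.reg 4 = 0)
    (h16 : σ.reg 16 = c) (h17 : σ.reg 17 = r) (hr : r ≤ 2 * K)
    (h19 : σ.reg 19 = lo) (h20 : σ.reg 20 = hi) (hhi : hi ≤ N) :
    Runs E gadgetProg σ (13 * N + 10) fun τ =>
      τ.reg 21 = gadgetBit (failBit F lo hi c) r ∧ τ.reg 23 = gadgetY r := by
  have hE1 : E ≠ 0 := by rintro rfl; norm_num at hE'
  refine Runs.seq_basic (s := 13 * N + 9) hσ le_rfl (by simp [Instr.Safe]) fun hσ1 => ?_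
  refine Runs.cond_le (s := 13 * N + 8) hσ1 le_rfl (fun h => ?_) fun h => ?_
  · simp [Instr.run, h4, h17] at h
    refine Runs.seq_basic (s := 13 * N + 7) hσ1 le_rfl (by simp [Instr.Safe]) fun hσ2 => ?_
    refine Runs.cond_le (s := 13 * N + 6) hσ2 le_rfl (fun h' => ?_) fun h' => ?_
    · simp [Instr.run, NatOp.eval, h4, h17, h3] at h'
      refine Runs.seq_block (s := 13 * N + 1) hσ2 (by simp) (by simp [SafeBlock, Instr.Safe, hE1])
        fun τ' hτ' e => ?_
      refine (runs_failLoop (lo := lo) (hi := hi) (c := c) (j := r / 2) F hτ' ⟨?_, ?_⟩ hE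
        ?_ ?_ ?_ ?_ ?_ (by omega) ?_ ?_ hhi ?_).mono le_rfl ?_
      · simp [e, runBlock, Instr.run, hF.1]
      · simp [e, runBlock, Instr.run, hF.2]
      · simp [e, runBlock, Instr.run, h0]
      · simp [e, runBlock, Instr.run, h2]
      · simp [e, runBlock, Instr.run, h3]
      · simp [e, runBlock, Instr.run, h16]
      · simp [e, runBlock, Instr.run, NatOp.eval, h17, h3]
      · simp [e, runBlock, Instr.run, h19]
      · simp [e, runBlock, Instr.run, h20]
      · simp [e, runBlock, Instr.run]
      · rintro τ ⟨q1, -, -, q2, -⟩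
        have hr1 : r % 2 = 1 := by omega
        refine ⟨by rw [q1, gadgetBit, if_pos hr1], ?_⟩
        rw [q2, gadgetY, if_neg (by omega), if_pos hr1]
        simp [e, runBlock, Instr.run]
    · simp [Instr.run, NatOp.eval, h4, h17, h3] at h'
      refine Runs.basic_le hσ2 (by omega) (by simp [Instr.Safe]; omega) ?_
      simp [Instr.run, gadgetBit, gadgetY, h', show r ≠ 0 by omega]
  · simp [Instr.run, h4, h17] at h
    refine Runs.basic_le hσ1 (by omega) (by simp [Instr.Safe]; omega) ?_
    simp [Instr.run, gadgetBit, gadgetY, h]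

/-- Parameters of the reduction in the registers up to `14`. -/
structure Params (N K s A B n m : ℕ) (σ : State M) : Prop where
  h0 : σ.reg 0 = N
  h1 : σ.reg 1 = K
  h2 : σ.reg 2 = 1
  h3 : σ.reg 3 = 2
  h4 : σ.reg 4 = 0
  h5 : σ.reg 5 = s
  h6 : σ.reg 6 = A
  h7 : σ.reg 7 = B
  h8 : σ.reg 8 = n
  h9 : σ.reg 9 = m
  h10 : σ.reg 10 = min s N
  h11 : σ.reg 11 = 2 * K + 4
  h12 : σ.reg 12 = 2 * K + 1
  h13 : σ.reg 13 = 2 * K + 3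
  h14 : σ.reg 14 = B * (2 * K + 1)

theorem Params.congr {N K s A B n m : ℕ} {σ τ : State M} (h : Params N K s A B n m σ)
    (hr : ∀ r < 15, τ.reg r = σ.reg r) : Params N K s A B n m τ := by
  constructor <;> rw [hr _ (by omega)]
  exacts [h.h0, h.h1, h.h2, h.h3, h.h4, h.h5, h.h6, h.h7, h.h8, h.h9, h.h10, h.h11, h.h12, h.h13,
    h.h14]

/-- Compute the vertex of the first curve with index in register `15`. -/
def leftProg : Program M :=
  .seq (block (.op .div 16 15 11) [.op .mod 17 15 11, .const 22 10, .const 23 180])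
    (.cond (.lt 16 6)
      (.cond (.lt 4 17)
        (.cond (.lt 17 3)
          (block (.const 22 85) [.const 23 360])
          (.cond (.lt 17 13)
            -- Register `4` holds 0 throughout, so adding it copies a register.
            (.seq (block (.op .sub 17 17 3) [.const 19 0, .op .add 20 10 4])
              (.seq gadgetProg
                (block (.op .add 21 21 21) [.const 22 11, .op .sub 22 22 21])))
            (block (.const 22 85) [.const 23 0])))
        -- Nothing is to be done: the rest point was set as the default. Writing a scratch register
        -- serves as an empty instruction.
        (.basic (.const 29 0)))
      (.basic (.const 29 0)))

theorem leftProg_writes : (leftProg : Program M).Writes gadgetRegs := by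
  have := gadgetProg_writes (M := M)
  simp [leftProg, block, Program.Writes, this]
  simp [gadgetRegs]

theorem runs_leftProg [SmallScalars M] {E N K s A B n m v : ℕ} (F : CNF N K) {σ : State M}
    (hσ : Good E σ) (hF : HoldsCNF F σ) (hE : K * N + N < 2 ^ E) (hE' : 2000 < 2 ^ E)
    (hp : Params N K s A B n m σ) (h15 : σ.reg 15 = v) :
    Runs E leftProg σ (13 * N + 30) fun τ =>
      τ.reg 22 = leftX K A (failBit F 0 (min s N)) v ∧ τ.reg 23 = leftY K A v := by
  obtain ⟨h0, h1, h2, h3, h4, h5, h6, h7, h8, h9, h10, h11, h12, h13, h14⟩ := hp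
  have hN : min s N < 2 ^ E := h10 ▸ hσ.reg 10
  refine Runs.seq_block (s := 13 * N + 26) hσ (by simp)
    (by simp [SafeBlock, Instr.Safe]; omega) fun σ1 hσ1 e1 => ?_
  have k16 : σ1.reg 16 = v / (2 * K + 4) := by
    simp [e1, runBlock, Instr.run, NatOp.eval, h15, h11]
  have k17 : σ1.reg 17 = v % (2 * K + 4) := by
    simp [e1, runBlock, Instr.run, NatOp.eval, h15, h11]
  have k22 : σ1.reg 22 = 10 := by simp [e1, runBlock, Instr.run]
  have k23 : σ1.reg 23 = 180 := by simp [e1, runBlock, Instr.run]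
  have kr : ∀ r < 15, σ1.reg r = σ.reg r := fun r hr => by
    simp only [e1, runBlock, List.foldl, Instr.run, Function.update_apply]
    rw [if_neg (by omega), if_neg (by omega), if_neg (by omega), if_neg (by omega)]
  have ka : σ1.arr = σ.arr := by rw [e1]; rfl
  clear e1
  refine Runs.cond_le (s := 13 * N + 25) hσ1 le_rfl (fun c1 => ?_) fun c1 => ?_
  · rw [k16, kr 6 (by omega), h6] at c1
    refine Runs.cond_le (s := 13 * N + 24) hσ1 le_rfl (fun c2 => ?_) fun c2 => ?_
    · rw [k17, kr 4 (by omega), h4] at c2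
      refine Runs.cond_le (s := 13 * N + 23) hσ1 le_rfl (fun c3 => ?_) fun c3 => ?_
      · rw [k17, kr 3 (by omega), h3] at c3
        refine Runs.block_le hσ1 (by simp) ?_ ?_
        · simp [SafeBlock, Instr.Safe]; omega
        · have e : v % (2 * K + 4) = 1 := by omega
          simp [runBlock, Instr.run, leftX, leftY, c1, e]
      · rw [k17, kr 3 (by omega), h3] at c3
        refine Runs.cond_le (s := 13 * N + 22) hσ1 le_rfl (fun c4 => ?_) fun c4 => ?_
        · rw [k17, kr 13 (by omega), h13] at c4
          refine Runs.seq_block (s := 13 * N + 13) hσ1 (by simp) ?_ fun σ2 hσ2 e2 => ?_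
          · simp [SafeBlock, Instr.Safe, Instr.run, kr, h10, h4]
            simpa using hN
          · refine Runs.seq_le (runs_gadgetProg (lo := 0) (hi := min s N) (c := v / (2 * K + 4))
              (r := v % (2 * K + 4) - 2) F hσ2 ⟨?_, ?_⟩ hE hE' ?_ ?_ ?_ ?_ ?_ ?_ (by omega) ?_ ?_
              (min_le_right _ _)) (s₂ := 3) le_rfl ?_
            · simp [e2, runBlock, Instr.run, ka, hF.1]
            · simp [e2, runBlock, Instr.run, ka, hF.2]
            · simp [e2, runBlock, Instr.run, kr, h0]
            · simp [e2, runBlock, Instr.run, kr, h2]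
            · simp [e2, runBlock, Instr.run, kr, h3]
            · simp [e2, runBlock, Instr.run, kr, h4]
            · simp [e2, runBlock, Instr.run, k16]
            · simp [e2, runBlock, Instr.run, NatOp.eval, kr, k17, h3]
            · simp [e2, runBlock, Instr.run]
            · simp [e2, runBlock, Instr.run, NatOp.eval, kr, h10, h4]
            · rintro τ hτ ⟨q1, q2⟩
              have hb := gadgetBit_le (failBit_le F 0 (min s N) (v / (2 * K + 4)))
                (v % (2 * K + 4) - 2)
              refine Runs.block_le hτ (by simp) ?_ ?_
              · simp [SafeBlock, Instr.Safe, q1]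
                omega
              · simp [runBlock, Instr.run, NatOp.eval, leftX, leftY, c1, q1,
                  q2, c2.ne', show v % (2 * K + 4) ≠ 1 by omega,
                  show v % (2 * K + 4) ≠ 2 * K + 3 by omega]
                omega
        · rw [k17, kr 13 (by omega), h13] at c4
          refine Runs.block_le hσ1 (by simp) ?_ ?_
          · simp [SafeBlock, Instr.Safe]; omega
          · have e : v % (2 * K + 4) = 2 * K + 3 := by
              have := Nat.mod_lt v (show 2 * K + 4 > 0 by omega)
              omega
            simp [runBlock, Instr.run, leftX, leftY, c1, e]
    · rw [k17, kr 4 (by omega), h4] at c2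
      refine Runs.basic_le hσ1 (by omega) (by simp [Instr.Safe]) ?_
      have e : v % (2 * K + 4) = 0 := by omega
      simp [Instr.run, leftX, leftY, c1, e, k22, k23]
  · rw [k16, kr 6 (by omega), h6] at c1
    refine Runs.basic_le hσ1 (by omega) (by simp [Instr.Safe]) ?_
    simp [Instr.run, leftX, leftY, c1, k22, k23]

/-- Compute the vertex of the second curve with index in register `15`. -/
def rightProg : Program M :=
  .cond (.lt 15 2) (block (.const 22 910) [.const 23 180])
    (.cond (.lt 15 3) (block (.const 22 1085) [.const 23 360])
      (.seq (.basic (.op .sub 24 15 3))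
        (.cond (.lt 24 14)
          (.seq (block (.op .div 16 24 12) [.op .mod 17 24 12, .op .add 19 5 4, .op .add 20 0 4])
            (.seq gadgetProg
              (block (.op .add 21 21 21) [.const 22 1009, .op .add 22 22 21])))
          (.cond (.lt 14 24) (block (.const 22 910) [.const 23 180])
            (block (.const 22 1085) [.const 23 0])))))

theorem rightProg_writes : (rightProg : Program M).Writes gadgetRegs := by
  have := gadgetProg_writes (M := M)
  simp [rightProg, block, Program.Writes, this]
  simp [gadgetRegs]

theorem runs_rightProg [SmallScalars M] {E N K s A B n m v : ℕ} (F : CNF N K) {σ : State M}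
    (hσ : Good E σ) (hF : HoldsCNF F σ) (hE : K * N + N < 2 ^ E) (hE' : 2000 < 2 ^ E)
    (hp : Params N K s A B n m σ) (h15 : σ.reg 15 = v) :
    Runs E rightProg σ (13 * N + 30) fun τ =>
      τ.reg 22 = rightX K B (failBit F s N) v ∧ τ.reg 23 = rightY K B v := by
  obtain ⟨h0, h1, h2, h3, h4, h5, h6, h7, h8, h9, h10, h11, h12, h13, h14⟩ := hp
  have hN : N < 2 ^ E := h0 ▸ hσ.reg 0
  have hs : s < 2 ^ E := h5 ▸ hσ.reg 5
  refine Runs.cond_le (s := 13 * N + 29) hσ le_rfl (fun c1 => ?_) fun c1 => ?_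
  · rw [h15, h2] at c1
    refine Runs.block_le hσ (by simp) ?_ ?_
    · simp [SafeBlock, Instr.Safe]; omega
    · have e : v = 0 := by omega
      simp [runBlock, Instr.run, rightX, rightY, e]
  rw [h15, h2] at c1
  refine Runs.cond_le (s := 13 * N + 28) hσ le_rfl (fun c2 => ?_) fun c2 => ?_
  · rw [h15, h3] at c2
    refine Runs.block_le hσ (by simp) ?_ ?_
    · simp [SafeBlock, Instr.Safe]; omega
    · have e : v = 1 := by omega
      simp [runBlock, Instr.run, rightX, rightY, e]
  rw [h15, h3] at c2
  refine Runs.seq_basic (s := 13 * N + 27) hσ le_rfl (by simp [Instr.Safe]) fun hσ1 => ?_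
  obtain ⟨σ1, e1⟩ : ∃ σ1, σ1 = (Instr.op .sub 24 15 3 : Instr M).run σ := ⟨_, rfl⟩
  rw [← e1] at hσ1 ⊢
  have k24 : σ1.reg 24 = v - 2 := by
    simp [e1, Instr.run, NatOp.eval, h15, h3]
  have kr : ∀ r < 15, σ1.reg r = σ.reg r := fun r hr => by
    simp only [e1, Instr.run, Function.update_apply]
    rw [if_neg (by omega)]
  have ka : σ1.arr = σ.arr := by rw [e1]; rfl
  clear e1
  refine Runs.cond_le (s := 13 * N + 26) hσ1 le_rfl (fun c3 => ?_) fun c3 => ?_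
  · rw [k24, kr 14 (by omega), h14] at c3
    refine Runs.seq_block (s := 13 * N + 13) hσ1 (by simp) ?_ fun σ2 hσ2 e2 => ?_
    · simp [SafeBlock, Instr.Safe, Instr.run, kr, h5, h4, h0, hs, hN]
    · have hmod := Nat.mod_lt (v - 2) (show 2 * K + 1 > 0 by omega)
      refine Runs.seq_le (runs_gadgetProg (lo := s) (hi := N) (c := (v - 2) / (2 * K + 1))
        (r := (v - 2) % (2 * K + 1)) F hσ2 ⟨?_, ?_⟩ hE hE' ?_ ?_ ?_ ?_ ?_ ?_ (by omega) ?_ ?_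
        le_rfl) (s₂ := 3) le_rfl ?_
      · simp [e2, runBlock, Instr.run, ka, hF.1]
      · simp [e2, runBlock, Instr.run, ka, hF.2]
      · simp [e2, runBlock, Instr.run, kr, h0]
      · simp [e2, runBlock, Instr.run, kr, h2]
      · simp [e2, runBlock, Instr.run, kr, h3]
      · simp [e2, runBlock, Instr.run, kr, h4]
      · simp [e2, runBlock, Instr.run, NatOp.eval, kr, k24, h12]
      · simp [e2, runBlock, Instr.run, NatOp.eval, kr, k24, h12]
      · simp [e2, runBlock, Instr.run, NatOp.eval, kr, h5, h4]
      · simp [e2, runBlock, Instr.run, NatOp.eval, kr, h0, h4]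
      · rintro τ hτ ⟨q1, q2⟩
        have hb := gadgetBit_le (failBit_le F s N ((v - 2) / (2 * K + 1))) ((v - 2) % (2 * K + 1))
        refine Runs.block_le hτ (by simp) ?_ ?_
        · simp [SafeBlock, Instr.Safe, Instr.run, NatOp.eval, q1]
          omega
        · simp [runBlock, Instr.run, NatOp.eval, rightX, rightY, c3, q1,
            q2, show v ≠ 0 by omega, show v ≠ 1 by omega]
          omega
  rw [k24, kr 14 (by omega), h14] at c3
  refine Runs.cond_le (s := 13 * N + 25) hσ1 le_rfl (fun c4 => ?_) fun c4 => ?_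
  · rw [k24, kr 14 (by omega), h14] at c4
    refine Runs.block_le hσ1 (by simp) ?_ ?_
    · simp [SafeBlock, Instr.Safe]; omega
    · simp [runBlock, Instr.run, rightX, rightY, c3, c4.ne',
        show v ≠ 0 by omega, show v ≠ 1 by omega]
  · rw [k24, kr 14 (by omega), h14] at c4
    refine Runs.block_le hσ1 (by simp) ?_ ?_
    · simp [SafeBlock, Instr.Safe]; omega
    · have e : v - 2 = B * (2 * K + 1) := by omega
      simp [runBlock, Instr.run, rightX, rightY, e,
        show v ≠ 0 by omega, show v ≠ 1 by omega]

end Frechet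
end

noncomputable section
namespace Frechet
open Set

variable {M : Model}

/-! Writing the curves into memory -/

/-- Store the points computed by `prog` for the indices below the number in register `cnt` in
the scalar array `A`. -/
def fillProg (prog : Program M) (d cnt A : ℕ) : Program M :=
  .seq (.basic (.const 15 0)) (.loop (.lt 15 cnt) (.seq prog
    (block (.const 24 d) [.op .mul 24 24 15, .ofNat 0 22, .sstore A 24 0, .ofNat 0 23,
      .op .add 24 24 2, .sstore A 24 0, .op .add 15 15 2])))

/-- The memories differ only in scratch registers and the scalar array `A`. -/
structure FillFrame (A : ℕ) (σ τ : State M) : Prop where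
  reg : ∀ r, r < 15 ∨ 30 ≤ r → τ.reg r = σ.reg r
  arr : τ.arr = σ.arr
  sreg : ∀ x, x ≠ 0 → τ.sreg x = σ.sreg x
  sarr : ∀ B, B ≠ A → τ.sarr B = σ.sarr B

/-- The array with the coordinates of the first `v` points. -/
def coordsUpTo (M : Model) (d : ℕ) (X Y : ℕ → ℕ) (v k : ℕ) : M.S :=
  if k < d * v then
    if k % d = 0 then (X (k / d) : M.S) else if k % d = 1 then (Y (k / d) : M.S) else 0
  else 0

theorem flatten_planeCoords {n d : ℕ} (X Y : ℕ → ℕ) :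
    flatten (planeCoords M n d X Y) = coordsUpTo M d X Y n := by
  funext k
  unfold flatten coordsUpTo
  rw [mul_comm d n]
  by_cases h : k < n * d
  · rw [dif_pos h, if_pos h]
    simp [planeCoords, Fin.divNat, Fin.modNat]
  · rw [dif_neg h, if_neg h]

/-- Only two cells change per point, because the remaining `d - 2` coordinates are already 0. -/
theorem coordsUpTo_succ {d : ℕ} (hd : 2 ≤ d) (X Y : ℕ → ℕ) (v : ℕ) :
    coordsUpTo M d X Y (v + 1) = Function.update (Function.update (coordsUpTo M d X Y v) (d * v)
      (X v : M.S)) (d * v + 1) (Y v : M.S) := by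
  funext k
  simp only [Function.update_apply]
  have key : ∀ r < d, (d * v + r) / d = v ∧ (d * v + r) % d = r := fun r hr => by
    rw [mul_comm]; exact ⟨block_div hr, block_mod hr⟩
  have hmul : d * (v + 1) = d * v + d := by ring
  rcases Nat.lt_or_ge k (d * v) with h | h
  · rw [if_neg (by omega), if_neg (by omega)]
    simp only [coordsUpTo, if_pos h, if_pos (show k < d * (v + 1) by omega)]
  · obtain ⟨r, rfl⟩ := Nat.exists_eq_add_of_le h
    unfold coordsUpTo
    rw [hmul, if_neg (show ¬ d * v + r < d * v by omega)]
    rcases Nat.lt_or_ge r d with hr | hr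
    · rw [if_pos (by omega), (key r hr).1, (key r hr).2]
      rcases Nat.lt_trichotomy r 1 with h1 | h1 | h1
      · obtain rfl : r = 0 := by omega
        simp
      · subst h1; simp
      · rw [if_neg (by omega), if_neg (by omega), if_neg (by omega), if_neg (by omega)]
    · rw [if_neg (by omega), if_neg (by omega), if_neg (by omega)]

theorem runs_fillProg [SmallScalars M] {E d cnt A n s : ℕ} {prog : Program M} {X Y : ℕ → ℕ}
    {σ : State M} (hd : 2 ≤ d) (hcnt : cnt < 15) (hσ : Good E σ) (hn : σ.reg cnt = n)
    (h2 : σ.reg 2 = 1)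
    (hE : d * n < 2 ^ E) (hE0 : d < 2 ^ E) (hX : ∀ v, X v ≤ 1085) (hY : ∀ v, Y v ≤ 1085)
    (hw : prog.Writes gadgetRegs)
    (hprog : ∀ v τ, v < n → Good E τ → (∀ r < 15, τ.reg r = σ.reg r) → τ.arr = σ.arr →
      τ.reg 15 = v → Runs E prog τ s fun τ' => τ'.reg 22 = X v ∧ τ'.reg 23 = Y v)
    (hA : σ.sarr A = fun _ => 0) :
    Runs E (fillProg prog d cnt A) σ (n * (s + 9) + 2) fun τ =>
      FillFrame A σ τ ∧ τ.sarr A = flatten (planeCoords M n d X Y) := by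
  let I : ℕ → State M → Prop := fun v τ => FillFrame A σ τ ∧ τ.reg 15 = v ∧
    τ.sarr A = coordsUpTo M d X Y v
  refine Runs.seq_basic (s := n * ((s + 8) + 1) + 1) hσ le_rfl (by simp [Instr.Safe])
    fun hσ1 => ?_
  refine (Runs.loop I ?_ ?_ hσ1 ?_).mono le_rfl ?_
  · rintro v τ ⟨hf, e15, -⟩
    rw [e15, hf.reg cnt (.inl hcnt), hn]
  · rintro v τ hv hτ ⟨hf, e15, eA⟩
    refine Runs.seq_le ((hprog v τ hv hτ (fun r hr => hf.reg r (.inl hr)) hf.arr e15).frame hw)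
      (s₂ := 8) le_rfl ?_
    rintro τ' hτ' ⟨⟨e22, e23⟩, hfr⟩
    have e15' : τ'.reg 15 = v := by rw [hfr.reg 15 (by simp [gadgetRegs]), e15]
    have e2' : τ'.reg 2 = 1 := by
      rw [hfr.reg 2 (by simp [gadgetRegs]), hf.reg 2 (.inl (by omega)), h2]
    have hdv : d * v + 2 ≤ d * n := by
      have : d * (v + 1) ≤ d * n := Nat.mul_le_mul_left d hv
      rw [Nat.mul_succ] at this
      omega
    have hv' : v + 2 ≤ d * v + 2 := by nlinarith
    refine Runs.block_le hτ' (by simp) ?_ ?_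
    · simp [SafeBlock, Instr.Safe, Instr.run, NatOp.eval, e22, e23, e15', e2', hX, hY, hE0]
      omega
    · refine ⟨⟨fun r hr => ?_, ?_, fun x hx => ?_, fun B hB => ?_⟩, ?_, ?_⟩
      · simp only [runBlock, List.foldl, Instr.run, Function.update_apply]
        rw [if_neg (by omega), if_neg (by omega), if_neg (by omega), if_neg (by omega),
          hfr.reg r (by simp only [gadgetRegs]; omega), hf.reg r hr]
      · exact hfr.arr.trans hf.arr
      · simp [runBlock, Instr.run, hx, hfr.sreg, hf.sreg]
      · simp [runBlock, Instr.run, hB, hfr.sarr, hf.sarr]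
      · simp [runBlock, Instr.run, NatOp.eval, e15', e2']
      · simp [runBlock, Instr.run, NatOp.eval, e15', e2', e22, e23, hfr.sarr, eA,
          coordsUpTo_succ hd]
  · refine ⟨⟨fun r hr => ?_, rfl, fun _ _ => rfl, fun _ _ => rfl⟩, ?_, ?_⟩
    · simp only [Instr.run, Function.update_apply]
      rw [if_neg (by omega)]
    · simp [Instr.run]
    · simp only [Instr.run, hA]
      funext k
      simp [coordsUpTo]
  · rintro τ ⟨hf, -, eA⟩
    exact ⟨hf, by rw [eA, flatten_planeCoords]⟩

/-! Powers -/

/-- Raise the number in register `b` to the power in register `e`. -/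
def powProg (dst b e ctr : ℕ) : Program M :=
  .seq (block (.const dst 1) [.const ctr 0])
    (.loop (.lt ctr e) (block (.op .mul dst dst b) [.op .add ctr ctr 2]))

theorem runs_powProg [SmallScalars M] {E dst b e ctr x y : ℕ} {σ : State M} (hσ : Good E σ)
    (hdb : b ≠ dst) (hde : e ≠ dst) (hdc : ctr ≠ dst) (hd2 : 2 ≠ dst) (hcb : b ≠ ctr)
    (hce : e ≠ ctr) (hc2 : 2 ≠ ctr) (h2 : σ.reg 2 = 1) (hb : σ.reg b = x) (he : σ.reg e = y)
    (hx : 0 < x) (hE : x ^ y < 2 ^ E) :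
    Runs E (powProg dst b e ctr) σ (3 * y + 3) fun τ =>
      τ.reg dst = x ^ y ∧ Frame (fun r => r = dst ∨ r = ctr) σ τ := by
  have hE0 : E ≠ 0 := by
    rintro rfl
    have := Nat.pow_pos (n := y) hx
    omega
  let I : ℕ → State M → Prop := fun k τ => τ.reg dst = x ^ k ∧ τ.reg ctr = k ∧
    Frame (fun r => r = dst ∨ r = ctr) σ τ
  refine Runs.seq_block (s := y * (2 + 1) + 1) hσ (by simp; omega)
    (by simp [SafeBlock, Instr.Safe, hE0]) fun σ1 hσ1 e1 => ?_
  refine (Runs.loop I ?_ ?_ hσ1 ?_).mono le_rfl ?_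
  · rintro k τ ⟨-, ec, hf⟩
    rw [ec, hf.reg e (by simp [hde, hce]), he]
  · rintro k τ hk hτ ⟨ed, ec, hf⟩
    have eb : τ.reg b = x := by rw [hf.reg b (by simp [hdb, hcb]), hb]
    have e2 : τ.reg 2 = 1 := by rw [hf.reg 2 (by simp [hd2, hc2]), h2]
    have ey : y < 2 ^ E := he ▸ hσ.reg e
    have hpow : x ^ k * x < 2 ^ E := by
      rw [← pow_succ]
      exact (Nat.pow_le_pow_right hx hk).trans_lt hE
    have hbody := Runs.block_le (E := E) (s := 2) (i := .op .mul dst dst b)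
      (l := [.op .add ctr ctr 2]) (σ := τ) hτ (by simp)
      (Q := fun τ' => τ'.reg dst = x ^ (k + 1) ∧ τ'.reg ctr = k + 1) ?_ ?_
    · refine (hbody.frame (S := fun r => r = dst ∨ r = ctr) ?_).mono le_rfl ?_
      · simp [block, Program.Writes]
      · rintro τ' ⟨⟨q1, q2⟩, hf'⟩
        exact ⟨q1, q2, hf.trans hf'⟩
    · simp [SafeBlock, Instr.Safe, Instr.run, NatOp.eval, ed, eb, hpow, hdc, hd2, ec, e2]
      omega
    · simp [runBlock, Instr.run, NatOp.eval, ed, eb, hdc, hdc.symm, hd2, ec, e2, pow_succ]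
  · refine ⟨by simp [e1, runBlock, Instr.run, hdc.symm], by simp [e1, runBlock, Instr.run], ?_⟩
    refine ⟨fun r hr => ?_, by rw [e1]; rfl, by rw [e1]; rfl, by rw [e1]; rfl⟩
    simp only [not_or] at hr
    simp [e1, runBlock, Instr.run, hr.1, hr.2]
  · rintro τ ⟨h1, -, h3⟩
    exact ⟨h1, h3⟩

theorem powProg_writes {dst b e ctr : ℕ} {S : ℕ → Prop} (h1 : S dst) (h2 : S ctr) :
    (powProg dst b e ctr : Program M).Writes S := by
  simp [powProg, block, Program.Writes, h1, h2]

/-! Computing the parameters -/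

/-- The number of variables is rounded up to `(p + q) * blockSize`. -/
def blockSize (p q N : ℕ) : ℕ := N / (p + q) + 1

/-- The number of vertices of the curves is `curveSize p q N K p` and `curveSize p q N K q`. -/
def curveSize (p q N K e : ℕ) : ℕ := (2 ^ blockSize p q N * (2 * K + 5)) ^ e

/-- The numbers in the reduction have at most `E` bits. -/
structure Fits (E d p q N K : ℕ) : Prop where
  const : 2000 + d + p + q + 2 * K < 2 ^ E
  split : blockSize p q N * (p + q) < 2 ^ E
  clauses : K * N + N < 2 ^ E
  curve : d * curveSize p q N K q < 2 ^ E

def setupProg (p q : ℕ) : Program M :=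
  .seq (block (.const 2 1) [.const 3 2, .const 24 (p + q), .op .div 25 0 24, .op .add 25 25 2,
      .const 26 q, .op .mul 5 25 26, .op .add 11 1 1, .const 29 4, .op .add 11 11 29,
      -- The last two instructions compute `min s N` as `s - (s - N)` with truncated subtraction.
      .op .sub 13 11 2, .op .sub 12 13 3, .op .add 28 11 2, .op .sub 24 5 0, .op .sub 10 5 24])
    (.seq (powProg 27 3 25 29)
      (.seq (.basic (.op .mul 28 27 28))
        (.seq (powProg 6 27 26 29)
          (.seq (powProg 8 28 26 29)
            (.seq (.basic (.const 26 p))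
              (.seq (powProg 7 27 26 29)
                (.seq (powProg 9 28 26 29)
                  (.basic (.op .mul 14 7 12)))))))))

theorem setupProg_writes (p q : ℕ) :
    (setupProg p q : Program M).Writes fun r => 2 ≤ r ∧ r ≠ 4 ∧ r < 30 := by
  simp [setupProg, block, Program.Writes, powProg_writes]

theorem runs_setupProg [SmallScalars M] {E d p q N K : ℕ} {σ : State M} (hσ : Good E σ)
    (hp : 1 ≤ p) (hpq : p ≤ q) (hd : 2 ≤ d) (hE : Fits E d p q N K) (h0 : σ.reg 0 = N)
    (h1 : σ.reg 1 = K) (h4 : σ.reg 4 = 0) :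
    Runs E (setupProg p q) σ (3 * blockSize p q N + 6 * q + 6 * p + 60) fun τ =>
      Params N K (blockSize p q N * q) ((2 ^ blockSize p q N) ^ q) ((2 ^ blockSize p q N) ^ p)
        (curveSize p q N K q) (curveSize p q N K p) τ := by
  obtain ⟨hc, hs, hcl, hcu⟩ := hE
  set u := blockSize p q N with hu
  have hE0 : E ≠ 0 := by rintro rfl; simp at hc
  have hu0 : 1 ≤ u := Nat.succ_le_succ (Nat.zero_le _)
  have hU : 0 < 2 ^ u * (2 * K + 5) := by positivity
  have hn : curveSize p q N K q < 2 ^ E := lt_of_le_of_lt (Nat.le_mul_of_pos_left _ (by omega)) hcu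
  have hpw : ∀ e, 1 ≤ e → e ≤ q → curveSize p q N K e < 2 ^ E := fun e _ he =>
    (Nat.pow_le_pow_right hU he).trans_lt hn
  have hU' : 2 ^ u * (2 * K + 5) < 2 ^ E := by
    have := hpw 1 le_rfl (by omega)
    rwa [curveSize, pow_one] at this
  have hpw' : ∀ e, 1 ≤ e → e ≤ q → (2 ^ u) ^ e * (2 * K + 5) < 2 ^ E := fun e h he => by
    refine lt_of_le_of_lt ?_ (hpw e h he)
    rw [curveSize, mul_pow]
    exact Nat.mul_le_mul_left _ (Nat.le_self_pow (by omega) _)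
  have hpw'' : ∀ e, 1 ≤ e → e ≤ q → (2 ^ u) ^ e < 2 ^ E := fun e h he =>
    (Nat.le_mul_of_pos_right _ (by omega)).trans_lt (hpw' e h he)
  have h2u : 2 ^ u < 2 ^ E := (Nat.le_mul_of_pos_right _ (by omega)).trans_lt hU'
  have hN : N < 2 ^ E := h0 ▸ hσ.reg 0
  have huq : u * q < 2 ^ E := lt_of_le_of_lt (Nat.mul_le_mul_left _ (by omega)) hs
  have huE : u < 2 ^ E := lt_of_le_of_lt (Nat.le_mul_of_pos_right _ (by omega)) hs
  have hdef : N / (p + q) + 1 = u := rfl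
  refine Runs.seq_block (s := 3 * u + 6 * q + 6 * p + 30) hσ (by simp) ?_ fun σ1 hσ1 e1 => ?_
  · simp [SafeBlock, Instr.Safe, Instr.run, NatOp.eval, h0, h1, hdef, huq, huE, hE0]
    omega
  have a0 : σ1.reg 0 = N := by simp [e1, runBlock, Instr.run, h0]
  have a1 : σ1.reg 1 = K := by simp [e1, runBlock, Instr.run, h1]
  have a2 : σ1.reg 2 = 1 := by simp [e1, runBlock, Instr.run]
  have a3 : σ1.reg 3 = 2 := by simp [e1, runBlock, Instr.run]
  have a4 : σ1.reg 4 = 0 := by simp [e1, runBlock, Instr.run, h4]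
  have a5 : σ1.reg 5 = u * q := by simp [e1, runBlock, Instr.run, NatOp.eval, h0, hdef]
  have a10 : σ1.reg 10 = min (u * q) N := by
    simp [e1, runBlock, Instr.run, NatOp.eval, h0, hdef]
    omega
  have a11 : σ1.reg 11 = 2 * K + 4 := by simp [e1, runBlock, Instr.run, NatOp.eval, h1]; omega
  have a12 : σ1.reg 12 = 2 * K + 1 := by simp [e1, runBlock, Instr.run, NatOp.eval, h1]; omega
  have a13 : σ1.reg 13 = 2 * K + 3 := by simp [e1, runBlock, Instr.run, NatOp.eval, h1]; omega
  have a25 : σ1.reg 25 = u := by simp [e1, runBlock, Instr.run, NatOp.eval, h0, hdef]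
  have a26 : σ1.reg 26 = q := by simp [e1, runBlock, Instr.run]
  have a28 : σ1.reg 28 = 2 * K + 5 := by simp [e1, runBlock, Instr.run, NatOp.eval, h1]; omega
  clear e1
  refine Runs.seq_le (runs_powProg hσ1 (by norm_num) (by norm_num) (by norm_num) (by norm_num)
    (by norm_num) (by norm_num) (by norm_num) a2 a3 a25 (by norm_num) h2u)
    (s₂ := 6 * q + 6 * p + 27) (by omega) ?_
  rintro σ2 hσ2 ⟨b27, hf2⟩
  have b := fun r (h : r ≠ 27) (h' : r ≠ 29) => hf2.reg r (by simp [h, h'])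
  refine Runs.seq_basic (s := 6 * q + 6 * p + 26) hσ2 le_rfl ?_ fun hσ3 => ?_
  · simp [Instr.Safe, b27, b, a28, hU']
  obtain ⟨σ3, e3⟩ : ∃ σ3, σ3 = (Instr.op .mul 28 27 28 : Instr M).run σ2 := ⟨_, rfl⟩
  rw [← e3] at hσ3 ⊢
  have c := fun r (h : r ≠ 27) (h' : r ≠ 29) (h'' : r ≠ 28) => show σ3.reg r = σ1.reg r by
    simp [e3, Instr.run, h'', b r h h']
  have c27 : σ3.reg 27 = 2 ^ u := by simp [e3, Instr.run, b27]
  have c28 : σ3.reg 28 = 2 ^ u * (2 * K + 5) := by simp [e3, Instr.run, NatOp.eval, b27, b, a28]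
  clear e3
  refine Runs.seq_le (runs_powProg (x := 2 ^ u) (y := q) hσ3 (by norm_num) (by norm_num)
    (by norm_num) (by norm_num) (by norm_num) (by norm_num) (by norm_num) (by simp [c, a2]) c27
    (by simp [c, a26]) (by positivity) (hpw'' q (by omega) le_rfl))
    (s₂ := 3 * q + 6 * p + 23) (by omega) ?_
  rintro σ4 hσ4 ⟨d6, hf4⟩
  have d := fun r (h : r ≠ 6) (h' : r ≠ 29) => hf4.reg r (by simp [h, h'])
  refine Runs.seq_le (runs_powProg (x := 2 ^ u * (2 * K + 5)) (y := q) hσ4 (by norm_num)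
    (by norm_num) (by norm_num) (by norm_num) (by norm_num) (by norm_num) (by norm_num)
    (by simp [d, c, a2]) (by simp [d, c28])
    (by simp [d, c, a26]) (by positivity) hn)
    (s₂ := 6 * p + 20) (by omega) ?_
  rintro σ5 hσ5 ⟨f8, hf5⟩
  have f := fun r (h : r ≠ 8) (h' : r ≠ 29) => hf5.reg r (by simp [h, h'])
  refine Runs.seq_basic (s := 6 * p + 19) hσ5 le_rfl (by simp [Instr.Safe]; omega) fun hσ6 => ?_
  obtain ⟨σ6, e6⟩ : ∃ σ6, σ6 = (Instr.const 26 p : Instr M).run σ5 := ⟨_, rfl⟩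
  rw [← e6] at hσ6 ⊢
  have g := fun r (h : r ≠ 26) => show σ6.reg r = σ5.reg r by simp [e6, Instr.run, h]
  have g26 : σ6.reg 26 = p := by simp [e6, Instr.run]
  clear e6
  refine Runs.seq_le (runs_powProg (x := 2 ^ u) (y := p) hσ6 (by norm_num) (by norm_num)
    (by norm_num) (by norm_num) (by norm_num) (by norm_num) (by norm_num) (by simp [g, f, d, c, a2])
    (by simp [g, f, d, c27]) g26 (by positivity) (hpw'' p hp hpq))
    (s₂ := 3 * p + 16) (by omega) ?_
  rintro σ7 hσ7 ⟨k7, hf7⟩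
  have k := fun r (h : r ≠ 7) (h' : r ≠ 29) => hf7.reg r (by simp [h, h'])
  refine Runs.seq_le (runs_powProg (x := 2 ^ u * (2 * K + 5)) (y := p) hσ7 (by norm_num)
    (by norm_num) (by norm_num) (by norm_num) (by norm_num) (by norm_num) (by norm_num)
    (by simp [k, g, f, d, c, a2]) (by simp [k, g, f, d, c28])
    (by simp [k, g26]) (by positivity) (hpw p hp hpq))
    (s₂ := 13) (by omega) ?_
  rintro σ8 hσ8 ⟨l9, hf8⟩
  have l := fun r (h : r ≠ 9) (h' : r ≠ 29) => hf8.reg r (by simp [h, h'])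
  refine Runs.basic_le hσ8 (by norm_num) ?_ ?_
  · simp [Instr.Safe, l, k7, k, g, f, d, c, a12]
    exact lt_of_le_of_lt (Nat.mul_le_mul_left _ (by omega)) (hpw' p hp hpq)
  · constructor <;> simp [Instr.run, NatOp.eval, l9, l, k7, k, g, f8, f, d6, d, c, a0, a1, a2, a3,
      a4, a5, a10, a11, a12, a13, curveSize, ← hu]

/-! Clearing the memory -/

def clearProg : Program M :=
  .seq (block (.op .mul 24 1 0) [.const 15 0])
    (.loop (.lt 15 24) (block (.store 0 15 4) [.store 1 15 4, .op .add 15 15 2]))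

/-- Only the first `K * N` cells of the arrays `0` and `1` can be nonzero. -/
theorem runs_clearProg [SmallScalars M] {E N K : ℕ} (F : CNF N K) {σ : State M} (hσ : Good E σ)
    (hF : HoldsCNF F σ) (hA : ∀ A, 2 ≤ A → σ.arr A = fun _ => 0) (hE : K * N + N < 2 ^ E)
    (h0 : σ.reg 0 = N) (h1 : σ.reg 1 = K) (h2 : σ.reg 2 = 1) (h4 : σ.reg 4 = 0) :
    Runs E clearProg σ (4 * (K * N) + 3) fun τ => τ.arr = (fun _ _ => 0) ∧
      (∀ r, r < 15 ∨ 30 ≤ r → τ.reg r = σ.reg r) ∧ τ.sreg = σ.sreg ∧ τ.sarr = σ.sarr := by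
  let I : ℕ → State M → Prop := fun k τ => τ.reg 15 = k ∧ τ.reg 24 = K * N ∧
    (∀ r, r < 15 ∨ 30 ≤ r → τ.reg r = σ.reg r) ∧ (τ.sreg = σ.sreg ∧ τ.sarr = σ.sarr) ∧
    ∀ A i, τ.arr A i = if i < k then 0 else σ.arr A i
  refine Runs.seq_block (s := K * N * (3 + 1) + 1) hσ (by simp; omega)
    (by simp [SafeBlock, Instr.Safe, h0, h1]; omega) fun σ1 hσ1 e1 => ?_
  refine (Runs.loop I ?_ ?_ hσ1 ?_).mono le_rfl ?_
  · rintro k τ ⟨e15, e24, -⟩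
    rw [e15, e24]
  · rintro k τ hk hτ ⟨e15, e24, hr, hs, ha⟩
    have e4 : τ.reg 4 = 0 := by rw [hr 4 (.inl (by omega)), h4]
    have e2 : τ.reg 2 = 1 := by rw [hr 2 (.inl (by omega)), h2]
    refine Runs.block_le hτ (by simp) ?_ ?_
    · simp [SafeBlock, Instr.Safe, Instr.run, e15, e2]
      omega
    · refine ⟨by simp [runBlock, Instr.run, NatOp.eval, e15, e2],
        by simp [runBlock, Instr.run, e24], fun r hr' => ?_, hs, fun A i => ?_⟩
      · simp only [runBlock, List.foldl, Instr.run, Function.update_apply]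
        rw [if_neg (by omega), hr r hr']
      · simp only [runBlock, List.foldl, Instr.run, Function.update_apply, e15, e4]
        have hA' := fun h => congrFun (hA A h) i
        by_cases hA1 : A = 1
        · subst hA1
          by_cases hi : i = k
          · simp [hi]
          · simp only [if_true, Function.update_apply, if_neg hi, one_ne_zero, if_false, ha]
            by_cases hik : i < k
            · rw [if_pos hik, if_pos (by omega)]
            · rw [if_neg hik, if_neg (by omega)]
        · by_cases hA0 : A = 0
          · subst hA0
            by_cases hi : i = k
            · simp [hi]
            · simp only [if_true, Function.update_apply, if_neg hi, zero_ne_one, if_false, ha]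
              by_cases hik : i < k
              · rw [if_pos hik, if_pos (by omega)]
              · rw [if_neg hik, if_neg (by omega)]
          · rw [if_neg hA1, if_neg hA0, ha, hA' (by omega)]
            simp
  · refine ⟨by simp [e1, runBlock, Instr.run], by simp [e1, runBlock, Instr.run, NatOp.eval, h0, h1],
      fun r hr => ?_, ⟨by rw [e1]; rfl, by rw [e1]; rfl⟩, fun A i => by rw [e1]; rfl⟩
    simp only [e1, runBlock, List.foldl, Instr.run, Function.update_apply]
    rw [if_neg (by omega), if_neg (by omega)]
  · rintro τ ⟨-, -, hr, hs, ha⟩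
    refine ⟨?_, hr, hs⟩
    funext A i
    rw [ha]
    split_ifs with h
    · rfl
    · rcases Nat.lt_or_ge A 2 with hA2 | hA2
      · interval_cases A
        · rw [hF.arr_zero]; exact dif_neg h
        · rw [hF.arr_one]; exact dif_neg h
      · rw [hA A hA2]

theorem runBlock_const (l : List ℕ) (σ : State M) :
    runBlock σ (l.map fun r => .const r 0) =
      { σ with reg := fun r => if r ∈ l then 0 else σ.reg r } := by
  induction l generalizing σ with
  | nil => simp [runBlock]
  | cons s l ih =>
    have : runBlock σ ((s :: l).map fun r => .const r 0) =
      runBlock ((Instr.const s 0).run σ) (l.map fun r => .const r 0) := rfl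
    rw [this, ih]
    simp only [Instr.run, List.mem_cons, Function.update_apply]
    congr 1
    funext r
    by_cases h1 : r ∈ l <;> by_cases h2 : r = s <;> simp [h1, h2]

theorem safeBlock_const {E : ℕ} (l : List ℕ) (σ : State M) :
    SafeBlock E σ (l.map fun r => .const r 0) := by
  induction l generalizing σ with
  | nil => trivial
  | cons s l ih => exact ⟨by simp [Instr.Safe], ih _⟩

/-- Move the numbers of vertices to the registers `0` and `1` and clear all other registers. -/
def moveProg : Program M :=
  block (.op .add 0 8 4) (.op .add 1 9 4 :: .ofNat 0 4 ::
    ([2, 3, 5, 6, 7, 8, 9, 10, 11, 12, 13, 14, 15, 16, 17, 18, 19, 20, 21, 22, 23, 24, 25, 26, 27,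
      28, 29].map fun r => .const r 0))

theorem runs_moveProg [SmallScalars M] {E n m : ℕ} {σ : State M} (hσ : Good E σ)
    (h4 : σ.reg 4 = 0) (h8 : σ.reg 8 = n) (h9 : σ.reg 9 = m) (hr : ∀ r, 30 ≤ r → σ.reg r = 0)
    (hx : ∀ x, x ≠ 0 → σ.sreg x = 0) :
    Runs E moveProg σ 30 fun τ => τ.reg = (fun r => if r = 0 then n else if r = 1 then m else 0) ∧
      τ.sreg = (fun _ => 0) ∧ τ.arr = σ.arr ∧ τ.sarr = σ.sarr := by
  have hn : n < 2 ^ E := h8 ▸ hσ.reg 8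
  have hm : m < 2 ^ E := h9 ▸ hσ.reg 9
  refine Runs.block_le hσ (by simp) ?_ ?_
  · refine ⟨by simpa [Instr.Safe, h8, h4] using hn, by simpa [Instr.Safe, Instr.run, h9, h4] using hm,
      by simp [Instr.Safe, Instr.run, h4], safeBlock_const _ _⟩
  · rw [show ∀ (i j k : Instr M) (l : List (Instr M)), runBlock σ (i :: j :: k :: l) =
      runBlock (k.run (j.run (i.run σ))) l from fun _ _ _ _ => rfl, runBlock_const]
    refine ⟨?_, ?_, rfl, rfl⟩
    · funext r
      rcases Nat.lt_or_ge r 30 with h | h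
      · interval_cases r <;> simp [Instr.run, NatOp.eval, h4, h8, h9]
      · have : r ∉ [2, 3, 5, 6, 7, 8, 9, 10, 11, 12, 13, 14, 15, 16, 17, 18, 19, 20, 21, 22, 23, 24,
          25, 26, 27, 28, 29] := fun h' => by
          have : ∀ x ∈ [2, 3, 5, 6, 7, 8, 9, 10, 11, 12, 13, 14, 15, 16, 17, 18, 19, 20, 21, 22, 23,
            24, 25, 26, 27, 28, 29], x < 30 := by decide
          exact absurd (this r h') (by omega)
        simp only [this, if_false, Instr.run, Function.update_apply]
        rw [if_neg (by omega), if_neg (by omega), if_neg (by omega), if_neg (by omega), hr r h]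
    · funext x
      by_cases h : x = 0
      · simp [Instr.run, h, h4]
      · simp [Instr.run, h, hx]

end Frechet
end

noncomputable section
namespace Frechet
open Set

variable {M : Model}

/-! The reduction as a program -/

/-- Replace the formula in memory by the two curves. -/
def prepProg (d p q : ℕ) : Program M :=
  .seq (setupProg p q) (.seq (fillProg leftProg d 8 0) (.seq (fillProg rightProg d 9 1)
    (.seq clearProg moveProg)))

/-- A bound for the number of steps of `prepProg`. -/
def prepSteps (p q N K : ℕ) : ℕ :=
  (3 * blockSize p q N + 6 * q + 6 * p + 60) + ((curveSize p q N K q * (13 * N + 39) + 2) +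
    ((curveSize p q N K p * (13 * N + 39) + 2) + ((4 * (K * N) + 3) + 30)))

/-- The first curve for a formula. -/
def leftInput (M : Model) (d p q : ℕ) {N K : ℕ} (F : CNF N K) :
    Fin (curveSize p q N K q) → Fin d → M.S :=
  leftCurve M _ d K ((2 ^ blockSize p q N) ^ q) (failBit F 0 (min (blockSize p q N * q) N))

/-- The second curve for a formula. -/
def rightInput (M : Model) (d p q : ℕ) {N K : ℕ} (F : CNF N K) :
    Fin (curveSize p q N K p) → Fin d → M.S :=
  rightCurve M _ d K ((2 ^ blockSize p q N) ^ p) (failBit F (blockSize p q N * q) N)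

theorem flatten_le {a b : ℕ} {f : Fin a → Fin b → ℕ} {c : ℕ} (h : ∀ i j, f i j ≤ c) (k : ℕ) :
    flatten f k ≤ c := by
  unfold flatten
  split_ifs
  · exact h _ _
  · exact Nat.zero_le c

theorem good_input [SmallScalars M] {E d p q N K : ℕ} (hE : Fits E d p q N K) (F : CNF N K) :
    Good E (F.input M) := by
  obtain ⟨hc, hs, hcl, hcu⟩ := hE
  refine ⟨fun r => ?_, fun A i => ?_, fun x => ?_⟩
  · simp only [CNF.input]
    split_ifs <;> omega
  · have h1 : 1 < 2 ^ E := by omega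
    refine lt_of_le_of_lt ?_ h1
    simp only [CNF.input]
    split_ifs
    · exact flatten_le (fun i j => by split_ifs <;> simp) i
    · exact flatten_le (fun i j => by split_ifs <;> simp) i
    · exact Nat.zero_le 1
  · have := SmallScalars.size_le (M := M) 0 (by norm_num)
    simpa [CNF.input] using this

/-- The final memory must equal the input memory in every cell, since nothing is known about the
approximation program on other memories. This is why scratch registers and arrays are cleared. -/
theorem runs_prepProg [SmallScalars M] {E d p q N K : ℕ} (hp : 1 ≤ p) (hpq : p ≤ q) (hd : 2 ≤ d)
    (hE : Fits E d p q N K) (F : CNF N K) :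
    Runs E (prepProg d p q) (F.input M) (prepSteps p q N K) fun τ =>
      τ = curvesInput M (leftInput M d p q F) (rightInput M d p q F) := by
  have hσ := good_input (M := M) hE F
  have hU : 0 < 2 ^ blockSize p q N * (2 * K + 5) := by positivity
  have hmn : curveSize p q N K p ≤ curveSize p q N K q := Nat.pow_le_pow_right hU hpq
  have hcu := hE.curve
  have hcu' : d * curveSize p q N K p < 2 ^ E := (Nat.mul_le_mul_left d hmn).trans_lt hcu
  have hc := hE.const
  refine Runs.seq_le ((runs_setupProg hσ hp hpq hd hE rfl rfl rfl).frame (setupProg_writes p q))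
    le_rfl ?_
  rintro σ1 hσ1 ⟨P1, f1⟩
  have F1 : HoldsCNF F σ1 := ⟨by rw [f1.arr]; rfl, by rw [f1.arr]; rfl⟩
  refine Runs.seq_le (runs_fillProg (s := 13 * N + 30) (X := leftX K ((2 ^ blockSize p q N) ^ q)
    (failBit F 0 (min (blockSize p q N * q) N))) (Y := leftY K ((2 ^ blockSize p q N) ^ q)) hd
    (by norm_num) hσ1 P1.h8 P1.h2 hcu (by omega) (fun v => (leftX_le v).trans (by norm_num))
    (fun v => (leftY_le v).trans (by norm_num)) leftProg_writes ?_ (by rw [f1.sarr]; rfl)) le_rfl ?_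
  · intro v τ hv hτ hr ha h15
    exact runs_leftProg F hτ ⟨by rw [ha, F1.1], by rw [ha, F1.2]⟩ hE.clauses (by omega)
      (P1.congr hr) h15
  rintro σ2 hσ2 ⟨f2, s2⟩
  have P2 := P1.congr fun r hr => f2.reg r (.inl hr)
  have F2 : HoldsCNF F σ2 := ⟨by rw [f2.arr, F1.1], by rw [f2.arr, F1.2]⟩
  refine Runs.seq_le (runs_fillProg (s := 13 * N + 30)
    (X := rightX K ((2 ^ blockSize p q N) ^ p) (failBit F (blockSize p q N * q) N))
    (Y := rightY K ((2 ^ blockSize p q N) ^ p)) hd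
    (by norm_num) hσ2 P2.h9 P2.h2 hcu' (by omega)
    (fun v => rightX_le (failBit_le F _ _) v)
    (fun v => (rightY_le v).trans (by norm_num)) rightProg_writes ?_
    (by rw [f2.sarr 1 (by norm_num), f1.sarr]; rfl)) le_rfl ?_
  · intro v τ hv hτ hr ha h15
    exact runs_rightProg F hτ ⟨by rw [ha, F2.1], by rw [ha, F2.2]⟩ hE.clauses (by omega)
      (P2.congr hr) h15
  rintro σ3 hσ3 ⟨f3, s3⟩
  have P3 := P2.congr fun r hr => f3.reg r (.inl hr)
  have F3 : HoldsCNF F σ3 := ⟨by rw [f3.arr, F2.1], by rw [f3.arr, F2.2]⟩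
  refine Runs.seq_le (runs_clearProg F hσ3 F3 ?_ hE.clauses P3.h0 P3.h1 P3.h2 P3.h4) le_rfl ?_
  · intro A hA
    rw [f3.arr, f2.arr, f1.arr]
    simp only [CNF.input]
    rw [if_neg (by omega), if_neg (by omega)]
  rintro σ4 hσ4 ⟨a4, r4, x4, s4⟩
  refine (runs_moveProg (n := curveSize p q N K q) (m := curveSize p q N K p) hσ4 ?_ ?_ ?_ ?_
    ?_).mono le_rfl ?_
  · rw [r4 4 (.inl (by norm_num)), P3.h4]
  · rw [r4 8 (.inl (by norm_num)), P3.h8]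
  · rw [r4 9 (.inl (by norm_num)), P3.h9]
  · intro r hr
    rw [r4 r (.inr hr), f3.reg r (.inr hr), f2.reg r (.inr hr), f1.reg r (by omega)]
    simp only [CNF.input]
    rw [if_neg (by omega), if_neg (by omega)]
  · intro x hx
    rw [x4, f3.sreg x hx, f2.sreg x hx, f1.sreg]
    rfl
  · rintro ⟨reg, arr, sreg, sarr⟩ ⟨e1, e2, e3, e4⟩
    simp only at e1 e2 e3 e4
    subst e1 e2
    rw [a4] at e3
    rw [s4] at e4
    subst e3 e4
    unfold curvesInput
    congr 1
    funext A
    split_ifs with h1 h2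
    · rw [h1, f3.sarr 0 (by norm_num), s2]; rfl
    · rw [h2, s3]; rfl
    · rw [f3.sarr A h2, f2.sarr A h1, f1.sarr]; rfl

/-- Room for the construction: `2 * K + 5` vertices per vector suffice for the `2 * K + 4` vertices
of a left block or the `2 * K + 1` of a right zigzag, together with the ends of the curves. -/
theorem le_curveSize {p q N K e : ℕ} (he : 1 ≤ e) :
    (2 ^ blockSize p q N) ^ e * (2 * K + 5) ≤ curveSize p q N K e := by
  rw [curveSize, mul_pow]
  exact Nat.mul_le_mul_left _ (Nat.le_self_pow (by omega) _)

theorem le_blockSize {p q : ℕ} (hp : 1 ≤ p) (N : ℕ) :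
    N ≤ blockSize p q N * q + blockSize p q N * p := by
  have h1 := Nat.div_add_mod N (p + q)
  have h2 := Nat.mod_lt N (show p + q > 0 by omega)
  have h3 : blockSize p q N * q + blockSize p q N * p = (p + q) * (N / (p + q)) + (p + q) := by
    unfold blockSize; ring
  omega

section

variable {d p q N K : ℕ} [NeZero (curveSize p q N K q)] [NeZero (curveSize p q N K p)]

theorem dist_input_le (v : Variant) (hd : 2 ≤ d) (hp : 1 ≤ p) (hpq : p ≤ q) (F : CNF N K)
    (h : F.Satisfiable) :
    dist v (points M (leftInput M d p q F)) (points M (rightInput M d p q F)) ≤ 1000 := by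
  rw [satisfiable_iff F (le_blockSize (q := q) hp N), pow_mul, pow_mul] at h
  have h1 := le_curveSize (p := p) (q := q) (N := N) (K := K) (hp.trans hpq)
  have h2 := le_curveSize (p := p) (q := q) (N := N) (K := K) hp
  have p1 : 0 < (2 ^ blockSize p q N) ^ q := by positivity
  have p2 : 0 < (2 ^ blockSize p q N) ^ p := by positivity
  exact dist_le_of_orthogonal v hd (failBit_le F _ _) (failBit_le F _ _) (by nlinarith)
    (by nlinarith) h

theorem le_dist_input (v : Variant) (hd : 2 ≤ d) (hp : 1 ≤ p) (hpq : p ≤ q) (F : CNF N K)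
    (h : ¬ F.Satisfiable) :
    1001.5 ≤ dist v (points M (leftInput M d p q F)) (points M (rightInput M d p q F)) := by
  -- A formula without clauses is satisfiable, so the vectors are not empty.
  have hK : 0 < K := by
    rcases Nat.eq_zero_or_pos K with rfl | hK
    · exact absurd ⟨fun _ => true, fun j => j.elim0⟩ h
    · exact hK
  rw [satisfiable_iff F (le_blockSize (q := q) hp N), pow_mul, pow_mul] at h
  have h1 := le_curveSize (p := p) (q := q) (N := N) (K := K) (hp.trans hpq)
  have h2 := le_curveSize (p := p) (q := q) (N := N) (K := K) hp
  have p1 : 0 < (2 ^ blockSize p q N) ^ q := by positivity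
  have p2 : 0 < (2 ^ blockSize p q N) ^ p := by positivity
  exact le_dist_of_not_orthogonal v hd (by nlinarith)
    (by nlinarith) p2 hK h

end

theorem coordSize_planeCoords_le [SmallScalars M] {n d : ℕ} {X Y : ℕ → ℕ} (hX : ∀ v, X v ≤ 1085)
    (hY : ∀ v, Y v ≤ 1085) : coordSize M (planeCoords M n d X Y) ≤ 20 := by
  refine Finset.sup_le fun i _ => Finset.sup_le fun k _ => ?_
  unfold planeCoords
  split_ifs
  · exact SmallScalars.size_le _ (hX _)
  · exact SmallScalars.size_le _ (hY _)
  · simpa using SmallScalars.size_le (M := M) 0 (by norm_num)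

theorem coordSize_input_le [SmallScalars M] (d p q : ℕ) {N K : ℕ} (F : CNF N K) :
    max (coordSize M (leftInput M d p q F)) (coordSize M (rightInput M d p q F)) ≤ 20 :=
  max_le (coordSize_planeCoords_le (fun v => (leftX_le v).trans (by norm_num))
      (fun v => (leftY_le v).trans (by norm_num)))
    (coordSize_planeCoords_le (fun v => rightX_le (failBit_le F _ _) v)
      (fun v => (rightY_le v).trans (by norm_num)))

/-- The program deciding satisfiability by means of a program `P` approximating the Fréchet
distance. -/
def satProg (d p q : ℕ) (P : Program M) : Program M :=
  .seq (prepProg d p q) (.seq P (.seq (block (.const 2 1001) [.ofNat 1 2])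
    (.cond (.slt 1 0) (.basic (.const 0 0)) (.basic (.const 0 1)))))

/-- The second `t` in the bound pays for reading the computed scalar, whose size is at most 20 plus
the running time that produced it. -/
theorem exec_satProg [SmallScalars M] {E d p q N K : ℕ} (hp : 1 ≤ p) (hpq : p ≤ q) (hd : 2 ≤ d)
    (hE : Fits E d p q N K) (F : CNF N K) {P : Program M} {τ : State M} {t : ℕ}
    (h : Exec P (curvesInput M (leftInput M d p q F) (rightInput M d p q F)) τ t) :
    ∃ τ' t', Exec (satProg d p q P) (F.input M) τ' t' ∧
      t' ≤ prepSteps p q N K * unitCost E + 2 * t + 100 ∧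
      (τ'.reg 0 = 1 ↔ ¬ (1001 : ℝ) < M.val (τ.sreg 0)) := by
  obtain ⟨_, t1, h1, h1t, -, rfl⟩ := runs_prepProg (M := M) hp hpq hd hE F
  have hs := h.size_sreg_le 0
  have hs0 : M.size ((curvesInput M (leftInput M d p q F) (rightInput M d p q F)).sreg 0) ≤ 20 := by
    have h0 := SmallScalars.size_le (M := M) 0 (by norm_num)
    rwa [Nat.cast_zero] at h0
  have hsize := SmallScalars.size_le (M := M) 1001 (by norm_num)
  have hbits : bits 1001 ≤ 11 := Nat.succ_le_succ (Nat.size_le.2 (by norm_num))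
  have hb0 : bits 0 ≤ 2 := Nat.succ_le_succ (Nat.size_le.2 (by norm_num))
  have hb1 : bits 1 ≤ 2 := Nat.succ_le_succ (Nat.size_le.2 (by norm_num))
  have e2 := Exec.basic (.const 2 1001) τ
  have e3 := Exec.basic (.ofNat 1 2) ((Instr.const 2 1001 : Instr M).run τ)
  set τ3 := (Instr.ofNat 1 2 : Instr M).run ((Instr.const 2 1001 : Instr M).run τ) with hτ3
  have s0 : τ3.sreg 0 = τ.sreg 0 := by simp [hτ3, Instr.run]
  have s1 : τ3.sreg 1 = ((1001 : ℕ) : M.S) := by simp [hτ3, Instr.run]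
  have v1 : M.val (τ3.sreg 1) = 1001 := by rw [s1, map_natCast]; norm_num
  have c2 : (Instr.const 2 1001 : Instr M).cost τ ≤ 11 := hbits
  have c3 : (Instr.ofNat 1 2 : Instr M).cost ((Instr.const 2 1001 : Instr M).run τ) ≤ 31 := by
    simp only [Instr.cost, Instr.run, Function.update_self]
    omega
  have c4 : (Test.slt 1 0).cost τ3 ≤ 40 + t := by
    simp only [Test.cost, s0, s1]
    omega
  by_cases hlt : (1001 : ℝ) < M.val (τ.sreg 0)
  · have hold : (Test.slt 1 0).holds τ3 := by
      show M.val (τ3.sreg 1) < M.val (τ3.sreg 0)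
      rw [v1, s0]; exact hlt
    refine ⟨_, _, .seq h1 (.seq h (.seq (.seq e2 e3) (.condTrue hold (.basic _ _)))), ?_, ?_⟩
    · have : (Instr.const 0 0 : Instr M).cost τ3 ≤ 2 := hb0
      omega
    · simp [Instr.run, hlt]
  · have hold : ¬ (Test.slt 1 0).holds τ3 := by
      show ¬ M.val (τ3.sreg 1) < M.val (τ3.sreg 0)
      rw [v1, s0]; exact hlt
    refine ⟨_, _, .seq h1 (.seq h (.seq (.seq e2 e3) (.condFalse hold (.basic _ _)))), ?_, ?_⟩
    · have : (Instr.const 0 1 : Instr M).cost τ3 ≤ 2 := hb1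
      omega
    · simp [Instr.run, hlt]

/-! Running time -/

/-- For fixed `d`, `p`, `q` the largest numbers are `2 ^ O(N + K)`; factors such as `2 * K + 5` and
`d` are bounded crudely by powers of two. -/
theorem exists_fits {d p q : ℕ} (hp : 1 ≤ p) (hd : 2 ≤ d) :
    ∃ c : ℕ, ∀ N K : ℕ, Fits (c * (N + K + 1)) d p q N K := by
  refine ⟨3000 + 2 * d + 2 * p + 10 * q, fun N K => ?_⟩
  have hu : blockSize p q N * (p + q) ≤ N + p + q := by
    have := Nat.div_mul_le_self N (p + q)
    unfold blockSize
    rw [Nat.add_mul]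
    omega
  have hu' : blockSize p q N ≤ N + 1 := Nat.succ_le_succ (Nat.div_le_self _ _)
  have key : ∀ {x y : ℕ}, x < 2 ^ y → y ≤ (3000 + 2 * d + 2 * p + 10 * q) * (N + K + 1) →
      x < 2 ^ ((3000 + 2 * d + 2 * p + 10 * q) * (N + K + 1)) := fun h h' =>
    h.trans_le (Nat.pow_le_pow_right (by norm_num) h')
  refine ⟨key Nat.lt_two_pow_self ?_, (key Nat.lt_two_pow_self (by nlinarith)).trans_le' hu, ?_, ?_⟩
  · nlinarith [Nat.zero_le (d * N), Nat.zero_le (d * K), Nat.zero_le (p * N), Nat.zero_le (p * K),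
      Nat.zero_le (q * N), Nat.zero_le (q * K)]
  · refine key (y := (K + 1) + N) ?_ ?_
    · calc K * N + N = (K + 1) * N := by ring
        _ < 2 ^ (K + 1) * 2 ^ N := Nat.mul_lt_mul'' Nat.lt_two_pow_self Nat.lt_two_pow_self
        _ = _ := (pow_add 2 (K + 1) N).symm
    · nlinarith [Nat.zero_le (d * N), Nat.zero_le (d * K), Nat.zero_le (p * N), Nat.zero_le (p * K),
        Nat.zero_le (q * N), Nat.zero_le (q * K)]
  · refine key (y := d + (blockSize p q N + (2 * K + 5)) * q) ?_ ?_
    · rw [pow_add, pow_mul, pow_add, curveSize]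
      refine Nat.mul_lt_mul_of_lt_of_le Nat.lt_two_pow_self ?_ (by positivity)
      exact Nat.pow_le_pow_left (Nat.mul_le_mul_left _ Nat.lt_two_pow_self.le) _
    · have : (blockSize p q N + (2 * K + 5)) * q ≤ (N + 1 + (2 * K + 5)) * q :=
        Nat.mul_le_mul_right _ (by omega)
      nlinarith [Nat.zero_le (d * N), Nat.zero_le (d * K), Nat.zero_le (p * N), Nat.zero_le (p * K),
        Nat.zero_le (q * N), Nat.zero_le (q * K)]

/-- Up to a polynomial factor the longer curve has `2 ^ (N q / (p + q))` vertices, and `p ≥ 1` makes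
this exponentially smaller than `2 ^ N`. -/
theorem curveSize_le {p q : ℕ} (hp : 1 ≤ p) (N K : ℕ) :
    (curveSize p q N K q : ℝ) ≤
      ((2 : ℝ) ^ ((q : ℝ) / (p + q))) ^ N * (10 * ((N : ℝ) + K + 1)) ^ q := by
  have hpq : (0 : ℝ) < (p : ℝ) + q := by positivity
  have hu : (blockSize p q N : ℝ) ≤ N / (p + q) + 1 := by
    have := Nat.cast_div_le (α := ℝ) (m := N) (n := p + q)
    unfold blockSize
    push_cast at this ⊢
    linarith
  have h1 : ((2 : ℝ) ^ blockSize p q N) ^ q ≤ ((2 : ℝ) ^ ((q : ℝ) / (p + q))) ^ N * 2 ^ q := by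
    rw [← pow_mul, ← Real.rpow_natCast, ← Real.rpow_natCast, ← Real.rpow_natCast, ← Real.rpow_mul
      (by norm_num), ← Real.rpow_add (by norm_num)]
    refine Real.rpow_le_rpow_of_exponent_le (by norm_num) ?_
    push_cast
    calc (blockSize p q N : ℝ) * q ≤ (N / (p + q) + 1) * q := by gcongr
      _ = _ := by field_simp
  unfold curveSize
  push_cast
  calc ((2 : ℝ) ^ blockSize p q N * (2 * K + 5)) ^ q
      = ((2 : ℝ) ^ blockSize p q N) ^ q * (2 * K + 5) ^ q := mul_pow _ _ _
    _ ≤ ((2 : ℝ) ^ ((q : ℝ) / (p + q))) ^ N * 2 ^ q * (5 * ((N : ℝ) + K + 1)) ^ q := by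
        gcongr
        have := Nat.cast_nonneg (α := ℝ) N
        have := Nat.cast_nonneg (α := ℝ) K
        linarith
    _ = _ := by rw [mul_assoc, ← mul_pow]; ring

/-- The exponents of the two sizes add up to `blockSize p q N * (p + q)`, which exceeds `N` by at
most the constant `p + q`. -/
theorem curveSize_mul_le (p q N K : ℕ) :
    (curveSize p q N K q : ℝ) * curveSize p q N K p ≤
      2 ^ N * (10 * ((N : ℝ) + K + 1)) ^ (p + q) := by
  have hu : blockSize p q N * (p + q) ≤ N + (p + q) := by
    have := Nat.div_mul_le_self N (p + q)
    unfold blockSize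
    rw [Nat.add_mul]
    omega
  have h1 : ((2 : ℝ) ^ blockSize p q N) ^ (p + q) ≤ 2 ^ N * 2 ^ (p + q) := by
    rw [← pow_mul, ← pow_add]
    exact pow_le_pow_right₀ (by norm_num) hu
  unfold curveSize
  push_cast
  calc ((2 : ℝ) ^ blockSize p q N * (2 * K + 5)) ^ q * ((2 : ℝ) ^ blockSize p q N * (2 * K + 5)) ^ p
      = ((2 : ℝ) ^ blockSize p q N) ^ (p + q) * (2 * K + 5) ^ (p + q) := by
        rw [← pow_add, add_comm q p, mul_pow]
    _ ≤ 2 ^ N * 2 ^ (p + q) * (5 * ((N : ℝ) + K + 1)) ^ (p + q) := by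
        gcongr
        have := Nat.cast_nonneg (α := ℝ) N
        have := Nat.cast_nonneg (α := ℝ) K
        linarith
    _ = _ := by rw [mul_assoc, ← mul_pow]; ring

theorem curveSize_pos (p q N K e : ℕ) : 0 < curveSize p q N K e :=
  Nat.pow_pos (by positivity)

theorem prepSteps_le {p q : ℕ} (hpq : p ≤ q) (N K : ℕ) :
    prepSteps p q N K ≤ curveSize p q N K q * ((300 + 6 * p + 6 * q) * (N + K + 1) ^ 2) := by
  have hU : 0 < 2 ^ blockSize p q N * (2 * K + 5) := by positivity
  have hmn : curveSize p q N K p ≤ curveSize p q N K q := Nat.pow_le_pow_right hU hpq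
  have hn := curveSize_pos p q N K q
  have hu : blockSize p q N ≤ N + 1 := Nat.succ_le_succ (Nat.div_le_self _ _)
  unfold prepSteps
  set n := curveSize p q N K q
  set m := curveSize p q N K p
  set r := 3 * blockSize p q N + 6 * q + 6 * p + 4 * (K * N) + 97
  have h1 : m * (13 * N + 39) ≤ n * (13 * N + 39) := Nat.mul_le_mul_right _ hmn
  have h2 : r ≤ n * r := Nat.le_mul_of_pos_left _ hn
  have h3 : 2 * (13 * N + 39) + r ≤ (300 + 6 * p + 6 * q) * (N + K + 1) ^ 2 := by
    simp only [r]
    have h4 : 1 ≤ (N + K + 1) ^ 2 := Nat.one_le_pow _ _ (by omega)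
    nlinarith [Nat.zero_le (K * N), Nat.zero_le (N * N), Nat.zero_le (K * K),
      Nat.mul_le_mul_left (6 * p) h4, Nat.mul_le_mul_left (6 * q) h4]
  calc _ = n * (13 * N + 39) + m * (13 * N + 39) + r := by simp only [r]; omega
    _ ≤ n * (13 * N + 39) + n * (13 * N + 39) + n * r := by omega
    _ = n * (2 * (13 * N + 39) + r) := by ring
    _ ≤ _ := Nat.mul_le_mul_left _ h3

/-- The two curves satisfy the polynomial restriction. -/
theorem curveSize_restrict {p q N K : ℕ} {a b : ℝ} (ha : q * a ≤ p) (hb : p ≤ q * b) :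
    (curveSize p q N K q : ℝ) ^ a ≤ curveSize p q N K p ∧
      (curveSize p q N K p : ℝ) ≤ (curveSize p q N K q : ℝ) ^ b := by
  have hU : (1 : ℝ) ≤ ((2 ^ blockSize p q N * (2 * K + 5) : ℕ) : ℝ) := by
    exact_mod_cast Nat.succ_le_of_lt (by positivity)
  unfold curveSize
  -- Both sizes are powers of the same number, at least 1, with exponents `q` and `p`; only
  -- exponents have to be compared.
  rw [Nat.cast_pow, Nat.cast_pow, ← Real.rpow_natCast, ← Real.rpow_natCast,
    ← Real.rpow_mul (by linarith), ← Real.rpow_mul (by linarith)]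
  exact ⟨Real.rpow_le_rpow_of_exponent_le hU ha, Real.rpow_le_rpow_of_exponent_le hU hb⟩

/-- The ratio is a rational number strictly between `max 0 (γ - η)` and `min 1 (γ + η)`. This
interval is nonempty even for `γ = 0` and `γ = 1`. -/
theorem exists_ratio {γ η : ℝ} (h0 : 0 ≤ γ) (h1 : γ ≤ 1) (hη : 0 < η) :
    ∃ p q : ℕ, 1 ≤ p ∧ p ≤ q ∧ q * (γ - η) ≤ p ∧ p ≤ q * (γ + η) := by
  obtain ⟨r, hr, hr'⟩ := exists_rat_btwn
    (show max 0 (γ - η) < min 1 (γ + η) by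
      rw [max_lt_iff, lt_min_iff, lt_min_iff]; refine ⟨⟨?_, ?_⟩, ?_, ?_⟩ <;> linarith)
  rw [max_lt_iff] at hr
  rw [lt_min_iff] at hr'
  have hr0 : 0 < r := by exact_mod_cast hr.1
  have hr1 : r < 1 := by exact_mod_cast hr'.1
  have hd : (0 : ℝ) < r.den := by exact_mod_cast r.den_pos
  have hnum : 0 < r.num := Rat.num_pos.2 hr0
  have hcast : ((r.num.natAbs : ℕ) : ℝ) = r.num := by
    rw [Nat.cast_natAbs, abs_of_pos hnum]
  have hr_eq : (r.num : ℝ) = r.den * (r : ℝ) := by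
    rw [Rat.cast_def]; field_simp
  refine ⟨r.num.natAbs, r.den, by omega, ?_, ?_, ?_⟩
  · have : ((r.num.natAbs : ℕ) : ℝ) ≤ r.den := by
      rw [hcast, hr_eq]; exact mul_le_of_le_one_right hd.le hr'.1.le
    exact_mod_cast this
  · rw [hcast, hr_eq]; gcongr; exact hr.2.le
  · rw [hcast, hr_eq]; gcongr; exact hr'.2.le

theorem prepTime_le {p q : ℕ} (hp : 1 ≤ p) (hpq : p ≤ q) (e N K : ℕ) {b : ℝ}
    (hb : (2 : ℝ) ^ ((q : ℝ) / (p + q)) ≤ b) :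
    ((prepSteps p q N K * unitCost (e * (N + K + 1)) : ℕ) : ℝ) ≤
      (300 + 6 * p + 6 * q) * (3 * e + 30) * 10 ^ q * ((N : ℝ) + K + 1) ^ (p + q + 3) * b ^ N := by
  have hN := Nat.cast_nonneg (α := ℝ) N
  have hK := Nat.cast_nonneg (α := ℝ) K
  have hb0 : 0 ≤ b := le_trans (by positivity) hb
  have s1 : (prepSteps p q N K : ℝ) ≤
      curveSize p q N K q * ((300 + 6 * p + 6 * q) * ((N : ℝ) + K + 1) ^ 2) := by
    exact_mod_cast prepSteps_le hpq N K
  have s2 : (unitCost (e * (N + K + 1)) : ℝ) ≤ (3 * e + 30) * ((N : ℝ) + K + 1) := by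
    unfold unitCost
    push_cast
    nlinarith
  have s3 : (curveSize p q N K q : ℝ) ≤ b ^ N * (10 * ((N : ℝ) + K + 1)) ^ q :=
    (curveSize_le hp N K).trans (by gcongr)
  rw [Nat.cast_mul]
  generalize hx : (N : ℝ) + K + 1 = x at *
  have hx1 : 1 ≤ x := by linarith
  have hx0 : 0 ≤ x := by linarith
  have hxp : x ^ (q + 3) ≤ x ^ (p + q + 3) := pow_le_pow_right₀ hx1 (by omega)
  calc (prepSteps p q N K : ℝ) * (unitCost (e * (N + K + 1)) : ℝ)
      ≤ (b ^ N * (10 * x) ^ q * ((300 + 6 * p + 6 * q) * x ^ 2)) * ((3 * e + 30) * x) :=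
        mul_le_mul (s1.trans (mul_le_mul_of_nonneg_right s3 (by positivity))) s2 (by positivity)
          (by positivity)
    _ = (300 + 6 * p + 6 * q) * (3 * e + 30) * 10 ^ q * x ^ (q + 3) * b ^ N := by
        rw [mul_pow]; ring
    _ ≤ _ := by gcongr

theorem rpow_curveSize_mul_le (p q N K : ℕ) {δ δ' b : ℝ} (h : δ' ≤ δ) (h0 : 0 ≤ δ') (h1 : δ' ≤ 1)
    (hb : (2 : ℝ) ^ (1 - δ') ≤ b) :
    ((curveSize p q N K q : ℝ) * curveSize p q N K p) ^ (1 - δ) ≤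
      b ^ N * (10 * ((N : ℝ) + K + 1)) ^ (p + q) := by
  have hN := Nat.cast_nonneg (α := ℝ) N
  have hK := Nat.cast_nonneg (α := ℝ) K
  have hn : (1 : ℝ) ≤ curveSize p q N K q := Nat.one_le_cast.2 (curveSize_pos ..)
  have hm : (1 : ℝ) ≤ curveSize p q N K p := Nat.one_le_cast.2 (curveSize_pos ..)
  have h10 : 1 ≤ (10 * ((N : ℝ) + K + 1)) ^ (p + q) := one_le_pow₀ (by linarith)
  have h2 : ((2 : ℝ) ^ N) ^ (1 - δ') = ((2 : ℝ) ^ (1 - δ')) ^ N := by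
    rw [← Real.rpow_natCast, ← Real.rpow_mul (by norm_num), mul_comm,
      Real.rpow_mul_natCast (by norm_num)]
  calc _ ≤ ((curveSize p q N K q : ℝ) * curveSize p q N K p) ^ (1 - δ') :=
        Real.rpow_le_rpow_of_exponent_le (one_le_mul_of_one_le_of_one_le hn hm) (by linarith)
    _ ≤ (2 ^ N * (10 * ((N : ℝ) + K + 1)) ^ (p + q)) ^ (1 - δ') :=
        Real.rpow_le_rpow (by positivity) (curveSize_mul_le p q N K) (by linarith)
    _ = ((2 : ℝ) ^ (1 - δ')) ^ N * ((10 * ((N : ℝ) + K + 1)) ^ (p + q)) ^ (1 - δ') := by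
        rw [Real.mul_rpow (by positivity) (by positivity), h2]
    _ ≤ _ := by
        have h3 : ((2 : ℝ) ^ (1 - δ')) ^ N ≤ b ^ N := pow_le_pow_left₀ (by positivity) hb N
        have h4 := Real.rpow_le_rpow_of_exponent_le h10 (show 1 - δ' ≤ 1 by linarith)
        rw [Real.rpow_one] at h4
        exact mul_le_mul h3 h4 (by positivity) ((by positivity : (0 : ℝ) ≤ _).trans h3)

theorem not_hasApproxAlgorithm [SmallScalars M] (hSETH : SETHPrime M) (v : Variant) {d : ℕ}
    (hd : 2 ≤ d) {δ γ η : ℝ} (hδ : 0 < δ) (h0 : 0 ≤ γ) (h1 : γ ≤ 1) (hη : 0 < η) :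
    ¬ HasApproxAlgorithm M v d 1.001
      (fun n m => (n : ℝ) ^ (γ - η) ≤ m ∧ (m : ℝ) ≤ (n : ℝ) ^ (γ + η))
      (fun n m => ((n : ℝ) * m) ^ (1 - δ)) := by
  rintro ⟨P, c, k, hP⟩
  obtain ⟨p, q, hp, hpq, ha, hb⟩ := exists_ratio h0 h1 hη
  obtain ⟨e, he⟩ := exists_fits (q := q) hp hd
  -- For `δ > 1` the exponent `1 - δ` would be negative. A smaller `δ` only weakens the time bound,
  -- since both curves have at least one vertex.
  set δ' := min δ (1 / 2) with hδ'
  have hδ0 : 0 < δ' := lt_min hδ (by norm_num)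
  have hδ1 : δ' ≤ 1 / 2 := min_le_right _ _
  have hp' : (1 : ℝ) ≤ p := by exact_mod_cast hp
  have hq' : (1 : ℝ) ≤ q := by exact_mod_cast hp.trans hpq
  -- The two terms stem from the running time of the approximation and from the time to write the
  -- curves.
  set base := max ((2 : ℝ) ^ (1 - δ')) ((2 : ℝ) ^ ((q : ℝ) / (p + q))) with hbase
  have hbase2 : base < 2 := by
    have key : ∀ x : ℝ, x < 1 → (2 : ℝ) ^ x < 2 := fun x hx => by
      simpa using Real.rpow_lt_rpow_of_exponent_lt (by norm_num : (1 : ℝ) < 2) hx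
    refine max_lt (key _ (by linarith)) (key _ ?_)
    rw [div_lt_one (by positivity)]; linarith
  have hbase1 : 1 ≤ base := le_max_of_le_left (Real.one_le_rpow (by norm_num) (by linarith))
  let C : ℝ := (300 + 6 * p + 6 * q) * (3 * e + 30) * 10 ^ q + 2 * |c| * 20 ^ k * 10 ^ (p + q) + 100
  refine hSETH ⟨2 - base, by linarith, by linarith, satProg d p q P, C, p + q + 3, fun N K F => ?_⟩
  have : NeZero (curveSize p q N K q) := ⟨(curveSize_pos p q N K q).ne'⟩
  have : NeZero (curveSize p q N K p) := ⟨(curveSize_pos p q N K p).ne'⟩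
  have hmn : curveSize p q N K p ≤ curveSize p q N K q := Nat.pow_le_pow_right (by positivity) hpq
  obtain ⟨τ, t, hex, ht, hlow, hupp⟩ := hP _ _ hmn (curveSize_restrict ha hb)
    (leftInput M d p q F) (rightInput M d p q F)
  obtain ⟨τ', t', hex', ht', hout⟩ := exec_satProg hp hpq hd (he N K) F hex
  refine ⟨τ', t', hex', ?_, ?_⟩
  · have hN := Nat.cast_nonneg (α := ℝ) N
    have hK := Nat.cast_nonneg (α := ℝ) K
    have hS := prepTime_le hp hpq e N K (le_max_right ((2 : ℝ) ^ (1 - δ')) _)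
    have t1 := rpow_curveSize_mul_le p q N K (min_le_left δ (1 / 2)) hδ0.le (by linarith)
      (le_max_left _ ((2 : ℝ) ^ ((q : ℝ) / (p + q))))
    rw [← hbase] at hS t1
    have t2 : (((max (coordSize M (leftInput M d p q F))
        (coordSize M (rightInput M d p q F)) : ℕ) : ℝ)) ^ k ≤ 20 ^ k := by
      gcongr
      exact_mod_cast coordSize_input_le d p q F
    have ht'' : (t' : ℝ) ≤ ((prepSteps p q N K * unitCost (e * (N + K + 1)) : ℕ) : ℝ) +
        2 * t + 100 := by exact_mod_cast ht'
    have hbN : 1 ≤ base ^ N := one_le_pow₀ hbase1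
    rw [show (2 : ℝ) - (2 - base) = base by ring]
    generalize hx : (N : ℝ) + K + 1 = x at *
    have hx1 : 1 ≤ x := by linarith
    have hx0 : 0 ≤ x := by linarith
    have hxp : x ^ (p + q) ≤ x ^ (p + q + 3) := pow_le_pow_right₀ hx1 (by omega)
    have hb0 : 0 ≤ base := by linarith
    have hT : (t : ℝ) ≤ |c| * 20 ^ k * 10 ^ (p + q) * x ^ (p + q + 3) * base ^ N := by
      calc (t : ℝ) ≤ c * _ * _ ^ k := ht
        _ ≤ |c| * (base ^ N * (10 * x) ^ (p + q)) * 20 ^ k := by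
            gcongr
            exact le_abs_self c
        _ = |c| * 20 ^ k * 10 ^ (p + q) * x ^ (p + q) * base ^ N := by rw [mul_pow]; ring
        _ ≤ _ := by gcongr
    have h100 : 1 ≤ x ^ (p + q + 3) * base ^ N :=
      one_le_mul_of_one_le_of_one_le (one_le_pow₀ hx1) hbN
    calc (t' : ℝ) ≤ _ := ht''
      _ ≤ (300 + 6 * p + 6 * q) * (3 * e + 30) * 10 ^ q * x ^ (p + q + 3) * base ^ N +
          2 * (|c| * 20 ^ k * 10 ^ (p + q) * x ^ (p + q + 3) * base ^ N) +
          100 * (x ^ (p + q + 3) * base ^ N) := by linarith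
      _ = _ := by simp only [C]; ring
  -- A satisfiable formula gives a value of at most `1.001 * 1000 = 1001`, an unsatisfiable one a
  -- value of at least 1001.5.
  · rw [hout]
    constructor
    · intro hle
      by_contra hF
      have := le_dist_input (M := M) (d := d) v hd hp hpq F hF
      linarith
    · intro hF
      have := dist_input_le (M := M) (d := d) v hd hp hpq F hF
      linarith

end Frechet

end

theorem theorem2 (M : Frechet.Model) (hM : M = Frechet.logCostRAM ∨ M = Frechet.realRAM)
    (hSETH : Frechet.SETHPrime M)
    (v : Frechet.Variant) (d : ℕ) (hd : 2 ≤ d) (δ : ℝ) (hδ : 0 < δ) :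
    (¬ Frechet.HasApproxAlgorithm M v d 1.001
        (fun _ _ => True)
        (fun n m => ((n : ℝ) * m) ^ (1 - δ))) ∧
    (∀ γ η : ℝ, 0 ≤ γ → γ ≤ 1 → 0 < η →
      ¬ Frechet.HasApproxAlgorithm M v d 1.001
        (fun n m => (n : ℝ) ^ (γ - η) ≤ m ∧ (m : ℝ) ≤ (n : ℝ) ^ (γ + η))
        (fun n m => ((n : ℝ) * m) ^ (1 - δ))) := by
  have : Frechet.SmallScalars M := by
    rcases hM with rfl | rfl <;> infer_instance
  have main : ∀ γ η : ℝ, 0 ≤ γ → γ ≤ 1 → 0 < η →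
      ¬ Frechet.HasApproxAlgorithm M v d 1.001
        (fun n m => (n : ℝ) ^ (γ - η) ≤ m ∧ (m : ℝ) ≤ (n : ℝ) ^ (γ + η))
        (fun n m => ((n : ℝ) * m) ^ (1 - δ)) := fun γ η h0 h1 hη =>
    Frechet.not_hasApproxAlgorithm hSETH v hd hδ h0 h1 hη
  refine ⟨?_, main⟩
  rintro ⟨P, c, k, hP⟩
  -- An algorithm for all instances also solves any restriction, here the one with `γ = 0` and `η =
  -- 1`.
  exact main 0 1 le_rfl zero_le_one one_pos ⟨P, c, k, fun n m _ _ hmn _ => hP n m hmn trivial⟩
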